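/- For $\alpha\ge 0$ let $T_\alpha:[0,1]\to[0,1]$ be the Pomeau–Manneville map $T_\alpha(x)=x(1+2^\alpha x^\alpha)$ for $x\in[0,1/2)$ and $T_\alpha(x)=2x-1$ for $x\in[1/2,1]$ (with $x^0=1$, so that $T_0$ is the angle-doubling map). For $\beta>0$ let $\mathcal C_*(\beta)$ be the set of all continuous, Lebesgue integrable $g:(0,1]\to[0,\infty)$ such that $g$ is decreasing, $x\mapsto x^{\beta+1}g(x)$ is increasing (both in the weak sense), and $g(x)\le 2^{\beta}(2+\beta)x^{-\beta}\int_0^1 g$ for all $x\in(0,1]$. For a function $f:[0,1]\to\mathbb R^d$ put $\|f\|_{\mathrm{Lip}}=\max_a\sup_x|f_a(x)|+\max_a\sup_{x\ne y}|f_a(x)-f_a(y)|/|x-y|$, and for $h:\mathbb R^d\to\mathbb R$ let $\|D^kh\|_\infty$ be the largest supremum norm of a partial derivative of $h$ of order $k$. Given parameters $(\alpha_n)_{n\ge1}$ and a Borel probability measure $\mu$ on $[0,1]$, let $\widetilde T_0=\mathrm{id}$, $\widetilde T_n=T_{\alpha_n}\circ\cdots\circ T_{\alpha_1}$, and $$W=W(N)=\frac1{\sqrt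 N}\sum_{i=0}^{N-1}\Bigl(f\circ\widetilde T_i-\int f\circ\widetilde T_i\,d\mu\Bigr),\qquad \Sigma_N=\int W\otimes W\,d\mu ,$$ where $(v\otimes w)_{ab}=v_aw_b$. For a positive definite matrix $\Sigma$ let $\Phi_{\Sigma}(h)$ denote the expectation of $h$ with respect to the centred normal distribution $\mathcal N(0,\Sigma)$. **Theorem.** Let $0<\beta_*<1/3$, $d\ge1$ and $L,M\ge0$. There is a constant $C>0$, depending only on $\beta_*,d,L,M$ (in particular independent of $N$), such that the following holds. Let $0\le\alpha_n\le\beta_*$ for all $n\ge1$, let $\mu$ be a probability measure on $[0,1]$ whose density with respect to Lebesgue measure belongs to $\mathcal C_*(\beta_*)$, let $N\ge2$, and let $f:[0,1]\to\mathbb R^d$ be Lipschitz continuous with $\|f\|_{\mathrm{Lip}}\le L$ and such that $\Sigma_N$ is positive definite. Then for every three times differentiable $h:\mathbb R^d\to\mathbb R$ with $\max_{k=1,2,3}\|D^kh\|_\infty\le M$, $$\Bigl|\int h(W)\,d\mu-\Phi_{\Sigma_N}(h)\Bigr|\le C\,N^{\beta_*-\frac12}(\log N)^{\frac1{\beta_*}}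 .$$ -/

import Mathlib

open MeasureTheory ProbabilityTheory unitInterval
open scoped NNReal ENNReal

namespace Intermittent

lemma pm_mem (α : ℝ≥0) (x : I) :
    (if (x : ℝ) < 1 / 2 then (x : ℝ) * (1 + 2 ^ (α : ℝ) * (x : ℝ) ^ (α : ℝ))
      else 2 * (x : ℝ) - 1) ∈ Set.Icc (0 : ℝ) 1 := by
  obtain ⟨x, hx0, hx1⟩ := x
  dsimp only
  split_ifs with h
  · have h1 : (2 : ℝ) ^ (α : ℝ) * x ^ (α : ℝ) ≤ 1 := by
      rw [← Real.mul_rpow (by norm_num) hx0]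
      exact Real.rpow_le_one (by positivity) (by linarith) α.2
    have h0 : 0 ≤ (2 : ℝ) ^ (α : ℝ) * x ^ (α : ℝ) := by positivity
    constructor
    · positivity
    · nlinarith
  · rw [not_lt] at h
    constructor <;> linarith

/-- The Pomeau–Manneville map `T_α : [0,1] → [0,1]` with parameter `α ≥ 0`
(`α = 0` gives the angle-doubling map). -/
noncomputable def pmMap (α : ℝ≥0) (x : I) : I :=
  ⟨if (x : ℝ) < 1 / 2 then (x : ℝ) * (1 + 2 ^ (α : ℝ) * (x : ℝ) ^ (α : ℝ))
    else 2 * (x : ℝ) - 1, pm_mem α x⟩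

/-- The composition `T_{α_n} ∘ ⋯ ∘ T_{α_1}`; the entry `α 0` is not used. -/
noncomputable def comp (α : ℕ → ℝ≥0) : ℕ → I → I
  | 0 => id
  | n + 1 => pmMap (α (n + 1)) ∘ comp α n

/-- The cone `C_*(β)`. Only the values of `g` on `(0,1]` matter. -/
def cone (β : ℝ) : Set (ℝ → ℝ) :=
  {g | ContinuousOn g (Set.Ioc 0 1) ∧
    IntegrableOn g (Set.Ioc 0 1) volume ∧
    (∀ x ∈ Set.Ioc (0 : ℝ) 1, 0 ≤ g x) ∧
    AntitoneOn g (Set.Ioc 0 1) ∧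
    MonotoneOn (fun x => x ^ (β + 1) * g x) (Set.Ioc 0 1) ∧
    ∀ x ∈ Set.Ioc (0 : ℝ) 1,
      g x ≤ 2 ^ β * (2 + β) * x ^ (-β) * ∫ y in Set.Ioc (0 : ℝ) 1, g y}

/-- `μ` has a density with respect to Lebesgue measure on `[0,1]` that belongs to `C_*(β)`. -/
def HasConeDensity (β : ℝ) (μ : Measure I) : Prop :=
  ∃ g ∈ cone β, μ = (volume : Measure I).withDensity (fun x => ENNReal.ofReal (g x))

variable {d : ℕ}

/-- `W(N) = N^{-1/2} ∑_{i<N} (f ∘ T̃_i - μ(f ∘ T̃_i))`. -/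
noncomputable def W (α : ℕ → ℝ≥0) (μ : Measure I) (f : I → Fin d → ℝ) (N : ℕ) (x : I) :
    Fin d → ℝ :=
  (1 / √(N : ℝ)) • ∑ i ∈ Finset.range N, (f (comp α i x) - ∫ y, f (comp α i y) ∂μ)

/-- `Σ_N = μ(W ⊗ W)`. -/
noncomputable def covMat (α : ℕ → ℝ≥0) (μ : Measure I) (f : I → Fin d → ℝ) (N : ℕ) :
    Matrix (Fin d) (Fin d) ℝ :=
  Matrix.of fun a b => ∫ x, W α μ f N x a * W α μ f N x b ∂μ

/-- `‖f‖_Lip = max_a sup |f_a| + max_a sup_{x ≠ y} |f_a(x) - f_a(y)| / |x - y|`,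
which is finite exactly when `f` is Lipschitz continuous. -/
noncomputable def lipNorm (f : I → Fin d → ℝ) : ℝ≥0∞ :=
  (⨆ (a : Fin d) (x : I), ‖f x a‖ₑ) +
    ⨆ (a : Fin d) (x : I) (y : I) (_ : x ≠ y), ‖f x a - f y a‖ₑ / edist x y

/-- `h` is three times (Fréchet) differentiable. -/
def ThriceDifferentiable (h : (Fin d → ℝ) → ℝ) : Prop :=
  ∀ k < 3, Differentiable ℝ (iteratedFDeriv ℝ k h)

/-- `‖D^k h‖_∞`: the largest supremum norm of a partial derivative of `h` of order `k`. -/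
noncomputable def derivNorm (k : ℕ) (h : (Fin d → ℝ) → ℝ) : ℝ≥0∞ :=
  ⨆ (i : Fin k → Fin d) (x : Fin d → ℝ),
    ‖iteratedFDeriv ℝ k h x (fun j => Pi.single (i j) 1)‖ₑ

/-- `Φ_S(h)`: the expectation of `h` with respect to the normal distribution `N(0, S)`. -/
noncomputable def gaussianExp (S : Matrix (Fin d) (Fin d) ℝ) (h : (Fin d → ℝ) → ℝ) : ℝ :=
  ∫ z, h (WithLp.ofLp z) ∂(multivariateGaussian 0 S)

end Intermittent

/-!
Call a density regular if it is nonnegative and decreasing and becomes increasing after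
multiplication by `x ^ b`; the transfer operators of the maps preserve this class. The mass of a
regular density that has visited the right branch spreads out at least as evenly as a constant, so
two regular densities of equal mass have a constant in common, and what has not yet visited the
right branch after `n` steps has mass `O(n ^ (-γ))` whenever `β * (γ + 1) < 1`. Subtracting common
constants repeatedly couples the two densities at a polynomial rate. Conditioning on the itinerary,
which determines the past of an orbit up to a contraction, turns this loss of memory into
decorrelation at the rate `k ^ (-γ)` of Lipschitz functionals of the past and the future of the
orbit. For `β < 1 / 3` one can take `γ > 2`.

Such mixing gives Stein's identity for `W` up to `O(N ^ (-1 / 2))`: in `E[v_n p(W)]` the terms at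
distance `m = 0, 1, …` from time `n` are removed from `W` one shell at a time, with a first-order
Taylor expansion in each shell. The covariances appear as the linear terms, and the remainders are
summable because `γ > 2`. Rotating `W` into an independent Gaussian vector `Z` of the same
covariance along `cos θ • Z + sin θ • W` then bounds `E[h(W)] - E[h(Z)]` by the defect in Stein's
identity.
-/

namespace Intermittent

section Taylor

variable {E : Type*} [NormedAddCommGroup E] [NormedSpace ℝ E] {M : ℝ} {p : E → ℝ}

/-- Functions of class `C^{1,1}` with uniform bounds: `p` and its derivative are bounded by `M`, and
the derivative is `M`-Lipschitz. These are the test functions whose oscillation along a sum of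
weakly dependent terms is controlled by a Taylor expansion. -/
structure SmoothBounded (M : ℝ) (p : E → ℝ) : Prop where
  differentiable : Differentiable ℝ p
  abs_le : ∀ w, |p w| ≤ M
  norm_fderiv_le : ∀ w, ‖fderiv ℝ p w‖ ≤ M
  norm_fderiv_sub_le : ∀ w w', ‖fderiv ℝ p w - fderiv ℝ p w'‖ ≤ M * ‖w - w'‖

namespace SmoothBounded

lemma nonneg (hp : SmoothBounded M p) : 0 ≤ M :=
  (norm_nonneg _).trans (hp.norm_fderiv_le 0)

lemma continuous_fderiv (hp : SmoothBounded M p) : Continuous (fderiv ℝ p) := by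
  have hlip : LipschitzWith M.toNNReal (fderiv ℝ p) := LipschitzWith.of_dist_le_mul fun w w' => by
    rw [dist_eq_norm, dist_eq_norm, Real.coe_toNNReal _ hp.nonneg]
    exact hp.norm_fderiv_sub_le w w'
  exact hlip.continuous

lemma abs_sub_sub_fderiv_le (hp : SmoothBounded M p) (w : E) {δ δ' : E} {R : ℝ} (hδ : ‖δ‖ ≤ R)
    (hδ' : ‖δ'‖ ≤ R) :
    |p (w + δ) - p (w + δ') - fderiv ℝ p w (δ - δ')| ≤ M * R * ‖δ - δ'‖ := by
  have h := (convex_closedBall w R).norm_image_sub_le_of_norm_fderiv_le' (𝕜 := ℝ)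
    (φ := fderiv ℝ p w) (C := M * R) (x := w + δ') (y := w + δ)
    (fun x _ => hp.differentiable x)
    (fun x hx => (hp.norm_fderiv_sub_le x w).trans <| mul_le_mul_of_nonneg_left
      (by simpa [dist_eq_norm] using hx) hp.nonneg)
    (by simpa using hδ') (by simpa using hδ)
  simpa using h

lemma abs_translate_sub_le (hp : SmoothBounded M p) (w w' δ : E) :
    |p (w + δ) - p (w' + δ) - (p w - p w')| ≤ M * ‖w - w'‖ * ‖δ‖ := by
  have hderiv : ∀ z, HasFDerivAt (fun z => p (w + z) - p (w' + z))
      (fderiv ℝ p (w + z) - fderiv ℝ p (w' + z)) z := fun z =>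
    ((hasFDerivAt_comp_add_left w).2 (hp.differentiable (w + z)).hasFDerivAt).sub
      ((hasFDerivAt_comp_add_left w').2 (hp.differentiable (w' + z)).hasFDerivAt)
  have h := (convex_univ (𝕜 := ℝ) (E := E)).norm_image_sub_le_of_norm_hasFDerivWithin_le
    (C := M * ‖w - w'‖) (x := 0) (y := δ) (fun z _ => (hderiv z).hasFDerivWithinAt)
    (fun z _ => by simpa using hp.norm_fderiv_sub_le (w + z) (w' + z))
    (Set.mem_univ _) (Set.mem_univ _)
  simpa only [add_zero, sub_zero, Real.norm_eq_abs] using h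

lemma hasFDerivAt_comp_affine (hp : SmoothBounded M p) (s : ℝ) (u w : E) :
    HasFDerivAt (fun w => p (s • w + u)) (s • fderiv ℝ p (s • w + u)) w := by
  have h := (hp.differentiable (s • w + u)).hasFDerivAt.comp w
    (((hasFDerivAt_id w).const_smul s).add_const u)
  refine h.congr_fderiv ?_
  ext z
  simp

lemma comp_affine (hp : SmoothBounded M p) {s : ℝ} (hs : |s| ≤ 1) (u : E) :
    SmoothBounded M (fun w => p (s • w + u)) where
  differentiable w := (hp.hasFDerivAt_comp_affine s u w).differentiableAt
  abs_le w := hp.abs_le _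
  norm_fderiv_le w := by
    rw [(hp.hasFDerivAt_comp_affine s u w).fderiv, norm_smul, Real.norm_eq_abs]
    exact (mul_le_of_le_one_left (norm_nonneg _) hs).trans (hp.norm_fderiv_le _)
  norm_fderiv_sub_le w w' := by
    have hsub : ‖s • w + u - (s • w' + u)‖ ≤ ‖w - w'‖ := by
      rw [add_sub_add_right_eq_sub, ← smul_sub, norm_smul, Real.norm_eq_abs]
      exact mul_le_of_le_one_left (norm_nonneg _) hs
    rw [(hp.hasFDerivAt_comp_affine s u w).fderiv, (hp.hasFDerivAt_comp_affine s u w').fderiv,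
      ← smul_sub, norm_smul, Real.norm_eq_abs]
    exact (mul_le_of_le_one_left (norm_nonneg _) hs).trans
      ((hp.norm_fderiv_sub_le _ _).trans (mul_le_mul_of_nonneg_left hsub hp.nonneg))

end SmoothBounded

/-- The first-order Taylor remainder of `p` at `w` with increment `δ`. -/
noncomputable def taylorRem (p : E → ℝ) (w δ : E) : ℝ := p (w + δ) - p w - fderiv ℝ p w δ

lemma SmoothBounded.abs_taylorRem_le (hp : SmoothBounded M p) (w : E) {δ : E} {R : ℝ}
    (hδ : ‖δ‖ ≤ R) : |taylorRem p w δ| ≤ M * R * R := by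
  have hR : 0 ≤ R := (norm_nonneg _).trans hδ
  have h := hp.abs_sub_sub_fderiv_le w hδ (norm_zero.trans_le hR)
  simp only [add_zero, sub_zero] at h
  exact h.trans (mul_le_mul_of_nonneg_left hδ (mul_nonneg hp.nonneg hR))

lemma SmoothBounded.abs_taylorRem_sub_le (hp : SmoothBounded M p) (w w' : E) {δ δ' : E} {R : ℝ}
    (hδ : ‖δ‖ ≤ R) (hδ' : ‖δ'‖ ≤ R) :
    |taylorRem p w δ - taylorRem p w' δ'| ≤ M * R * (‖δ - δ'‖ + 2 * ‖w - w'‖) := by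
  have hincr := hp.abs_sub_sub_fderiv_le w hδ hδ'
  have hbase := hp.abs_translate_sub_le w w' δ'
  have hlin : |(fderiv ℝ p w - fderiv ℝ p w') δ'| ≤ M * ‖w - w'‖ * ‖δ'‖ :=
    (ContinuousLinearMap.le_opNorm _ _).trans
      (mul_le_mul_of_nonneg_right (hp.norm_fderiv_sub_le w w') (norm_nonneg _))
  have hR : M * ‖w - w'‖ * ‖δ'‖ ≤ M * ‖w - w'‖ * R :=
    mul_le_mul_of_nonneg_left hδ' (mul_nonneg hp.nonneg (norm_nonneg _))
  calc |taylorRem p w δ - taylorRem p w' δ'|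
      = |(p (w + δ) - p (w + δ') - fderiv ℝ p w (δ - δ')) +
          (p (w + δ') - p (w' + δ') - (p w - p w')) - (fderiv ℝ p w - fderiv ℝ p w') δ'| := by
        simp only [taylorRem, map_sub, sub_apply]
        ring_nf
    _ ≤ M * R * ‖δ - δ'‖ + M * ‖w - w'‖ * R + M * ‖w - w'‖ * R :=
        (abs_sub _ _).trans
          (add_le_add ((abs_add_le _ _).trans (add_le_add hincr (hbase.trans hR))) (hlin.trans hR))
    _ = M * R * (‖δ - δ'‖ + 2 * ‖w - w'‖) := by ring

end Taylor

section PartialDeriv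

variable {d : ℕ} {M : ℝ} {p : (Fin d → ℝ) → ℝ}

lemma abs_apply_single_le (f : (Fin d → ℝ) →L[ℝ] ℝ) (b : Fin d) : |f (Pi.single b 1)| ≤ ‖f‖ := by
  have h := f.le_opNorm (Pi.single b 1)
  rwa [Pi.norm_single, norm_one, mul_one] at h

lemma apply_eq_sum_mul_apply_single (f : (Fin d → ℝ) →L[ℝ] ℝ) (x : Fin d → ℝ) :
    f x = ∑ b, x b * f (Pi.single b 1) := by
  conv_lhs => rw [pi_eq_sum_univ' x, map_sum]
  simp only [map_smul, smul_eq_mul]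

lemma norm_le_of_apply_single_le {f : (Fin d → ℝ) →L[ℝ] ℝ} {c : ℝ} (hc : 0 ≤ c)
    (hf : ∀ b, |f (Pi.single b 1)| ≤ c) : ‖f‖ ≤ d * c := by
  refine f.opNorm_le_bound (by positivity) fun x => ?_
  calc ‖f x‖ ≤ ∑ b, ‖x b * f (Pi.single b 1)‖ := by
        rw [apply_eq_sum_mul_apply_single f x]
        exact norm_sum_le _ _
    _ ≤ ∑ _b : Fin d, ‖x‖ * c := Finset.sum_le_sum fun b _ => by
        rw [norm_mul]
        exact mul_le_mul (norm_le_pi_norm x b) (hf b) (norm_nonneg _) (norm_nonneg _)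
    _ = d * c * ‖x‖ := by
        rw [Finset.sum_const, Finset.card_univ, Fintype.card_fin, nsmul_eq_mul]
        ring

/-- The partial derivative of `p` in the direction of the `b`-th coordinate. -/
noncomputable def partialDeriv (p : (Fin d → ℝ) → ℝ) (b : Fin d) (w : Fin d → ℝ) : ℝ :=
  fderiv ℝ p w (Pi.single b 1)

lemma fderiv_eq_sum_partialDeriv (p : (Fin d → ℝ) → ℝ) (w δ : Fin d → ℝ) :
    fderiv ℝ p w δ = ∑ b, δ b * partialDeriv p b w :=
  apply_eq_sum_mul_apply_single _ _

namespace SmoothBounded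

lemma abs_partialDeriv_le (hp : SmoothBounded M p) (b : Fin d) (w : Fin d → ℝ) :
    |partialDeriv p b w| ≤ M :=
  (abs_apply_single_le _ b).trans (hp.norm_fderiv_le w)

lemma abs_partialDeriv_sub_le (hp : SmoothBounded M p) (b : Fin d) (w w' : Fin d → ℝ) :
    |partialDeriv p b w - partialDeriv p b w'| ≤ M * ‖w - w'‖ :=
  (abs_apply_single_le (fderiv ℝ p w - fderiv ℝ p w') b).trans (hp.norm_fderiv_sub_le w w')

lemma continuous_partialDeriv (hp : SmoothBounded M p) (b : Fin d) :
    Continuous (partialDeriv p b) :=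
  hp.continuous_fderiv.clm_apply continuous_const

end SmoothBounded

end PartialDeriv

lemma abs_integral_le_of_forall {Ω : Type*} [MeasurableSpace Ω] {ν : Measure Ω}
    [IsProbabilityMeasure ν] {F : Ω → ℝ} {b : ℝ} (hb : ∀ ω, |F ω| ≤ b) : |∫ ω, F ω ∂ν| ≤ b := by
  simpa using norm_integral_le_of_norm_le_const (μ := ν) (f := F) (ae_of_all _ hb)

section Rotation

variable {E : Type*} [NormedAddCommGroup E] [NormedSpace ℝ E]

/-- A quarter turn from the second component of `x` at `θ = 0` to the first one at `θ = π / 2`. -/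
noncomputable def rotationPath (θ : ℝ) (x : E × E) : E :=
  Real.sin θ • x.1 + Real.cos θ • x.2

/-- The velocity of `rotationPath`. -/
noncomputable def rotationVelocity (θ : ℝ) (x : E × E) : E :=
  Real.cos θ • x.1 - Real.sin θ • x.2

lemma hasDerivAt_rotationPath (θ : ℝ) (x : E × E) :
    HasDerivAt (fun θ => rotationPath θ x) (rotationVelocity θ x) θ := by
  have h := ((Real.hasDerivAt_sin θ).smul_const x.1).add
    ((Real.hasDerivAt_cos θ).smul_const x.2)
  rwa [neg_smul, ← sub_eq_add_neg] at h

lemma norm_rotationPath_le (θ : ℝ) (x : E × E) :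
    ‖rotationPath θ x‖ ≤ ‖x.1‖ + ‖x.2‖ := by
  refine (norm_add_le _ _).trans (add_le_add ?_ ?_) <;> rw [norm_smul]
  · exact mul_le_of_le_one_left (norm_nonneg _) (Real.abs_sin_le_one θ)
  · exact mul_le_of_le_one_left (norm_nonneg _) (Real.abs_cos_le_one θ)

lemma norm_rotationVelocity_le (θ : ℝ) (x : E × E) :
    ‖rotationVelocity θ x‖ ≤ ‖x.1‖ + ‖x.2‖ := by
  refine (norm_sub_le _ _).trans (add_le_add ?_ ?_) <;> rw [norm_smul]
  · exact mul_le_of_le_one_left (norm_nonneg _) (Real.abs_cos_le_one θ)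
  · exact mul_le_of_le_one_left (norm_nonneg _) (Real.abs_sin_le_one θ)

lemma continuous_rotationPath (θ : ℝ) : Continuous (rotationPath θ : E × E → E) := by
  unfold rotationPath
  fun_prop

end Rotation

section SteinInterpolation

variable {d : ℕ} {M K K' : ℝ} {S : Matrix (Fin d) (Fin d) ℝ}
  {p h : (Fin d → ℝ) → ℝ} {P Q : Measure (Fin d → ℝ)}

/-- `P` satisfies Stein's identity for the covariance matrix `S` up to an error `K`, uniformly over
the test functions of class `SmoothBounded M`. -/
def SteinApprox (M K : ℝ) (S : Matrix (Fin d) (Fin d) ℝ) (P : Measure (Fin d → ℝ)) : Prop :=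
  ∀ (p : (Fin d → ℝ) → ℝ) (a : Fin d), SmoothBounded M p →
    |∫ w, w a * p w ∂P - ∑ b, S a b * ∫ w, partialDeriv p b w ∂P| ≤ K

/-- Test functions with bounded partial derivatives of orders one to three; the third order enters
only as a Lipschitz bound, and the function itself may grow linearly. -/
structure SmoothTest (M : ℝ) (h : (Fin d → ℝ) → ℝ) : Prop where
  differentiable : Differentiable ℝ h
  smoothBounded_partialDeriv : ∀ a, SmoothBounded M (partialDeriv h a)

namespace SmoothBounded

lemma partialDeriv_comp_affine (hp : SmoothBounded M p) (s : ℝ) (u : Fin d → ℝ)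
    (b : Fin d) (w : Fin d → ℝ) :
    partialDeriv (fun w => p (s • w + u)) b w = s * partialDeriv p b (s • w + u) := by
  rw [partialDeriv, (hp.hasFDerivAt_comp_affine s u w).fderiv]
  rfl

variable [IsProbabilityMeasure Q]

lemma integrable_fst_mul_comp_smul_add (hp : SmoothBounded M p)
    (hP : Integrable (fun w => ‖w‖) P) (s c : ℝ) (a : Fin d) :
    Integrable (fun x : (Fin d → ℝ) × (Fin d → ℝ) => x.1 a * p (s • x.1 + c • x.2)) (P.prod Q) := by
  have hpc := hp.differentiable.continuous
  refine ((hP.comp_fst Q).mul_const M).mono' (by fun_prop) (ae_of_all _ fun x => ?_)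
  rw [norm_mul]
  exact mul_le_mul (norm_le_pi_norm _ a) (hp.abs_le _) (norm_nonneg _) (norm_nonneg _)

variable [IsProbabilityMeasure P]

lemma integrable_partialDeriv_comp_smul_add (hp : SmoothBounded M p) (s c : ℝ) (b : Fin d) :
    Integrable (fun x : (Fin d → ℝ) × (Fin d → ℝ) => partialDeriv p b (s • x.1 + c • x.2))
      (P.prod Q) := by
  have hpc := hp.continuous_partialDeriv b
  exact (integrable_const M).mono' (by fun_prop)
    (ae_of_all _ fun x => hp.abs_partialDeriv_le b _)

lemma abs_integral_fst_mul_sub_le (hp : SmoothBounded M p) (hPS : SteinApprox M K S P)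
    (hP : Integrable (fun w => ‖w‖) P) {s : ℝ} (hs : |s| ≤ 1) (c : ℝ) (a : Fin d) :
    |∫ x, x.1 a * p (s • x.1 + c • x.2) ∂(P.prod Q) -
      s * ∑ b, S a b * ∫ x, partialDeriv p b (s • x.1 + c • x.2) ∂(P.prod Q)| ≤ K := by
  have hint := hp.integrable_fst_mul_comp_smul_add (Q := Q) hP s c a
  have hint' b := hp.integrable_partialDeriv_comp_smul_add (P := P) (Q := Q) s c b
  have hfubini : ∫ x, x.1 a * p (s • x.1 + c • x.2) ∂(P.prod Q) -
      s * ∑ b, S a b * ∫ x, partialDeriv p b (s • x.1 + c • x.2) ∂(P.prod Q) =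
      ∫ v, (∫ w, w a * p (s • w + c • v) ∂P -
        ∑ b, S a b * ∫ w, s * partialDeriv p b (s • w + c • v) ∂P) ∂Q := by
    rw [integral_sub hint.integral_prod_right
        (integrable_finsetSum _ fun b _ => ((hint' b).const_mul s).integral_prod_right.const_mul _),
      integral_finsetSum _ fun b _ => ((hint' b).const_mul s).integral_prod_right.const_mul _,
      integral_prod_symm _ hint, Finset.mul_sum]
    congr 1
    refine Finset.sum_congr rfl fun b _ => ?_
    simp only [integral_const_mul]
    rw [integral_prod_symm _ (hint' b), mul_left_comm]
  rw [hfubini]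
  refine abs_integral_le_of_forall fun v => ?_
  simpa only [hp.partialDeriv_comp_affine] using hPS _ a (hp.comp_affine hs (c • v))

lemma abs_integral_snd_mul_sub_le (hp : SmoothBounded M p) (hQS : SteinApprox M K S Q)
    (hQ : Integrable (fun w => ‖w‖) Q) (s : ℝ) {c : ℝ} (hc : |c| ≤ 1) (a : Fin d) :
    |∫ x, x.2 a * p (s • x.1 + c • x.2) ∂(P.prod Q) -
      c * ∑ b, S a b * ∫ x, partialDeriv p b (s • x.1 + c • x.2) ∂(P.prod Q)| ≤ K := by
  have h := hp.abs_integral_fst_mul_sub_le (Q := P) hQS hQ hc s a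
  have hswap (F : (Fin d → ℝ) × (Fin d → ℝ) → ℝ) :
      ∫ x, F x ∂(Q.prod P) = ∫ x, F x.swap ∂(P.prod Q) := (integral_prod_swap F).symm
  simp only [hswap, Prod.fst_swap, Prod.snd_swap] at h
  simpa only [add_comm (c • _)] using h

end SmoothBounded

namespace SmoothTest

lemma norm_fderiv_le (hh : SmoothTest M h) (w : Fin d → ℝ) :
    ‖fderiv ℝ h w‖ ≤ d * |M| :=
  norm_le_of_apply_single_le (abs_nonneg M) fun b =>
    ((hh.smoothBounded_partialDeriv b).abs_le w).trans (le_abs_self M)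

lemma norm_le (hh : SmoothTest M h) (w : Fin d → ℝ) :
    ‖h w‖ ≤ ‖h 0‖ + d * |M| * ‖w‖ := by
  have hlip := (convex_univ (𝕜 := ℝ)).norm_image_sub_le_of_norm_fderiv_le
    (fun z _ => hh.differentiable z) (fun z _ => hh.norm_fderiv_le z)
    (Set.mem_univ 0) (Set.mem_univ w)
  rw [sub_zero] at hlip
  linarith [norm_le_norm_add_norm_sub' (h w) (h 0)]

variable [IsProbabilityMeasure P] [IsProbabilityMeasure Q]

lemma integrable_comp_rotationPath (hh : SmoothTest M h) (hP : Integrable (fun w => ‖w‖) P)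
    (hQ : Integrable (fun w => ‖w‖) Q) (θ : ℝ) :
    Integrable (fun x => h (rotationPath θ x)) (P.prod Q) := by
  have hsum := ((hP.comp_fst Q).add (hQ.comp_snd P)).const_mul (d * |M|)
  refine ((integrable_const ‖h 0‖).add hsum).mono'
    (hh.differentiable.continuous.comp (continuous_rotationPath θ)).aestronglyMeasurable
    (ae_of_all _ fun x => (hh.norm_le _).trans ?_)
  exact add_le_add_right (mul_le_mul_of_nonneg_left (norm_rotationPath_le θ x) (by positivity)) _

lemma hasDerivAt_integral_rotationPath (hh : SmoothTest M h) (hP : Integrable (fun w => ‖w‖) P)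
    (hQ : Integrable (fun w => ‖w‖) Q) (θ : ℝ) :
    HasDerivAt (fun θ => ∫ x, h (rotationPath θ x) ∂(P.prod Q))
      (∫ x, fderiv ℝ h (rotationPath θ x) (rotationVelocity θ x) ∂(P.prod Q)) θ := by
  have hhc : Continuous h := hh.differentiable.continuous
  have hPc b : Continuous (partialDeriv h b) :=
    (hh.smoothBounded_partialDeriv b).differentiable.continuous
  refine (hasDerivAt_integral_of_dominated_loc_of_deriv_le (s := Set.univ)
    (F := fun θ x => h (rotationPath θ x))
    (F' := fun θ x => fderiv ℝ h (rotationPath θ x) (rotationVelocity θ x))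
    (bound := fun x => d * |M| * (‖x.1‖ + ‖x.2‖)) Filter.univ_mem
    (Filter.Eventually.of_forall fun θ =>
      (hhc.comp (continuous_rotationPath θ)).aestronglyMeasurable)
    (hh.integrable_comp_rotationPath hP hQ θ) ?_ (ae_of_all _ fun x θ _ => ?_)
    (((hP.comp_fst Q).add (hQ.comp_snd P)).const_mul _) (ae_of_all _ fun x θ _ => ?_)).2
  · simp only [fderiv_eq_sum_partialDeriv, rotationPath, rotationVelocity]
    exact Continuous.aestronglyMeasurable (by fun_prop)
  · exact (ContinuousLinearMap.le_opNorm _ _).trans <| mul_le_mul (hh.norm_fderiv_le _)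
      (norm_rotationVelocity_le θ x) (norm_nonneg _) (by positivity)
  · exact (hh.differentiable _).hasFDerivAt.comp_hasDerivAt θ (hasDerivAt_rotationPath θ x)

lemma integral_fderiv_rotationPath (hh : SmoothTest M h) (hP : Integrable (fun w => ‖w‖) P)
    (hQ : Integrable (fun w => ‖w‖) Q) (θ : ℝ) :
    ∫ x, fderiv ℝ h (rotationPath θ x) (rotationVelocity θ x) ∂(P.prod Q) =
      ∑ a, (Real.cos θ * ∫ x, x.1 a * partialDeriv h a (rotationPath θ x) ∂(P.prod Q) -
        Real.sin θ * ∫ x, x.2 a * partialDeriv h a (rotationPath θ x) ∂(P.prod Q)) := by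
  have hfst a : Integrable (fun x => x.1 a * partialDeriv h a (rotationPath θ x)) (P.prod Q) :=
    (hh.smoothBounded_partialDeriv a).integrable_fst_mul_comp_smul_add hP _ _ a
  have hsnd a : Integrable (fun x => x.2 a * partialDeriv h a (rotationPath θ x)) (P.prod Q) := by
    have hswap := ((hh.smoothBounded_partialDeriv a).integrable_fst_mul_comp_smul_add (Q := P) hQ
      (Real.cos θ) (Real.sin θ) a).swap
    refine hswap.congr (ae_of_all _ fun x => ?_)
    simp only [Function.comp_apply, Prod.fst_swap, Prod.snd_swap, rotationPath, add_comm]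
  have hexpand x : fderiv ℝ h (rotationPath θ x) (rotationVelocity θ x) =
      ∑ a, (Real.cos θ * (x.1 a * partialDeriv h a (rotationPath θ x)) -
        Real.sin θ * (x.2 a * partialDeriv h a (rotationPath θ x))) := by
    rw [fderiv_eq_sum_partialDeriv]
    refine Finset.sum_congr rfl fun a _ => ?_
    simp only [rotationVelocity, Pi.sub_apply, Pi.smul_apply, smul_eq_mul]
    ring
  simp only [hexpand]
  refine (integral_finsetSum _ fun a _ => ((hfst a).const_mul _).sub ((hsnd a).const_mul _)).trans
    (Finset.sum_congr rfl fun a _ => ?_)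
  rw [integral_sub' ((hfst a).const_mul _) ((hsnd a).const_mul _), integral_const_mul,
    integral_const_mul]

lemma abs_integral_fderiv_rotationPath_le (hh : SmoothTest M h) (hPS : SteinApprox M K S P)
    (hQS : SteinApprox M K' S Q) (hP : Integrable (fun w => ‖w‖) P)
    (hQ : Integrable (fun w => ‖w‖) Q) (θ : ℝ) :
    |∫ x, fderiv ℝ h (rotationPath θ x) (rotationVelocity θ x) ∂(P.prod Q)| ≤
      d * (K + K') := by
  rw [hh.integral_fderiv_rotationPath hP hQ]
  refine (Finset.abs_sum_le_sum_abs _ _).trans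
    ((Finset.sum_le_card_nsmul _ _ (K + K') fun a _ => ?_).trans_eq
      (by rw [Finset.card_univ, Fintype.card_fin, nsmul_eq_mul]))
  have hfst := (hh.smoothBounded_partialDeriv a).abs_integral_fst_mul_sub_le (Q := Q) hPS hP
    (Real.abs_sin_le_one θ) (Real.cos θ) a
  have hsnd := (hh.smoothBounded_partialDeriv a).abs_integral_snd_mul_sub_le (P := P) hQS hQ
    (Real.sin θ) (Real.abs_cos_le_one θ) a
  set D := ∑ b, S a b * ∫ x, partialDeriv (partialDeriv h a) b
    (Real.sin θ • x.1 + Real.cos θ • x.2) ∂(P.prod Q)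
  calc _ = |Real.cos θ * (∫ x, x.1 a * partialDeriv h a (rotationPath θ x) ∂(P.prod Q) -
          Real.sin θ * D) - Real.sin θ * (∫ x, x.2 a * partialDeriv h a (rotationPath θ x)
          ∂(P.prod Q) - Real.cos θ * D)| := by ring_nf
    _ ≤ K + K' := by
        refine (abs_sub _ _).trans (add_le_add ?_ ?_) <;> rw [abs_mul]
        · exact (mul_le_of_le_one_left (abs_nonneg _) (Real.abs_cos_le_one θ)).trans hfst
        · exact (mul_le_of_le_one_left (abs_nonneg _) (Real.abs_sin_le_one θ)).trans hsnd

/-- The first derivatives of `h` along the rotation cancel up to the defects in Stein's identity, so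
two laws that satisfy it for the same matrix are close. -/
theorem abs_integral_sub_integral_le (hh : SmoothTest M h) (hPS : SteinApprox M K S P)
    (hQS : SteinApprox M K' S Q) (hP : Integrable (fun w => ‖w‖) P)
    (hQ : Integrable (fun w => ‖w‖) Q) :
    |∫ w, h w ∂P - ∫ w, h w ∂Q| ≤ d * (K + K') * (Real.pi / 2) := by
  have hmvt := (convex_univ (𝕜 := ℝ)).norm_image_sub_le_of_norm_hasDerivWithin_le
    (fun θ _ => (hh.hasDerivAt_integral_rotationPath hP hQ θ).hasDerivWithinAt)
    (fun θ _ => hh.abs_integral_fderiv_rotationPath_le hPS hQS hP hQ θ)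
    (Set.mem_univ 0) (Set.mem_univ (Real.pi / 2))
  simp only [rotationPath, Real.sin_pi_div_two, Real.cos_pi_div_two, Real.sin_zero, Real.cos_zero,
    one_smul, zero_smul, add_zero, zero_add, integral_fun_fst, integral_fun_snd, probReal_univ,
    sub_zero, Real.norm_eq_abs] at hmvt
  rwa [abs_of_pos (by positivity : 0 < Real.pi / 2)] at hmvt

end SmoothTest

end SteinInterpolation

section GaussianIntegrationByParts

variable {d : ℕ} {M : ℝ} {p : (Fin d → ℝ) → ℝ}

lemma hasDerivAt_gaussianPDFReal_zero_one (x : ℝ) :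
    HasDerivAt (gaussianPDFReal 0 1) (-x * gaussianPDFReal 0 1 x) x := by
  have hexponent : HasDerivAt (fun x : ℝ => -(x - 0) ^ 2 / (2 * ((1 : ℝ≥0) : ℝ))) (-x) x := by
    have h := ((((hasDerivAt_id x).sub_const 0).pow 2).neg).div_const (2 * ((1 : ℝ≥0) : ℝ))
    refine h.congr_deriv ?_
    simp only [id_eq, sub_zero, Nat.cast_ofNat, Nat.add_one_sub_one, pow_one, mul_one,
      NNReal.coe_one]
    ring
  have h := hexponent.exp.const_mul (√(2 * Real.pi * ((1 : ℝ≥0) : ℝ)))⁻¹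
  rw [gaussianPDFReal_def]
  refine h.congr_deriv ?_
  ring

lemma integrable_mul_gaussianPDFReal : Integrable fun x : ℝ => x * gaussianPDFReal 0 1 x := by
  have h := (integrable_mul_exp_neg_mul_sq (b := 1 / 2) (by norm_num)).const_mul
    (√(2 * Real.pi * ((1 : ℝ≥0) : ℝ)))⁻¹
  refine h.congr (ae_of_all _ fun x => ?_)
  have hexponent : -(1 / 2) * x ^ 2 = -x ^ 2 / 2 := by ring
  simp only [gaussianPDFReal, sub_zero, NNReal.coe_one, mul_one, hexponent]
  ring

lemma integral_mul_gaussianReal {g g' : ℝ → ℝ} {b b' : ℝ} (hg : ∀ x, HasDerivAt g (g' x) x)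
    (hb : ∀ x, |g x| ≤ b) (hb' : ∀ x, |g' x| ≤ b') (hg' : Continuous g') :
    ∫ x, x * g x ∂(gaussianReal 0 1) = ∫ x, g' x ∂(gaussianReal 0 1) := by
  have hgc : Continuous g := continuous_iff_continuousAt.2 fun x => (hg x).continuousAt
  have hφ := integrable_gaussianPDFReal 0 1
  have hgφ : Integrable (g * gaussianPDFReal 0 1) :=
    hφ.bdd_mul hgc.aestronglyMeasurable (ae_of_all _ hb)
  have hg'φ : Integrable (g' * gaussianPDFReal 0 1) :=
    hφ.bdd_mul hg'.aestronglyMeasurable (ae_of_all _ hb')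
  have hgφ' : Integrable (g * fun x => -x * gaussianPDFReal 0 1 x) := by
    refine Integrable.bdd_mul ?_ hgc.aestronglyMeasurable (ae_of_all _ hb)
    simpa [neg_mul] using integrable_mul_gaussianPDFReal.neg
  have hparts := integral_mul_deriv_eq_deriv_mul_of_integrable (u := g)
    (v := gaussianPDFReal 0 1) (u' := g') (fun x _ => hg x)
    (fun x _ => hasDerivAt_gaussianPDFReal_zero_one x) hgφ' hg'φ hgφ
  simp only [integral_gaussianReal_eq_integral_smul one_ne_zero, smul_eq_mul]
  calc ∫ x, gaussianPDFReal 0 1 x * (x * g x)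
      = -∫ x, g x * (-x * gaussianPDFReal 0 1 x) := by
        rw [← integral_neg]
        congr with x
        ring
    _ = ∫ x, gaussianPDFReal 0 1 x * g' x := by
        rw [hparts, neg_neg]
        simp only [mul_comm]

/-- The standard normal distribution on `Fin d → ℝ`. -/
noncomputable def stdNormal (d : ℕ) : Measure (Fin d → ℝ) :=
  Measure.pi fun _ => gaussianReal 0 1

instance : IsProbabilityMeasure (stdNormal d) := by
  unfold stdNormal
  infer_instance

lemma integrable_eval_stdNormal (c : Fin d) : Integrable (fun z => z c) (stdNormal d) := by
  unfold stdNormal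
  exact integrable_comp_eval (f := id) IsGaussian.integrable_id

lemma integral_mul_stdNormal {b b' : ℝ} (hp : Differentiable ℝ p) (hb : ∀ z, |p z| ≤ b)
    (c : Fin d) (hb' : ∀ z, |partialDeriv p c z| ≤ b') (hc : Continuous (partialDeriv p c)) :
    ∫ z, z c * p z ∂(stdNormal d) = ∫ z, partialDeriv p c z ∂(stdNormal d) := by
  obtain _ | n := d
  · exact c.elim0
  have hmp := (measurePreserving_piFinSuccAbove
    (fun _ : Fin (n + 1) => gaussianReal 0 1) c).symm
  have hint : Integrable (fun z : Fin (n + 1) → ℝ => z c * p z) (stdNormal (n + 1)) :=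
    (integrable_eval_stdNormal c).mul_bdd hp.continuous.aestronglyMeasurable (ae_of_all _ hb)
  have hint' : Integrable (partialDeriv p c) (stdNormal (n + 1)) :=
    (integrable_const b').mono' hc.aestronglyMeasurable (ae_of_all _ hb')
  unfold stdNormal at hint hint' ⊢
  rw [← hmp.integral_comp', ← hmp.integral_comp']
  have hintProd := (hmp.integrable_comp_emb (MeasurableEquiv.measurableEmbedding _)).2 hint
  have hintProd' := (hmp.integrable_comp_emb (MeasurableEquiv.measurableEmbedding _)).2 hint'
  refine (integral_prod_symm _ hintProd).trans
    (Eq.trans ?_ (integral_prod_symm _ hintProd').symm)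
  refine integral_congr_ae (ae_of_all _ fun y => ?_)
  have hupdate (x : ℝ) : (MeasurableEquiv.piFinSuccAbove (fun _ => ℝ) c).symm (x, y) =
      Function.update (Fin.insertNth c 0 y : Fin (n + 1) → ℝ) c x := by
    rw [Fin.update_insertNth]
    rfl
  simp only [Function.comp_apply, hupdate, Function.update_self]
  exact integral_mul_gaussianReal
    (fun x => (hp _).hasFDerivAt.comp_hasDerivAt x (hasDerivAt_update _ c x))
    (fun x => hb _) (fun x => hb' _) (hc.comp (continuous_const.update c continuous_id))

namespace SmoothBounded

variable (R : Matrix (Fin d) (Fin d) ℝ)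

lemma hasFDerivAt_comp_mulVec (hp : SmoothBounded M p) (z : Fin d → ℝ) :
    HasFDerivAt (fun z => p (R.mulVec z))
      ((fderiv ℝ p (R.mulVec z)).comp R.mulVecLin.toContinuousLinearMap) z :=
  (hp.differentiable _).hasFDerivAt.comp z R.mulVecLin.toContinuousLinearMap.hasFDerivAt

lemma partialDeriv_comp_mulVec (hp : SmoothBounded M p) (c : Fin d) :
    partialDeriv (fun z => p (R.mulVec z)) c =
      fun z => ∑ b, R b c * partialDeriv p b (R.mulVec z) := by
  ext z
  rw [partialDeriv, (hp.hasFDerivAt_comp_mulVec R z).fderiv]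
  simp only [ContinuousLinearMap.comp_apply, LinearMap.coe_toContinuousLinearMap',
    Matrix.mulVecLin_apply, Matrix.mulVec_single_one, fderiv_eq_sum_partialDeriv]
  rfl

lemma integral_mul_comp_mulVec (hp : SmoothBounded M p) (c : Fin d) :
    ∫ z, z c * p (R.mulVec z) ∂(stdNormal d) =
      ∑ b, R b c * ∫ z, partialDeriv p b (R.mulVec z) ∂(stdNormal d) := by
  have hPc := hp.continuous_partialDeriv
  have hpartial := hp.partialDeriv_comp_mulVec R c
  have hbound z : |partialDeriv (fun z => p (R.mulVec z)) c z| ≤ ∑ b, |R b c| * M := by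
    rw [hpartial]
    refine (Finset.abs_sum_le_sum_abs _ _).trans (Finset.sum_le_sum fun b _ => ?_)
    rw [abs_mul]
    exact mul_le_mul_of_nonneg_left (hp.abs_partialDeriv_le b _) (abs_nonneg _)
  have hcont : Continuous (partialDeriv (fun z => p (R.mulVec z)) c) := by
    rw [hpartial]
    fun_prop
  have hint b : Integrable (fun z => partialDeriv p b (R.mulVec z)) (stdNormal d) :=
    (integrable_const M).mono' (by fun_prop) (ae_of_all _ fun z => hp.abs_partialDeriv_le b _)
  rw [integral_mul_stdNormal (fun z => (hp.hasFDerivAt_comp_mulVec R z).differentiableAt)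
    (fun z => hp.abs_le _) c hbound hcont, hpartial,
    integral_finsetSum _ fun b _ => (hint b).const_mul _]
  simp only [integral_const_mul]

lemma integral_mulVec_mul_comp_mulVec (hp : SmoothBounded M p) (a : Fin d) :
    ∫ z, R.mulVec z a * p (R.mulVec z) ∂(stdNormal d) =
      ∑ b, (∑ c, R a c * R b c) * ∫ z, partialDeriv p b (R.mulVec z) ∂(stdNormal d) := by
  have hRc : Continuous R.mulVec := continuous_const.matrix_mulVec continuous_id
  have hint c : Integrable (fun z => z c * p (R.mulVec z)) (stdNormal d) :=
    (integrable_eval_stdNormal c).mul_bdd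
      (hp.differentiable.continuous.comp hRc).aestronglyMeasurable
      (ae_of_all _ fun z => hp.abs_le _)
  calc ∫ z, R.mulVec z a * p (R.mulVec z) ∂(stdNormal d)
      = ∫ z, ∑ c, R a c * (z c * p (R.mulVec z)) ∂(stdNormal d) := by
        simp only [← mul_assoc, ← Finset.sum_mul]
        rfl
    _ = ∑ c, ∑ b, R a c * R b c * ∫ z, partialDeriv p b (R.mulVec z) ∂(stdNormal d) := by
        rw [integral_finsetSum _ fun c _ => (hint c).const_mul _]
        simp only [integral_const_mul, hp.integral_mul_comp_mulVec, Finset.mul_sum, mul_assoc]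
    _ = _ := by
        rw [Finset.sum_comm]
        simp only [Finset.sum_mul]

end SmoothBounded

/-- The centred normal distribution with covariance matrix `S` on `Fin d → ℝ`; as for
`multivariateGaussian`, it is the Dirac mass at `0` when `S` is not positive semidefinite. -/
noncomputable def normalLaw (S : Matrix (Fin d) (Fin d) ℝ) : Measure (Fin d → ℝ) :=
  (multivariateGaussian 0 S).map WithLp.ofLp

variable {S : Matrix (Fin d) (Fin d) ℝ}

instance : IsProbabilityMeasure (normalLaw S) :=
  Measure.isProbabilityMeasure_map (by fun_prop)

lemma integrable_norm_normalLaw : Integrable (fun w => ‖w‖) (normalLaw S) := by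
  refine (integrable_map_measure (by fun_prop) (by fun_prop)).2 ?_
  exact ((PiLp.continuousLinearEquiv 2 ℝ fun _ : Fin d => ℝ).toContinuousLinearMap.integrable_comp
    (IsGaussian.integrable_id (μ := multivariateGaussian 0 S))).norm

lemma gaussianExp_eq_integral_normalLaw {h : (Fin d → ℝ) → ℝ} (hh : Continuous h) :
    gaussianExp S h = ∫ w, h w ∂(normalLaw S) :=
  (integral_map (by fun_prop) hh.aestronglyMeasurable).symm

open scoped MatrixOrder in
lemma integral_normalLaw {F : (Fin d → ℝ) → ℝ} (hF : Continuous F) :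
    ∫ w, F w ∂(normalLaw S) = ∫ z, F ((CFC.sqrt S).mulVec z) ∂(stdNormal d) := by
  rw [← gaussianExp_eq_integral_normalLaw hF]
  have hFc : Continuous fun z : EuclideanSpace ℝ (Fin d) => F (WithLp.ofLp z) := by fun_prop
  unfold gaussianExp multivariateGaussian
  rw [integral_map (by fun_prop) hFc.aestronglyMeasurable, ← map_pi_eq_stdGaussian,
    integral_map (by fun_prop) (Continuous.aestronglyMeasurable (by fun_prop))]
  unfold stdNormal
  congr with z
  simp

open scoped MatrixOrder in
lemma sum_sqrt_apply_mul_sqrt_apply (hS : S.PosSemidef) (a b : Fin d) :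
    ∑ c, CFC.sqrt S a c * CFC.sqrt S b c = S a b := by
  have hherm : (CFC.sqrt S).IsHermitian := (CFC.sqrt_nonneg S).isSelfAdjoint
  have hsymm c : CFC.sqrt S b c = CFC.sqrt S c b := by simpa using hherm.apply c b
  simp only [hsymm]
  rw [← Matrix.mul_apply, CFC.sqrt_mul_sqrt_self _ hS.nonneg]

lemma steinApprox_normalLaw (hS : S.PosSemidef) : SteinApprox M 0 S (normalLaw S) := by
  intro p a hp
  have hpc : Continuous p := hp.differentiable.continuous
  simp only [integral_normalLaw (hp.continuous_partialDeriv _)]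
  rw [integral_normalLaw (F := fun w => w a * p w) (by fun_prop),
    hp.integral_mulVec_mul_comp_mulVec]
  simp only [sum_sqrt_apply_mul_sqrt_apply hS, sub_self, abs_zero, le_refl]

end GaussianIntegrationByParts

section BoundedLip

variable {X : Type*} [PseudoMetricSpace X] {b b' b₁ b₂ c : ℝ} {S S' T : Finset ℕ}
  {Q Q₁ Q₂ : (ℕ → X) → ℝ}

/-- Functionals of a sequence that are bounded by `b`, depend only on the coordinates in `S`, and
are Lipschitz with constant `b` in each of them. -/
structure BoundedLip (b : ℝ) (S : Finset ℕ) (Q : (ℕ → X) → ℝ) : Prop where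
  abs_le : ∀ ω, |Q ω| ≤ b
  abs_sub_le : ∀ ω ω', |Q ω - Q ω'| ≤ b * ∑ i ∈ S, dist (ω i) (ω' i)

lemma abs_mul_sub_mul_le {a a' c c' A B : ℝ} (ha : |a| ≤ A) (hc : |c'| ≤ B) :
    |a * c - a' * c'| ≤ A * |c - c'| + B * |a - a'| := by
  have hsplit : a * c - a' * c' = a * (c - c') + (a - a') * c' := by ring
  rw [hsplit]
  refine (abs_add_le _ _).trans ?_
  rw [abs_mul, abs_mul, mul_comm B]
  gcongr

namespace BoundedLip

lemma nonneg [Nonempty X] (h : BoundedLip b S Q) : 0 ≤ b :=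
  (abs_nonneg _).trans (h.abs_le (Classical.arbitrary _))

lemma continuous (h : BoundedLip b S Q) : Continuous Q := by
  refine continuous_iff_continuousAt.2 fun ω => tendsto_iff_dist_tendsto_zero.2 ?_
  have hcont : Continuous fun ω' : ℕ → X => b * ∑ i ∈ S, dist (ω' i) (ω i) := by fun_prop
  have hlim := hcont.tendsto ω
  simp only [dist_self, Finset.sum_const_zero, mul_zero] at hlim
  exact squeeze_zero (fun _ => dist_nonneg) (fun ω' => h.abs_sub_le ω' ω) hlim

lemma eq_of_eqOn (h : BoundedLip b S Q) {ω ω' : ℕ → X} (hω : ∀ i ∈ S, ω i = ω' i) :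
    Q ω = Q ω' := by
  have hdist := h.abs_sub_le ω ω'
  rw [Finset.sum_eq_zero fun i hi => by rw [hω i hi, dist_self], mul_zero] at hdist
  exact sub_eq_zero.1 (abs_nonpos_iff.1 hdist)

lemma mono [Nonempty X] (h : BoundedLip b S Q) (hb : b ≤ b') (hS : S ⊆ S') :
    BoundedLip b' S' Q where
  abs_le ω := (h.abs_le ω).trans hb
  abs_sub_le ω ω' := (h.abs_sub_le ω ω').trans <| mul_le_mul hb
    (Finset.sum_le_sum_of_subset_of_nonneg hS fun _ _ _ => dist_nonneg)
    (Finset.sum_nonneg fun _ _ => dist_nonneg) (h.nonneg.trans hb)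

lemma mul [Nonempty X] (h₁ : BoundedLip b₁ S Q₁) (h₂ : BoundedLip b₂ S Q₂) :
    BoundedLip (2 * (b₁ * b₂)) S (fun ω => Q₁ ω * Q₂ ω) where
  abs_le ω := by
    rw [abs_mul]
    have hprod := mul_le_mul (h₁.abs_le ω) (h₂.abs_le ω) (abs_nonneg _) h₁.nonneg
    linarith [mul_nonneg h₁.nonneg h₂.nonneg]
  abs_sub_le ω ω' := by
    refine (abs_mul_sub_mul_le (h₁.abs_le ω) (h₂.abs_le ω')).trans ?_
    linarith [mul_le_mul_of_nonneg_left (h₂.abs_sub_le ω ω') h₁.nonneg,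
      mul_le_mul_of_nonneg_left (h₁.abs_sub_le ω ω') h₂.nonneg]

lemma sub_const (h : BoundedLip b S Q) (hc : |c| ≤ b) :
    BoundedLip (2 * b) S (fun ω => Q ω - c) where
  abs_le ω := by linarith [h.abs_le ω, abs_sub (Q ω) c]
  abs_sub_le ω ω' := by
    have hdist := h.abs_sub_le ω ω'
    rw [sub_sub_sub_cancel_right]
    linarith [(abs_nonneg _).trans hdist]

lemma abs_sub_le_of_eqOn_off [Nonempty X] (h : BoundedLip b S Q) {ω ω' : ℕ → X} {D : ℕ → ℝ}
    (hD0 : ∀ i, 0 ≤ D i) (hT : ∀ i ∈ S, i ∈ T → dist (ω i) (ω' i) ≤ D i)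
    (hT' : ∀ i ∈ S, i ∉ T → ω i = ω' i) : |Q ω - Q ω'| ≤ b * ∑ i ∈ T, D i := by
  refine (h.abs_sub_le ω ω').trans (mul_le_mul_of_nonneg_left ?_ h.nonneg)
  calc ∑ i ∈ S, dist (ω i) (ω' i) = ∑ i ∈ S with i ∈ T, dist (ω i) (ω' i) := by
        refine (Finset.sum_filter_of_ne fun i hi hne => ?_).symm
        by_contra hiT
        exact hne (by rw [hT' i hi hiT, dist_self])
    _ ≤ ∑ i ∈ S with i ∈ T, D i := Finset.sum_le_sum fun i hi =>
        hT i (Finset.mem_filter.1 hi).1 (Finset.mem_filter.1 hi).2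
    _ ≤ ∑ i ∈ T, D i := Finset.sum_le_sum_of_subset_of_nonneg
        (fun i hi => (Finset.mem_filter.1 hi).2) fun i _ _ => hD0 i

end BoundedLip

/-- Polynomial mixing of the law `ν` of a sequence: a centred functional of the coordinates in a
window `[s, e]` is nearly uncorrelated with functionals of the coordinates at distance at least
`k` from the window, on both sides of it. -/
def Mixing [MeasurableSpace X] (ν : Measure (ℕ → X)) (γ C : ℝ) : Prop :=
  ∀ (s e k : ℕ) (b₁ b₂ : ℝ) (S₁ S₂ : Finset ℕ) (χ Q : (ℕ → X) → ℝ), BoundedLip b₁ S₁ χ →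
    BoundedLip b₂ S₂ Q → (∀ i ∈ S₁, s ≤ i ∧ i ≤ e) → s ≤ e →
    (∀ i ∈ S₂, i + k ≤ s ∨ e + k ≤ i) → ∫ ω, χ ω ∂ν = 0 →
    |∫ ω, χ ω * Q ω ∂ν| ≤ C * b₁ * b₂ * ((k : ℝ) + 1) ^ (-γ)

end BoundedLip

section FarTimes

variable {N n m : ℕ}

/-- The times in `[0, N)` at distance at least `m` from `n`. -/
def farTimes (N n m : ℕ) : Finset ℕ := {i ∈ Finset.range N | i + m ≤ n ∨ n + m ≤ i}

/-- The times in `[0, N)` at distance exactly `m` from `n`. -/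
def sphereTimes (N n m : ℕ) : Finset ℕ := {i ∈ Finset.range N | i + m = n ∨ n + m = i}

lemma farTimes_zero (N n : ℕ) : farTimes N n 0 = Finset.range N :=
  Finset.filter_true_of_mem fun i _ => by omega

lemma farTimes_eq_empty (hn : n < N) (hm : N ≤ m) : farTimes N n m = ∅ :=
  Finset.filter_false_of_mem fun i hi => by
    rw [Finset.mem_range] at hi
    omega

lemma farTimes_eq_union (N n m : ℕ) :
    farTimes N n m = farTimes N n (m + 1) ∪ sphereTimes N n m := by
  ext i
  simp only [farTimes, sphereTimes, Finset.mem_union, Finset.mem_filter, Finset.mem_range]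
  omega

lemma disjoint_farTimes_sphereTimes (N n m : ℕ) :
    Disjoint (farTimes N n (m + 1)) (sphereTimes N n m) := by
  rw [Finset.disjoint_left]
  intro i
  simp only [farTimes, sphereTimes, Finset.mem_filter, Finset.mem_range]
  omega

lemma sum_farTimes {G : Type*} [AddCommMonoid G] (F : ℕ → G) (N n m : ℕ) :
    ∑ i ∈ farTimes N n m, F i =
      ∑ i ∈ farTimes N n (m + 1), F i + ∑ i ∈ sphereTimes N n m, F i := by
  rw [farTimes_eq_union]
  exact Finset.sum_union (disjoint_farTimes_sphereTimes N n m)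

lemma sphereTimes_subset_farTimes (N n m : ℕ) : sphereTimes N n m ⊆ farTimes N n m := by
  rw [farTimes_eq_union]
  exact Finset.subset_union_right

lemma farTimes_anti (N n : ℕ) : Antitone (farTimes N n) := by
  intro m m' h i
  simp only [farTimes, Finset.mem_filter]
  exact fun hi => ⟨hi.1, by omega⟩

lemma card_sphereTimes_le_two (N n m : ℕ) : (sphereTimes N n m).card ≤ 2 := by
  refine (Finset.card_le_card (t := {n - m, n + m}) fun i hi => ?_).trans Finset.card_le_two
  simp only [sphereTimes, Finset.mem_filter] at hi
  simp only [Finset.mem_insert, Finset.mem_singleton]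
  omega

lemma eq_sum_sub_farTimes {G : Type*} [AddCommGroup G] (F : Finset ℕ → G) (hn : n < N) (j : ℕ) :
    F (farTimes N n j) = ∑ t ∈ Finset.range N,
      (F (farTimes N n (j + t)) - F (farTimes N n (j + t + 1))) + F ∅ := by
  have htel := Finset.sum_range_sub' (fun t => F (farTimes N n (j + t))) N
  simp only [add_zero, farTimes_eq_empty hn (Nat.le_add_left N j), ← add_assoc] at htel
  rw [htel, sub_add_cancel]

end FarTimes

section PartialSum

variable {X : Type*} {d : ℕ}

/-- The sum of the process `i ↦ v i (ω i)` over a set `T` of times. -/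
def partialSum (v : ℕ → X → Fin d → ℝ) (T : Finset ℕ) (ω : ℕ → X) : Fin d → ℝ :=
  ∑ i ∈ T, v i (ω i)

lemma partialSum_empty (v : ℕ → X → Fin d → ℝ) (ω : ℕ → X) : partialSum v ∅ ω = 0 :=
  Finset.sum_empty

lemma partialSum_farTimes (v : ℕ → X → Fin d → ℝ) (N n m : ℕ) (ω : ℕ → X) :
    partialSum v (farTimes N n m) ω =
      partialSum v (farTimes N n (m + 1)) ω + partialSum v (sphereTimes N n m) ω :=
  sum_farTimes _ N n m

end PartialSum

section UniformLip

variable {X : Type*} [PseudoMetricSpace X] {d : ℕ} {A M : ℝ} {v : ℕ → X → Fin d → ℝ}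
  {p : (Fin d → ℝ) → ℝ}

/-- Observables `v i` that are bounded by `A` and `A`-Lipschitz, uniformly in the time `i`. -/
structure UniformLip (A : ℝ) (v : ℕ → X → Fin d → ℝ) : Prop where
  norm_le : ∀ i y, ‖v i y‖ ≤ A
  norm_sub_le : ∀ i y y', ‖v i y - v i y'‖ ≤ A * dist y y'

namespace UniformLip

lemma continuous_partialSum (hv : UniformLip A v) (T : Finset ℕ) : Continuous (partialSum v T) := by
  refine continuous_finsetSum _ fun i _ => Continuous.comp ?_ (continuous_apply i)
  refine (LipschitzWith.of_dist_le' (K := A) fun y y' => ?_).continuous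
  rw [dist_eq_norm]
  exact hv.norm_sub_le i y y'

lemma norm_partialSum_sub_le (hv : UniformLip A v) (T : Finset ℕ) (ω ω' : ℕ → X) :
    ‖partialSum v T ω - partialSum v T ω'‖ ≤ A * ∑ i ∈ T, dist (ω i) (ω' i) := by
  rw [partialSum, partialSum, ← Finset.sum_sub_distrib, Finset.mul_sum]
  exact norm_sum_le_of_le _ fun i _ => hv.norm_sub_le i _ _

lemma boundedLip_apply (hv : UniformLip A v) (n : ℕ) (a : Fin d) :
    BoundedLip A {n} (fun ω => v n (ω n) a) where
  abs_le ω := (norm_le_pi_norm (v n (ω n)) a).trans (hv.norm_le n _)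
  abs_sub_le ω ω' := by
    rw [Finset.sum_singleton]
    exact (norm_le_pi_norm (v n (ω n) - v n (ω' n)) a).trans (hv.norm_sub_le n _ _)

variable [Nonempty X]

lemma nonneg (hv : UniformLip A v) : 0 ≤ A :=
  (norm_nonneg _).trans (hv.norm_le 0 (Classical.arbitrary X))

lemma norm_partialSum_sphereTimes_le (hv : UniformLip A v) (N n m : ℕ) (ω : ℕ → X) :
    ‖partialSum v (sphereTimes N n m) ω‖ ≤ 2 * A := by
  refine (norm_sum_le_of_le _ fun i _ => hv.norm_le i (ω i)).trans ?_
  rw [Finset.sum_const, nsmul_eq_mul]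
  exact mul_le_mul_of_nonneg_right (by exact_mod_cast card_sphereTimes_le_two N n m) hv.nonneg

lemma norm_partialSum_farTimes_sub_le (hv : UniformLip A v) (N n m k : ℕ) (ω : ℕ → X) :
    ‖partialSum v (farTimes N n m) ω - partialSum v (farTimes N n (m + k)) ω‖ ≤ 2 * A * k := by
  induction k with
  | zero => simp
  | succ k ih =>
    have hstep : partialSum v (farTimes N n m) ω - partialSum v (farTimes N n (m + (k + 1))) ω =
        (partialSum v (farTimes N n m) ω - partialSum v (farTimes N n (m + k)) ω) +
          partialSum v (sphereTimes N n (m + k)) ω := by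
      rw [partialSum_farTimes v N n (m + k), add_assoc]
      abel
    rw [hstep]
    refine (norm_add_le _ _).trans ?_
    push_cast
    linarith [hv.norm_partialSum_sphereTimes_le N n (m + k) ω]

lemma boundedLip_partialSum_sphereTimes (hv : UniformLip A v) (N n m : ℕ) (b : Fin d) :
    BoundedLip (2 * A) (sphereTimes N n m)
      (fun ω => partialSum v (sphereTimes N n m) ω b) where
  abs_le ω := (norm_le_pi_norm _ b).trans (hv.norm_partialSum_sphereTimes_le N n m ω)
  abs_sub_le ω ω' := by
    have hnorm := hv.norm_partialSum_sub_le (sphereTimes N n m) ω ω'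
    have hcoord := (norm_le_pi_norm (partialSum v (sphereTimes N n m) ω -
      partialSum v (sphereTimes N n m) ω') b).trans hnorm
    rw [Pi.sub_apply, Real.norm_eq_abs] at hcoord
    linarith [(norm_nonneg _).trans hnorm]

lemma boundedLip_taylorRem (hv : UniformLip A v) (hp : SmoothBounded M p) (N n m : ℕ) :
    BoundedLip (4 * M * A ^ 2) (farTimes N n m) (fun ω => taylorRem p
      (partialSum v (farTimes N n (m + 1)) ω) (partialSum v (sphereTimes N n m) ω)) where
  abs_le ω :=
    (hp.abs_taylorRem_le _ (hv.norm_partialSum_sphereTimes_le N n m ω)).trans_eq (by ring)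
  abs_sub_le ω ω' := by
    have hA := hv.nonneg
    have hM := hp.nonneg
    have hsphere := hv.norm_partialSum_sub_le (sphereTimes N n m) ω ω'
    have hfar := hv.norm_partialSum_sub_le (farTimes N n (m + 1)) ω ω'
    calc _ ≤ M * (2 * A) * (‖partialSum v (sphereTimes N n m) ω -
            partialSum v (sphereTimes N n m) ω'‖ + 2 * ‖partialSum v (farTimes N n (m + 1)) ω -
            partialSum v (farTimes N n (m + 1)) ω'‖) :=
          hp.abs_taylorRem_sub_le _ _ (hv.norm_partialSum_sphereTimes_le N n m ω)
            (hv.norm_partialSum_sphereTimes_le N n m ω')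
      _ ≤ M * (2 * A) * (2 * A * ∑ i ∈ farTimes N n m, dist (ω i) (ω' i)) := by
          rw [sum_farTimes]
          refine mul_le_mul_of_nonneg_left ?_ (by positivity)
          linarith [(norm_nonneg _).trans hsphere]
      _ = 4 * M * A ^ 2 * ∑ i ∈ farTimes N n m, dist (ω i) (ω' i) := by ring

lemma abs_partialDeriv_partialSum_sub_le (hv : UniformLip A v) (hp : SmoothBounded M p)
    {T T' : Finset ℕ} (hT : T ⊆ T') (b : Fin d) (ω ω' : ℕ → X) :
    |partialDeriv p b (partialSum v T ω) - partialDeriv p b (partialSum v T ω')| ≤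
      M * (A * ∑ i ∈ T', dist (ω i) (ω' i)) := by
  refine (hp.abs_partialDeriv_sub_le b _ _).trans (mul_le_mul_of_nonneg_left ?_ hp.nonneg)
  exact (hv.norm_partialSum_sub_le T ω ω').trans <| mul_le_mul_of_nonneg_left
    (Finset.sum_le_sum_of_subset_of_nonneg hT fun _ _ _ => dist_nonneg) hv.nonneg

lemma boundedLip_partialDeriv_sub (hv : UniformLip A v) (hp : SmoothBounded M p) (N n m k : ℕ)
    (b : Fin d) {B : ℝ} (hk : (k : ℝ) ≤ B) (hB : 1 ≤ B) :
    BoundedLip (2 * M * A * B) (farTimes N n m) (fun ω =>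
      partialDeriv p b (partialSum v (farTimes N n m) ω) -
        partialDeriv p b (partialSum v (farTimes N n (m + k)) ω)) where
  abs_le ω := by
    have hA := hv.nonneg
    have hM := hp.nonneg
    calc _ ≤ M * (2 * A * k) := (hp.abs_partialDeriv_sub_le b _ _).trans
          (mul_le_mul_of_nonneg_left (hv.norm_partialSum_farTimes_sub_le N n m k ω) hM)
      _ ≤ M * (2 * A * B) := by gcongr
      _ = 2 * M * A * B := by ring
  abs_sub_le ω ω' := by
    have hA := hv.nonneg
    have hM := hp.nonneg
    have hnear := hv.abs_partialDeriv_partialSum_sub_le hp (Finset.Subset.refl (farTimes N n m))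
      b ω ω'
    have hfar := hv.abs_partialDeriv_partialSum_sub_le hp
      (farTimes_anti N n (Nat.le_add_right m k)) b ω ω'
    set s := ∑ i ∈ farTimes N n m, dist (ω i) (ω' i)
    have hs : 0 ≤ s := Finset.sum_nonneg fun _ _ => dist_nonneg
    rw [sub_sub_sub_comm]
    calc _ ≤ M * (A * s) + M * (A * s) := (abs_sub _ _).trans (add_le_add hnear hfar)
      _ = 2 * M * A * s * 1 := by ring
      _ ≤ 2 * M * A * s * B := mul_le_mul_of_nonneg_left hB
          (mul_nonneg (by positivity) hs)
      _ = 2 * M * A * B * s := by ring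

end UniformLip

end UniformLip

lemma integrable_of_continuous {Y : Type*} [TopologicalSpace Y] [CompactSpace Y]
    [MeasurableSpace Y] [OpensMeasurableSpace Y] {ν : Measure Y} [IsFiniteMeasure ν] {F : Y → ℝ}
    (hF : Continuous F) : Integrable F ν :=
  hF.integrable_of_hasCompactSupport (HasCompactSupport.of_compactSpace F)

section Decay

variable {γ : ℝ}

/-- The constant `∑ (t + 1) ^ (-γ / 2)`: half of a mixing exponent `γ > 2` is spent on summing over
distances, the other half on the decay in the remaining variable. -/
noncomputable def decaySum (γ : ℝ) : ℝ := ∑' t : ℕ, ((t : ℝ) + 1) ^ (-(γ / 2))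

lemma decaySum_nonneg (γ : ℝ) : 0 ≤ decaySum γ := tsum_nonneg fun _ => by positivity

lemma sum_rpow_le_decaySum (hγ : 2 < γ) (N : ℕ) :
    ∑ t ∈ Finset.range N, ((t : ℝ) + 1) ^ (-(γ / 2)) ≤ decaySum γ := by
  have hsum := (summable_nat_add_iff 1).2 (Real.summable_nat_rpow.2
    (show -(γ / 2) < -1 by linarith))
  simp only [Nat.cast_add, Nat.cast_one] at hsum
  exact hsum.sum_le_tsum _ fun _ _ => by positivity

lemma add_rpow_neg_le (hγ : 0 ≤ γ) {s t : ℝ} (hs : 0 < s) (ht : 0 < t) :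
    (s + t) ^ (-γ) ≤ s ^ (-(γ / 2)) * t ^ (-(γ / 2)) := by
  have hhalf : -γ = -(γ / 2) + -(γ / 2) := by ring
  rw [hhalf, Real.rpow_add (by positivity)]
  exact mul_le_mul (Real.rpow_le_rpow_of_nonpos hs (by linarith) (by linarith))
    (Real.rpow_le_rpow_of_nonpos ht (by linarith) (by linarith)) (by positivity) (by positivity)

lemma mul_rpow_neg_le (hγ : 2 ≤ γ) {s : ℝ} (hs : 1 ≤ s) : s * s ^ (-γ) ≤ s ^ (-(γ / 2)) := by
  calc s * s ^ (-γ) = s ^ (1 + -γ) := by rw [Real.rpow_add (by linarith), Real.rpow_one]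
    _ ≤ s ^ (-(γ / 2)) := Real.rpow_le_rpow_of_exponent_le hs (by linarith)

end Decay

section Telescope

variable {X : Type*} [TopologicalSpace X] [CompactSpace X] [MeasurableSpace X]
  [OpensMeasurableSpace (ℕ → X)] {ν : Measure (ℕ → X)} [IsFiniteMeasure ν] {N n : ℕ}
  {F : Finset ℕ → (ℕ → X) → ℝ} {φ : (ℕ → X) → ℝ} {c : ℝ}

lemma integral_mul_farTimes_eq_sum (hn : n < N) (hF : ∀ T, Continuous (F T))
    (hF0 : ∀ ω, F ∅ ω = c) (hφ : Continuous φ) (hφ0 : ∫ ω, φ ω ∂ν = 0) (j : ℕ) :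
    ∫ ω, φ ω * F (farTimes N n j) ω ∂ν = ∑ t ∈ Finset.range N,
      ∫ ω, φ ω * (F (farTimes N n (j + t)) ω - F (farTimes N n (j + t + 1)) ω) ∂ν := by
  have hterm (t : ℕ) :
      Continuous fun ω => φ ω * (F (farTimes N n (j + t)) ω - F (farTimes N n (j + t + 1)) ω) :=
    hφ.mul ((hF _).sub (hF _))
  have hexpand ω : φ ω * F (farTimes N n j) ω = (∑ t ∈ Finset.range N,
      φ ω * (F (farTimes N n (j + t)) ω - F (farTimes N n (j + t + 1)) ω)) + φ ω * c := by
    rw [eq_sum_sub_farTimes (fun T => F T ω) hn j, hF0, mul_add, Finset.mul_sum]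
  simp only [hexpand]
  rw [integral_add (integrable_of_continuous (continuous_finsetSum _ fun t _ => hterm t))
      ((integrable_of_continuous hφ).mul_const c), integral_mul_const, hφ0, zero_mul,
    add_zero, integral_finsetSum _ fun t _ => integrable_of_continuous (hterm t)]

end Telescope

section Mixing

variable {X : Type*} [PseudoMetricSpace X] [MeasurableSpace X]
  {ν : Measure (ℕ → X)} {d : ℕ} {γ C A M : ℝ} {v : ℕ → X → Fin d → ℝ} {p : (Fin d → ℝ) → ℝ}
  {N n m j : ℕ}

/-- The covariance of the component `a` at time `n` with the component `b` of the sum over the times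
at distance `m` from `n`, for a centred process `v`. -/
noncomputable def sphereCov (ν : Measure (ℕ → X)) (v : ℕ → X → Fin d → ℝ) (N n m : ℕ)
    (a b : Fin d) : ℝ :=
  ∫ ω, v n (ω n) a * partialSum v (sphereTimes N n m) ω b ∂ν

namespace Mixing

lemma nonneg (hmix : Mixing ν γ C) : 0 ≤ C := by
  have hzero : BoundedLip 1 ∅ (fun _ : ℕ → X => 0) :=
    ⟨fun _ => by simp, fun _ _ => by simp⟩
  simpa using hmix 0 0 0 1 1 ∅ ∅ _ _ hzero hzero (by simp) le_rfl (by simp) (by simp)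

lemma abs_integral_apply_mul_le (hmix : Mixing ν γ C) (hv : UniformLip A v)
    (hv0 : ∀ i a, ∫ ω, v i (ω i) a ∂ν = 0) (a : Fin d) {b₂ : ℝ} {Q : (ℕ → X) → ℝ}
    (hQ : BoundedLip b₂ (farTimes N n m) Q) :
    |∫ ω, v n (ω n) a * Q ω ∂ν| ≤ C * A * b₂ * ((m : ℝ) + 1) ^ (-γ) :=
  hmix n n m A b₂ {n} (farTimes N n m) _ Q (hv.boundedLip_apply n a) hQ
    (fun i hi => by rw [Finset.mem_singleton.1 hi]; exact ⟨le_rfl, le_rfl⟩) le_rfl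
    (fun _ hi => (Finset.mem_filter.1 hi).2) (hv0 n a)

variable [Nonempty X]

lemma abs_sphereCov_le (hmix : Mixing ν γ C) (hv : UniformLip A v)
    (hv0 : ∀ i a, ∫ ω, v i (ω i) a ∂ν = 0) (a b : Fin d) :
    |sphereCov ν v N n m a b| ≤ C * A * (2 * A) * ((m : ℝ) + 1) ^ (-γ) :=
  hmix.abs_integral_apply_mul_le hv hv0 a
    ((hv.boundedLip_partialSum_sphereTimes N n m b).mono le_rfl (sphereTimes_subset_farTimes N n m))

lemma abs_integral_mul_partialDeriv_near_le (hmix : Mixing ν γ C) (hγ : 2 ≤ γ)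
    (hv : UniformLip A v) (hv0 : ∀ i a, ∫ ω, v i (ω i) a ∂ν = 0) (hp : SmoothBounded M p)
    (a b : Fin d) :
    |∫ ω, v n (ω n) a * ((partialDeriv p b (partialSum v (farTimes N n (m + 1)) ω) -
        partialDeriv p b (partialSum v (farTimes N n (m + 1 + m)) ω)) *
          partialSum v (sphereTimes N n m) ω b) ∂ν| ≤
      8 * (C * M * A ^ 3) * ((m : ℝ) + 1) ^ (-(γ / 2)) := by
  have hA := hv.nonneg
  have hM := hp.nonneg
  have hC := hmix.nonneg
  have hnear := (hv.boundedLip_partialDeriv_sub hp N n (m + 1) m b (B := (m : ℝ) + 1)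
    (by linarith) (by simp)).mono le_rfl (farTimes_anti N n (Nat.le_succ m))
  have hsphere := (hv.boundedLip_partialSum_sphereTimes N n m b).mono le_rfl
    (sphereTimes_subset_farTimes N n m)
  calc _ ≤ C * A * (2 * (2 * M * A * ((m : ℝ) + 1) * (2 * A))) * ((m : ℝ) + 1) ^ (-γ) :=
        hmix.abs_integral_apply_mul_le hv hv0 a (hnear.mul hsphere)
    _ = 8 * (C * M * A ^ 3) * (((m : ℝ) + 1) * ((m : ℝ) + 1) ^ (-γ)) := by ring
    _ ≤ _ := mul_le_mul_of_nonneg_left (mul_rpow_neg_le hγ (by simp)) (by positivity)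

variable [CompactSpace X] [OpensMeasurableSpace (ℕ → X)] [IsProbabilityMeasure ν]

lemma abs_integral_centred_mul_le (hmix : Mixing ν γ C) (hv : UniformLip A v)
    (hp : SmoothBounded M p) (hmj : m ≤ j) (a b : Fin d) :
    |∫ ω, (v n (ω n) a * partialSum v (sphereTimes N n m) ω b - sphereCov ν v N n m a b) *
      (partialDeriv p b (partialSum v (farTimes N n j) ω) -
        partialDeriv p b (partialSum v (farTimes N n (j + 1)) ω)) ∂ν| ≤
      16 * (C * M * A ^ 3) * (((j - m : ℕ) : ℝ) + 1) ^ (-γ) := by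
  have hprod := ((hv.boundedLip_apply n a).mono le_rfl
    (Finset.subset_union_left (s₂ := sphereTimes N n m))).mul
    ((hv.boundedLip_partialSum_sphereTimes N n m b).mono le_rfl
      (Finset.subset_union_right (s₁ := {n})))
  have hcentred := hprod.sub_const (abs_integral_le_of_forall (ν := ν) hprod.abs_le)
  have hfar := hv.boundedLip_partialDeriv_sub hp N n j 1 b (B := 1) (by simp) le_rfl
  refine (hmix (n - m) (n + m) (j - m) _ _ _ _ _ _ hcentred hfar ?_ (by omega) ?_ ?_).trans_eq
    (by ring)
  · intro i hi
    rw [Finset.mem_union, Finset.mem_singleton] at hi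
    rcases hi with rfl | hi
    · omega
    · have hdist := (Finset.mem_filter.1 hi).2
      omega
  · intro i hi
    have hdist := (Finset.mem_filter.1 hi).2
    omega
  · rw [integral_sub (integrable_of_continuous hprod.continuous) (integrable_const _),
      integral_const, probReal_univ, one_smul, sub_self]

lemma abs_integral_centred_mul_partialDeriv_le (hmix : Mixing ν γ C) (hγ : 2 < γ)
    (hv : UniformLip A v) (hp : SmoothBounded M p) (hn : n < N) (a b : Fin d) :
    |∫ ω, (v n (ω n) a * partialSum v (sphereTimes N n m) ω b - sphereCov ν v N n m a b) *
        partialDeriv p b (partialSum v (farTimes N n (m + 1 + m)) ω) ∂ν| ≤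
      16 * decaySum γ * (C * M * A ^ 3) * ((m : ℝ) + 1) ^ (-(γ / 2)) := by
  have hA := hv.nonneg
  have hM := hp.nonneg
  have hC := hmix.nonneg
  have hprod : Continuous fun ω => v n (ω n) a * partialSum v (sphereTimes N n m) ω b :=
    (hv.boundedLip_apply n a).continuous.mul
      (hv.boundedLip_partialSum_sphereTimes N n m b).continuous
  have hdiff : Continuous fun ω => v n (ω n) a * partialSum v (sphereTimes N n m) ω b -
      sphereCov ν v N n m a b := hprod.sub continuous_const
  have hcentred : ∫ ω, (v n (ω n) a * partialSum v (sphereTimes N n m) ω b -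
      sphereCov ν v N n m a b) ∂ν = 0 := by
    rw [integral_sub (integrable_of_continuous hprod) (integrable_const _), integral_const,
      probReal_univ, one_smul, sphereCov, sub_self]
  have hterm t : |∫ ω, (v n (ω n) a * partialSum v (sphereTimes N n m) ω b -
        sphereCov ν v N n m a b) *
      (partialDeriv p b (partialSum v (farTimes N n (m + 1 + m + t)) ω) -
        partialDeriv p b (partialSum v (farTimes N n (m + 1 + m + t + 1)) ω)) ∂ν| ≤
      16 * (C * M * A ^ 3) * ((m : ℝ) + 1) ^ (-(γ / 2)) * ((t : ℝ) + 1) ^ (-(γ / 2)) := by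
    have hdist : ((m + 1 + m + t - m : ℕ) : ℝ) + 1 = ((m : ℝ) + 1) + ((t : ℝ) + 1) := by
      rw [show m + 1 + m + t - m = m + 1 + t by omega]
      push_cast
      ring
    refine (hmix.abs_integral_centred_mul_le hv hp (by omega) a b).trans ?_
    rw [hdist, mul_assoc (16 * _)]
    exact mul_le_mul_of_nonneg_left (add_rpow_neg_le (by linarith) (by positivity) (by positivity))
      (by positivity)
  rw [integral_mul_farTimes_eq_sum (F := fun T ω => partialDeriv p b (partialSum v T ω))
    (c := partialDeriv p b 0) hn
    (fun T => (hp.continuous_partialDeriv b).comp (hv.continuous_partialSum T))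
    (fun ω => by rw [partialSum_empty]) hdiff hcentred]
  refine (Finset.abs_sum_le_sum_abs _ _).trans ((Finset.sum_le_sum fun t _ => hterm t).trans ?_)
  rw [← Finset.mul_sum]
  refine (mul_le_mul_of_nonneg_left (sum_rpow_le_decaySum hγ N) (by positivity)).trans_eq ?_
  ring

lemma abs_sphereCov_mul_integral_sub_le (hmix : Mixing ν γ C) (hγ : 2 ≤ γ) (hv : UniformLip A v)
    (hv0 : ∀ i a, ∫ ω, v i (ω i) a ∂ν = 0) (hp : SmoothBounded M p) (a b : Fin d) :
    |sphereCov ν v N n m a b *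
        (∫ ω, partialDeriv p b (partialSum v (farTimes N n (m + 1 + m)) ω) ∂ν -
          ∫ ω, partialDeriv p b (partialSum v (Finset.range N) ω) ∂ν)| ≤
      8 * (C * M * A ^ 3) * ((m : ℝ) + 1) ^ (-(γ / 2)) := by
  have hA := hv.nonneg
  have hM := hp.nonneg
  have hC := hmix.nonneg
  have hint T : Integrable (fun ω => partialDeriv p b (partialSum v T ω)) ν :=
    integrable_of_continuous ((hp.continuous_partialDeriv b).comp (hv.continuous_partialSum T))
  have hrestore : |∫ ω, partialDeriv p b (partialSum v (farTimes N n (m + 1 + m)) ω) ∂ν -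
      ∫ ω, partialDeriv p b (partialSum v (Finset.range N) ω) ∂ν| ≤
      M * (2 * A * (2 * ((m : ℝ) + 1))) := by
    rw [← integral_sub (hint _) (hint _)]
    refine abs_integral_le_of_forall fun ω => ?_
    have hdiff := hv.norm_partialSum_farTimes_sub_le N n 0 (m + 1 + m) ω
    rw [zero_add, farTimes_zero] at hdiff
    rw [abs_sub_comm]
    refine (hp.abs_partialDeriv_sub_le b _ _).trans (mul_le_mul_of_nonneg_left ?_ hM)
    have hcast : ((m + 1 + m : ℕ) : ℝ) ≤ 2 * ((m : ℝ) + 1) := by push_cast; linarith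
    exact hdiff.trans (mul_le_mul_of_nonneg_left hcast (by positivity))
  rw [abs_mul]
  calc _ ≤ C * A * (2 * A) * ((m : ℝ) + 1) ^ (-γ) * (M * (2 * A * (2 * ((m : ℝ) + 1)))) :=
        mul_le_mul (hmix.abs_sphereCov_le hv hv0 a b) hrestore (abs_nonneg _) (by positivity)
    _ = 8 * (C * M * A ^ 3) * (((m : ℝ) + 1) * ((m : ℝ) + 1) ^ (-γ)) := by ring
    _ ≤ _ := mul_le_mul_of_nonneg_left (mul_rpow_neg_le hγ (by simp)) (by positivity)

-- The neighbourhood of `n` is first enlarged to distance `2 * m + 1`, so that the product of the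
-- two coordinates can be decoupled from the rest, and then filled in again.
lemma abs_integral_mul_partialDeriv_sub_le (hmix : Mixing ν γ C) (hγ : 2 < γ)
    (hv : UniformLip A v) (hv0 : ∀ i a, ∫ ω, v i (ω i) a ∂ν = 0) (hp : SmoothBounded M p)
    (hn : n < N) (a b : Fin d) :
    |∫ ω, v n (ω n) a * partialSum v (sphereTimes N n m) ω b *
        partialDeriv p b (partialSum v (farTimes N n (m + 1)) ω) ∂ν -
      sphereCov ν v N n m a b * ∫ ω, partialDeriv p b (partialSum v (Finset.range N) ω) ∂ν| ≤
      C * M * A ^ 3 * (16 + 16 * decaySum γ) * ((m : ℝ) + 1) ^ (-(γ / 2)) := by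
  have hnear := hmix.abs_integral_mul_partialDeriv_near_le hγ.le hv hv0 hp a b (N := N) (n := n)
    (m := m)
  have hdecouple := hmix.abs_integral_centred_mul_partialDeriv_le hγ hv hp hn a b (m := m)
  have hrestore := hmix.abs_sphereCov_mul_integral_sub_le hγ.le hv hv0 hp a b (N := N) (n := n)
    (m := m)
  set c := sphereCov ν v N n m a b
  set u : (ℕ → X) → ℝ := fun ω => v n (ω n) a
  set U : (ℕ → X) → ℝ := fun ω => partialSum v (sphereTimes N n m) ω b
  set P : ℕ → (ℕ → X) → ℝ := fun j ω => partialDeriv p b (partialSum v (farTimes N n j) ω)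
  set P₀ : (ℕ → X) → ℝ := fun ω => partialDeriv p b (partialSum v (Finset.range N) ω)
  have hprod : Continuous fun ω => u ω * U ω := (hv.boundedLip_apply n a).continuous.mul
    (hv.boundedLip_partialSum_sphereTimes N n m b).continuous
  have hP j : Continuous (P j) :=
    (hp.continuous_partialDeriv b).comp (hv.continuous_partialSum _)
  have hint j : Integrable (fun ω => u ω * U ω * P j ω) ν :=
    integrable_of_continuous (hprod.mul (hP j))
  have henlarge : ∫ ω, u ω * ((P (m + 1) ω - P (m + 1 + m) ω) * U ω) ∂ν =
      ∫ ω, u ω * U ω * P (m + 1) ω ∂ν - ∫ ω, u ω * U ω * P (m + 1 + m) ω ∂ν := by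
    rw [← integral_sub (hint _) (hint _)]
    congr with ω
    ring
  have hcentre : ∫ ω, (u ω * U ω - c) * P (m + 1 + m) ω ∂ν =
      ∫ ω, u ω * U ω * P (m + 1 + m) ω ∂ν - c * ∫ ω, P (m + 1 + m) ω ∂ν := by
    simp only [sub_mul]
    rw [integral_sub (hint _) ((integrable_of_continuous (hP _)).const_mul c), integral_const_mul]
  change |∫ ω, u ω * ((P (m + 1) ω - P (m + 1 + m) ω) * U ω) ∂ν| ≤ _ at hnear
  change |∫ ω, (u ω * U ω - c) * P (m + 1 + m) ω ∂ν| ≤ _ at hdecouple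
  change |c * (∫ ω, P (m + 1 + m) ω ∂ν - ∫ ω, P₀ ω ∂ν)| ≤ _ at hrestore
  change |∫ ω, u ω * U ω * P (m + 1) ω ∂ν - c * ∫ ω, P₀ ω ∂ν| ≤ _
  rw [henlarge] at hnear
  rw [hcentre] at hdecouple
  rw [abs_le] at *
  constructor <;> linarith

end Mixing

end Mixing

section SteinOfMixing

variable {X : Type*} [PseudoMetricSpace X] [CompactSpace X] [MeasurableSpace X]
  [OpensMeasurableSpace (ℕ → X)] {ν : Measure (ℕ → X)} [IsProbabilityMeasure ν] {d : ℕ}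
  {γ C A M c : ℝ} {v : ℕ → X → Fin d → ℝ} {p : (Fin d → ℝ) → ℝ} {N n m : ℕ}

namespace UniformLip

lemma integral_partialSum_mul_eq_sum (hv : UniformLip A v)
    (hv0 : ∀ i a, ∫ ω, v i (ω i) a ∂ν = 0) {F : Finset ℕ → (ℕ → X) → ℝ}
    (hF : ∀ T, Continuous (F T)) (hF0 : ∀ ω, F ∅ ω = c) (N : ℕ) (a : Fin d) :
    ∫ ω, partialSum v (Finset.range N) ω a * F (Finset.range N) ω ∂ν =
      ∑ n ∈ Finset.range N, ∑ m ∈ Finset.range N, ∫ ω, v n (ω n) a *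
        (F (farTimes N n m) ω - F (farTimes N n (m + 1)) ω) ∂ν := by
  have hcoord n : Continuous fun ω : ℕ → X => v n (ω n) a := (hv.boundedLip_apply n a).continuous
  have hterm n : Continuous fun ω => v n (ω n) a * F (Finset.range N) ω := (hcoord n).mul (hF _)
  simp only [partialSum, Finset.sum_apply, Finset.sum_mul]
  rw [integral_finsetSum _ fun n _ => integrable_of_continuous (hterm n)]
  refine Finset.sum_congr rfl fun n hn => ?_
  have htel := integral_mul_farTimes_eq_sum (Finset.mem_range.1 hn) hF hF0 (hcoord n) (hv0 n a) 0
  simpa only [farTimes_zero, zero_add] using htel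

lemma integral_partialSum_mul_partialSum (hv : UniformLip A v)
    (hv0 : ∀ i a, ∫ ω, v i (ω i) a ∂ν = 0) (N : ℕ) (a b : Fin d) :
    ∫ ω, partialSum v (Finset.range N) ω a * partialSum v (Finset.range N) ω b ∂ν =
      ∑ n ∈ Finset.range N, ∑ m ∈ Finset.range N, sphereCov ν v N n m a b := by
  rw [hv.integral_partialSum_mul_eq_sum hv0 (F := fun T ω => partialSum v T ω b) (c := 0)
    (fun T => (continuous_apply b).comp (hv.continuous_partialSum T))
    (fun ω => by rw [partialSum_empty, Pi.zero_apply])]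
  have hsphere n m ω : partialSum v (farTimes N n m) ω b - partialSum v (farTimes N n (m + 1)) ω b =
      partialSum v (sphereTimes N n m) ω b := by
    rw [partialSum_farTimes v N n m, Pi.add_apply, add_sub_cancel_left]
  simp only [hsphere, sphereCov]

variable [Nonempty X]

lemma integral_mul_sub_eq_taylor (hv : UniformLip A v) (hp : SmoothBounded M p) (a : Fin d) :
    ∫ ω, v n (ω n) a * (p (partialSum v (farTimes N n m) ω) -
        p (partialSum v (farTimes N n (m + 1)) ω)) ∂ν =
      ∫ ω, v n (ω n) a * taylorRem p (partialSum v (farTimes N n (m + 1)) ω)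
        (partialSum v (sphereTimes N n m) ω) ∂ν +
      ∑ b, ∫ ω, v n (ω n) a * partialSum v (sphereTimes N n m) ω b *
        partialDeriv p b (partialSum v (farTimes N n (m + 1)) ω) ∂ν := by
  have hrem : Continuous fun ω => v n (ω n) a * taylorRem p
      (partialSum v (farTimes N n (m + 1)) ω) (partialSum v (sphereTimes N n m) ω) :=
    (hv.boundedLip_apply n a).continuous.mul (hv.boundedLip_taylorRem hp N n m).continuous
  have hlin b : Continuous fun ω => v n (ω n) a * partialSum v (sphereTimes N n m) ω b *
      partialDeriv p b (partialSum v (farTimes N n (m + 1)) ω) :=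
    ((hv.boundedLip_apply n a).continuous.mul
      (hv.boundedLip_partialSum_sphereTimes N n m b).continuous).mul
        ((hp.continuous_partialDeriv b).comp (hv.continuous_partialSum _))
  rw [← integral_finsetSum _ fun b _ => integrable_of_continuous (hlin b),
    ← integral_add (integrable_of_continuous hrem)
      (integrable_of_continuous (continuous_finsetSum _ fun b _ => hlin b))]
  refine integral_congr_ae (ae_of_all _ fun ω => ?_)
  simp only [mul_assoc, ← Finset.mul_sum]
  rw [← fderiv_eq_sum_partialDeriv, taylorRem, ← partialSum_farTimes]
  ring

end UniformLip

namespace Mixing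

variable [Nonempty X]

lemma abs_integral_mul_sub_sub_le (hmix : Mixing ν γ C) (hγ : 2 < γ) (hv : UniformLip A v)
    (hv0 : ∀ i a, ∫ ω, v i (ω i) a ∂ν = 0) (hp : SmoothBounded M p) (hn : n < N) (a : Fin d) :
    |∫ ω, v n (ω n) a * (p (partialSum v (farTimes N n m) ω) -
        p (partialSum v (farTimes N n (m + 1)) ω)) ∂ν -
      ∑ b, sphereCov ν v N n m a b *
        ∫ ω, partialDeriv p b (partialSum v (Finset.range N) ω) ∂ν| ≤
      C * M * A ^ 3 * (4 + d * (16 + 16 * decaySum γ)) * ((m : ℝ) + 1) ^ (-(γ / 2)) := by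
  have hA := hv.nonneg
  have hM := hp.nonneg
  have hC := hmix.nonneg
  have hrem := hmix.abs_integral_apply_mul_le hv hv0 a (hv.boundedLip_taylorRem hp N n m)
  have hlin := Finset.sum_le_sum fun b (_ : b ∈ Finset.univ) =>
    hmix.abs_integral_mul_partialDeriv_sub_le hγ hv hv0 hp hn a b (m := m)
  rw [Finset.sum_const, Finset.card_univ, Fintype.card_fin, nsmul_eq_mul] at hlin
  have hdecay : ((m : ℝ) + 1) ^ (-γ) ≤ ((m : ℝ) + 1) ^ (-(γ / 2)) :=
    Real.rpow_le_rpow_of_exponent_le (by simp) (by linarith)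
  rw [hv.integral_mul_sub_eq_taylor hp, add_sub_assoc, ← Finset.sum_sub_distrib]
  calc _ ≤ C * A * (4 * M * A ^ 2) * ((m : ℝ) + 1) ^ (-γ) +
        d * (C * M * A ^ 3 * (16 + 16 * decaySum γ) * ((m : ℝ) + 1) ^ (-(γ / 2))) :=
        (abs_add_le _ _).trans (add_le_add hrem ((Finset.abs_sum_le_sum_abs _ _).trans hlin))
    _ ≤ C * A * (4 * M * A ^ 2) * ((m : ℝ) + 1) ^ (-(γ / 2)) +
        d * (C * M * A ^ 3 * (16 + 16 * decaySum γ) * ((m : ℝ) + 1) ^ (-(γ / 2))) := by gcongr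
    _ = _ := by ring

lemma abs_integral_partialSum_mul_sub_le (hmix : Mixing ν γ C) (hγ : 2 < γ) (hv : UniformLip A v)
    (hv0 : ∀ i a, ∫ ω, v i (ω i) a ∂ν = 0) (hp : SmoothBounded M p) (N : ℕ) (a : Fin d) :
    |∫ ω, partialSum v (Finset.range N) ω a * p (partialSum v (Finset.range N) ω) ∂ν -
      ∑ b, (∫ ω, partialSum v (Finset.range N) ω a * partialSum v (Finset.range N) ω b ∂ν) *
        ∫ ω, partialDeriv p b (partialSum v (Finset.range N) ω) ∂ν| ≤
      N * (C * M * A ^ 3 * (4 + d * (16 + 16 * decaySum γ)) * decaySum γ) := by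
  have hA := hv.nonneg
  have hM := hp.nonneg
  have hC := hmix.nonneg
  have hZ := decaySum_nonneg γ
  have hcov : ∑ b, (∫ ω, partialSum v (Finset.range N) ω a *
        partialSum v (Finset.range N) ω b ∂ν) *
          ∫ ω, partialDeriv p b (partialSum v (Finset.range N) ω) ∂ν =
      ∑ n ∈ Finset.range N, ∑ m ∈ Finset.range N, ∑ b, sphereCov ν v N n m a b *
        ∫ ω, partialDeriv p b (partialSum v (Finset.range N) ω) ∂ν := by
    simp only [hv.integral_partialSum_mul_partialSum hv0, Finset.sum_mul]
    rw [Finset.sum_comm]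
    exact Finset.sum_congr rfl fun n _ => Finset.sum_comm
  rw [hv.integral_partialSum_mul_eq_sum hv0 (F := fun T ω => p (partialSum v T ω)) (c := p 0)
    (fun T => hp.differentiable.continuous.comp (hv.continuous_partialSum T))
    (fun ω => by rw [partialSum_empty]), hcov]
  simp only [← Finset.sum_sub_distrib]
  refine (Finset.abs_sum_le_sum_abs _ _).trans
    ((Finset.sum_le_card_nsmul _ _ _ fun n hn => ?_).trans_eq
      (by rw [Finset.card_range, nsmul_eq_mul]))
  refine (Finset.abs_sum_le_sum_abs _ _).trans ((Finset.sum_le_sum fun m _ =>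
    hmix.abs_integral_mul_sub_sub_le hγ hv hv0 hp (Finset.mem_range.1 hn) a).trans ?_)
  rw [← Finset.mul_sum]
  exact mul_le_mul_of_nonneg_left (sum_rpow_le_decaySum hγ N) (by positivity)

theorem steinApprox_map_partialSum (hmix : Mixing ν γ C) (hγ : 2 < γ) (hv : UniformLip A v)
    (hv0 : ∀ i a, ∫ ω, v i (ω i) a ∂ν = 0) (N : ℕ) :
    SteinApprox M (N * (C * M * A ^ 3 * (4 + d * (16 + 16 * decaySum γ)) * decaySum γ))
      (Matrix.of fun a b => ∫ ω, partialSum v (Finset.range N) ω a *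
        partialSum v (Finset.range N) ω b ∂ν)
      (ν.map (partialSum v (Finset.range N))) := by
  intro p a hp
  have hW := (hv.continuous_partialSum (Finset.range N)).measurable.aemeasurable (μ := ν)
  have hpc := hp.differentiable.continuous
  have hpderiv b := hp.continuous_partialDeriv b
  rw [integral_map hW (by fun_prop)]
  simp only [integral_map hW (hpderiv _).aestronglyMeasurable]
  exact hmix.abs_integral_partialSum_mul_sub_le hγ hv hv0 hp N a

end Mixing

end SteinOfMixing
section PomeauManneville

/-- The left branch of `pmMap` on `[0,1/2]`, as a real function. -/
noncomputable def leftMap (a : ℝ≥0) (y : ℝ) : ℝ := y * (1 + 2 ^ (a : ℝ) * y ^ (a : ℝ))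

/-- The derivative of `leftMap`. -/
noncomputable def leftDeriv (a : ℝ≥0) (y : ℝ) : ℝ := 1 + (1 + a) * (2 ^ (a : ℝ) * y ^ (a : ℝ))

/-- The inverse of `leftMap` on `[0,1]`. -/
noncomputable def leftInv (a : ℝ≥0) (x : ℝ) : ℝ :=
  Function.invFunOn (leftMap a) (Set.Icc 0 (1 / 2)) x

variable (a : ℝ≥0) {x y z : ℝ}

lemma coe_pmMap_of_lt_half {x : I} (h : (x : ℝ) < 1 / 2) : (pmMap a x : ℝ) = leftMap a x := by
  simp only [pmMap, leftMap, h, if_true]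

lemma coe_pmMap_of_half_le {x : I} (h : 1 / 2 ≤ (x : ℝ)) : (pmMap a x : ℝ) = 2 * x - 1 := by
  simp only [pmMap, h.not_gt, if_false]

lemma two_rpow_mul_rpow_le_one (hy : 0 ≤ y) (hy2 : y ≤ 1 / 2) :
    2 ^ (a : ℝ) * y ^ (a : ℝ) ≤ 1 := by
  rw [← Real.mul_rpow zero_le_two hy]
  exact Real.rpow_le_one (by positivity) (by linarith) a.2

lemma two_rpow_mul_rpow_le (hy : 0 ≤ y) (hyz : y ≤ z) :
    2 ^ (a : ℝ) * y ^ (a : ℝ) ≤ 2 ^ (a : ℝ) * z ^ (a : ℝ) := by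
  gcongr

lemma leftDeriv_pos (hy : 0 ≤ y) : 0 < leftDeriv a y := by
  unfold leftDeriv
  positivity

lemma leftDeriv_le_leftDeriv (hy : 0 ≤ y) (hyz : y ≤ z) : leftDeriv a y ≤ leftDeriv a z := by
  have hpow := two_rpow_mul_rpow_le a hy hyz
  unfold leftDeriv
  gcongr

lemma strictMonoOn_leftMap : StrictMonoOn (leftMap a) (Set.Ici 0) := by
  intro y (hy : 0 ≤ y) z _ hyz
  have hpow := two_rpow_mul_rpow_le a hy hyz.le
  have hpow0 : 0 ≤ 2 ^ (a : ℝ) * y ^ (a : ℝ) := by positivity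
  unfold leftMap
  nlinarith

lemma continuous_leftMap : Continuous (leftMap a) :=
  continuous_id.mul (continuous_const.add
    (continuous_const.mul (Real.continuous_rpow_const a.2)))

lemma leftMap_zero : leftMap a 0 = 0 := zero_mul _

lemma leftMap_half : leftMap a (1 / 2) = 1 := by
  unfold leftMap
  rw [← Real.mul_rpow (by norm_num) (by norm_num)]
  norm_num

lemma surjOn_leftMap : Set.SurjOn (leftMap a) (Set.Icc 0 (1 / 2)) (Set.Icc 0 1) := by
  have hivt := intermediate_value_Icc (show (0 : ℝ) ≤ 1 / 2 by norm_num)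
    (continuous_leftMap a).continuousOn
  rwa [leftMap_zero, leftMap_half] at hivt

lemma leftInv_mem_Icc (hx : x ∈ Set.Icc (0 : ℝ) 1) : leftInv a x ∈ Set.Icc (0 : ℝ) (1 / 2) :=
  Function.invFunOn_mem (surjOn_leftMap a hx)

lemma leftMap_leftInv (hx : x ∈ Set.Icc (0 : ℝ) 1) : leftMap a (leftInv a x) = x :=
  Function.invFunOn_eq (surjOn_leftMap a hx)

lemma leftInv_leftMap (hy : y ∈ Set.Icc (0 : ℝ) (1 / 2)) : leftInv a (leftMap a y) = y :=
  ((strictMonoOn_leftMap a).mono Set.Icc_subset_Ici_self).injOn.leftInvOn_invFunOn hy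

lemma leftInv_pos (hx : x ∈ Set.Ioc (0 : ℝ) 1) : 0 < leftInv a x := by
  refine (leftInv_mem_Icc a (Set.Ioc_subset_Icc_self hx)).1.lt_of_ne fun h => hx.1.ne ?_
  rw [← leftMap_leftInv a (Set.Ioc_subset_Icc_self hx), ← h, leftMap_zero]

lemma leftInv_mem_Ioc (hx : x ∈ Set.Ioc (0 : ℝ) 1) : leftInv a x ∈ Set.Ioc (0 : ℝ) 1 :=
  ⟨leftInv_pos a hx, by linarith [(leftInv_mem_Icc a (Set.Ioc_subset_Icc_self hx)).2]⟩

lemma leftInv_le_leftInv (hx : x ∈ Set.Ioc (0 : ℝ) 1) (hy : y ∈ Set.Ioc (0 : ℝ) 1)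
    (hxy : x ≤ y) : leftInv a x ≤ leftInv a y := by
  have hx' := Set.Ioc_subset_Icc_self hx
  have hy' := Set.Ioc_subset_Icc_self hy
  rwa [← (strictMonoOn_leftMap a).le_iff_le (leftInv_mem_Icc a hx').1 (leftInv_mem_Icc a hy').1,
    leftMap_leftInv a hx', leftMap_leftInv a hy']

lemma hasDerivAt_leftMap (hy : 0 < y) : HasDerivAt (leftMap a) (leftDeriv a y) y := by
  have hrpow := Real.hasDerivAt_rpow_const (x := y) (p := (a : ℝ)) (Or.inl hy.ne')
  refine ((hasDerivAt_id y).mul ((hrpow.const_mul (2 ^ (a : ℝ))).const_add 1)).congr_deriv ?_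
  have hy_rpow : y ^ (a : ℝ) = y * y ^ ((a : ℝ) - 1) := by
    rw [Real.rpow_sub_one hy.ne']
    field_simp
  simp only [leftDeriv, id, hy_rpow]
  ring

lemma image_leftMap : leftMap a '' Set.Ioo 0 (1 / 2) = Set.Ioo 0 1 := by
  have hmono := (strictMonoOn_leftMap a).mono (Set.Icc_subset_Ici_self (b := (0 : ℝ)) (a := 1 / 2))
  refine Set.Subset.antisymm ?_ fun x hx => ?_
  · simpa only [leftMap_zero, leftMap_half] using hmono.mapsTo_Ioo.image_subset
  · have hx' := Set.Ioo_subset_Icc_self hx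
    refine ⟨leftInv a x, ⟨leftInv_pos a ⟨hx.1, hx.2.le⟩, ?_⟩, leftMap_leftInv a hx'⟩
    refine (leftInv_mem_Icc a hx').2.lt_of_ne fun h => hx.2.ne ?_
    rw [← leftMap_leftInv a hx', h, leftMap_half]

lemma image_rightMap : (fun y : ℝ => 2 * y - 1) '' Set.Icc (1 / 2) 1 = Set.Icc 0 1 := by
  ext x
  constructor
  · rintro ⟨y, hy, rfl⟩
    exact ⟨by linarith [hy.1], by linarith [hy.2]⟩
  · intro hx
    exact ⟨(x + 1) / 2, ⟨by linarith [hx.1], by linarith [hx.2]⟩, by ring⟩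

lemma hasDerivAt_rightMap (y : ℝ) : HasDerivAt (fun y : ℝ => 2 * y - 1) 2 y := by
  simpa using ((hasDerivAt_id y).const_mul 2).sub_const 1

lemma half_add_mem_Ioc (hx : x ∈ Set.Ioc (0 : ℝ) 1) : (x + 1) / 2 ∈ Set.Ioc (0 : ℝ) 1 :=
  ⟨by linarith [hx.1], by linarith [hx.2]⟩

end PomeauManneville

section ChangeOfVariables

/-- Extension of a function on the unit interval to the real line by its boundary values; it
reduces integrals over `I` to integrals over `(0,1]`. -/
noncomputable def realExt (F : I → ℝ) (x : ℝ) : ℝ := F (Set.projIcc 0 1 zero_le_one x)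

lemma realExt_of_mem (F : I → ℝ) {x : ℝ} (hx : x ∈ Set.Icc (0 : ℝ) 1) :
    realExt F x = F ⟨x, hx⟩ := by
  rw [realExt, Set.projIcc_of_mem]

lemma realExt_comp_coe (F : I → ℝ) : realExt F ∘ Subtype.val = F :=
  funext fun x => realExt_of_mem F x.2

lemma integral_unitInterval (F : I → ℝ) : ∫ x, F x = ∫ x in Set.Ioc (0 : ℝ) 1, realExt F x := by
  rw [← integral_Icc_eq_integral_Ioc, ← integral_subtype_comap measurableSet_Icc]
  exact congrArg (fun G : I → ℝ => ∫ x, G x) (realExt_comp_coe F).symm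

lemma integrable_unitInterval (F : I → ℝ) :
    Integrable F ↔ IntegrableOn (realExt F) (Set.Ioc (0 : ℝ) 1) := by
  rw [← integrableOn_Icc_iff_integrableOn_Ioc, IntegrableOn,
    ← map_comap_subtype_coe measurableSet_Icc,
    (MeasurableEmbedding.subtype_coe measurableSet_Icc).integrable_map_iff, realExt_comp_coe]
  rfl

lemma ae_mem_Ioc : ∀ᵐ x : I, (x : ℝ) ∈ Set.Ioc (0 : ℝ) 1 := by
  have hne : ∀ᵐ x : I, x ≠ 0 := by simp [ae_iff]
  filter_upwards [hne] with x hx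
  exact ⟨x.2.1.lt_of_ne fun h => hx (Subtype.ext h.symm), x.2.2⟩

variable {J : Set ℝ} {φ φ' : ℝ → ℝ} {F G : I → ℝ}

lemma integral_eq_of_branch (hJ : MeasurableSet J) (hJI : J ⊆ Set.Ioc 0 1)
    (hφ : ∀ y ∈ J, HasDerivAt φ (φ' y) y) (hinj : Set.InjOn φ J)
    (himage : (φ '' J : Set ℝ) =ᵐ[volume] Set.Ioc (0 : ℝ) 1)
    (heq : ∀ y ∈ J, |φ' y| * realExt F (φ y) = realExt G y)
    (hzero : ∀ y ∈ Set.Ioc (0 : ℝ) 1 \ J, realExt G y = 0) :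
    ∫ x, F x = ∫ x, G x := by
  rw [integral_unitInterval, integral_unitInterval, ← setIntegral_congr_set himage,
    integral_image_eq_integral_abs_deriv_smul hJ (fun y hy => (hφ y hy).hasDerivWithinAt) hinj]
  simp only [smul_eq_mul]
  rw [setIntegral_congr_fun hJ heq,
    setIntegral_eq_of_subset_of_forall_sdiff_eq_zero measurableSet_Ioc hJI hzero]

lemma integrable_iff_of_branch (hJ : MeasurableSet J) (hJI : J ⊆ Set.Ioc 0 1)
    (hφ : ∀ y ∈ J, HasDerivAt φ (φ' y) y) (hinj : Set.InjOn φ J)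
    (himage : (φ '' J : Set ℝ) =ᵐ[volume] Set.Ioc (0 : ℝ) 1)
    (heq : ∀ y ∈ J, |φ' y| * realExt F (φ y) = realExt G y)
    (hzero : ∀ y ∈ Set.Ioc (0 : ℝ) 1 \ J, realExt G y = 0) :
    Integrable F ↔ Integrable G := by
  rw [integrable_unitInterval, integrable_unitInterval, ← integrableOn_congr_set_ae himage,
    integrableOn_image_iff_integrableOn_abs_deriv_smul hJ
      (fun y hy => (hφ y hy).hasDerivWithinAt) hinj]
  simp only [smul_eq_mul]
  rw [integrableOn_congr_fun heq hJ]
  exact ⟨fun h => h.of_forall_sdiff_eq_zero measurableSet_Ioc hzero, fun h => h.mono_set hJI⟩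

end ChangeOfVariables

section TransferOperator

/-- The contribution of the left branch to the transfer operator. -/
noncomputable def leftOp (a : ℝ≥0) : (ℝ → ℝ) →ₗ[ℝ] ℝ → ℝ where
  toFun r x := r (leftInv a x) / leftDeriv a (leftInv a x)
  map_add' r s := funext fun _ => add_div (r _) (s _) _
  map_smul' c r := funext fun _ => mul_div_assoc c (r _) _

/-- The contribution of the right branch to the transfer operator. -/
noncomputable def rightOp : (ℝ → ℝ) →ₗ[ℝ] ℝ → ℝ where
  toFun r x := r ((x + 1) / 2) / 2
  map_add' r s := funext fun _ => add_div (r _) (s _) _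
  map_smul' c r := funext fun _ => mul_div_assoc c (r _) _

/-- The transfer operator of `pmMap`. It acts on densities on `(0,1]`, which are extended
arbitrarily to the real line. -/
noncomputable def transferOp (a : ℝ≥0) : (ℝ → ℝ) →ₗ[ℝ] ℝ → ℝ := leftOp a + rightOp

lemma leftOp_apply (a : ℝ≥0) (r : ℝ → ℝ) (x : ℝ) :
    leftOp a r x = r (leftInv a x) / leftDeriv a (leftInv a x) := rfl

lemma rightOp_apply (r : ℝ → ℝ) (x : ℝ) : rightOp r x = r ((x + 1) / 2) / 2 := rfl

lemma transferOp_apply (a : ℝ≥0) (r : ℝ → ℝ) (x : ℝ) :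
    transferOp a r x = leftOp a r x + rightOp r x := rfl

variable (a : ℝ≥0) (r : ℝ → ℝ) (B : I → ℝ)

lemma abs_leftDeriv_mul_leftOp {y : ℝ} (hy : y ∈ Set.Ioo (0 : ℝ) (1 / 2)) :
    |leftDeriv a y| * realExt (fun x => leftOp a r x * B x) (leftMap a y) =
      realExt (fun x => if (x : ℝ) < 1 / 2 then r x * B (pmMap a x) else 0) y := by
  have hyI : y ∈ Set.Icc (0 : ℝ) 1 := ⟨hy.1.le, by linarith [hy.2]⟩
  have hφI : leftMap a y ∈ Set.Icc (0 : ℝ) 1 :=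
    Set.Ioo_subset_Icc_self (image_leftMap a ▸ Set.mem_image_of_mem _ hy)
  have hpm : pmMap a ⟨y, hyI⟩ = ⟨leftMap a y, hφI⟩ := Subtype.ext (coe_pmMap_of_lt_half a hy.2)
  have hderiv := leftDeriv_pos a hy.1.le
  rw [realExt_of_mem _ hyI, realExt_of_mem _ hφI, if_pos hy.2, hpm, leftOp_apply,
    leftInv_leftMap a ⟨hy.1.le, hy.2.le⟩, abs_of_pos hderiv]
  field_simp

lemma abs_two_mul_rightOp {y : ℝ} (hy : y ∈ Set.Icc (1 / 2 : ℝ) 1) :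
    |(2 : ℝ)| * realExt (fun x => rightOp r x * B x) (2 * y - 1) =
      realExt (fun x => if (x : ℝ) < 1 / 2 then 0 else r x * B (pmMap a x)) y := by
  have hyI : y ∈ Set.Icc (0 : ℝ) 1 := ⟨by linarith [hy.1], hy.2⟩
  have hφI : 2 * y - 1 ∈ Set.Icc (0 : ℝ) 1 := ⟨by linarith [hy.1], by linarith [hy.2]⟩
  have hpm : pmMap a ⟨y, hyI⟩ = ⟨2 * y - 1, hφI⟩ := Subtype.ext (coe_pmMap_of_half_le a hy.1)
  have hinv : (2 * y - 1 + 1) / 2 = y := by ring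
  rw [realExt_of_mem _ hyI, realExt_of_mem _ hφI, if_neg hy.1.not_gt, hpm, rightOp_apply, hinv,
    abs_two]
  ring

lemma realExt_ite_lt_half_eq_zero {y : ℝ} (hy : y ∈ Set.Ioc (0 : ℝ) 1 \ Set.Ioo 0 (1 / 2)) :
    realExt (fun x => if (x : ℝ) < 1 / 2 then B x else 0) y = 0 := by
  rw [realExt_of_mem _ (Set.Ioc_subset_Icc_self hy.1)]
  exact if_neg fun h => hy.2 ⟨hy.1.1, h⟩

lemma realExt_ite_half_le_eq_zero {y : ℝ} (hy : y ∈ Set.Ioc (0 : ℝ) 1 \ Set.Icc (1 / 2) 1) :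
    realExt (fun x => if (x : ℝ) < 1 / 2 then 0 else B x) y = 0 := by
  rw [realExt_of_mem _ (Set.Ioc_subset_Icc_self hy.1)]
  exact if_pos (not_le.1 fun h => hy.2 ⟨h, hy.1.2⟩)

lemma Ioo_zero_half_subset : Set.Ioo (0 : ℝ) (1 / 2) ⊆ Set.Ioc 0 1 :=
  fun _ hy => ⟨hy.1, by linarith [hy.2]⟩

lemma Icc_half_one_subset : Set.Icc (1 / 2 : ℝ) 1 ⊆ Set.Ioc 0 1 :=
  fun _ hy => ⟨by linarith [hy.1], hy.2⟩

lemma injOn_leftMap : Set.InjOn (leftMap a) (Set.Ioo 0 (1 / 2)) :=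
  (strictMonoOn_leftMap a).injOn.mono fun _ hy => hy.1.le

lemma image_leftMap_ae_eq :
    (leftMap a '' Set.Ioo 0 (1 / 2) : Set ℝ) =ᵐ[volume] Set.Ioc (0 : ℝ) 1 :=
  image_leftMap a ▸ Ioo_ae_eq_Ioc

lemma injOn_rightMap : Set.InjOn (fun y : ℝ => 2 * y - 1) (Set.Icc (1 / 2) 1) :=
  fun y _ z _ h => by simpa using h

lemma image_rightMap_ae_eq :
    ((fun y : ℝ => 2 * y - 1) '' Set.Icc (1 / 2) 1 : Set ℝ) =ᵐ[volume] Set.Ioc (0 : ℝ) 1 :=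
  image_rightMap ▸ Ioc_ae_eq_Icc.symm

lemma integral_leftOp_mul :
    ∫ x : I, leftOp a r x * B x =
      ∫ x : I, if (x : ℝ) < 1 / 2 then r x * B (pmMap a x) else 0 :=
  integral_eq_of_branch measurableSet_Ioo Ioo_zero_half_subset
    (fun _ hy => hasDerivAt_leftMap a hy.1) (injOn_leftMap a) (image_leftMap_ae_eq a)
    (fun _ => abs_leftDeriv_mul_leftOp a r B) fun _ => realExt_ite_lt_half_eq_zero _

lemma integrable_leftOp_mul :
    Integrable (fun x : I => leftOp a r x * B x) ↔
      Integrable (fun x : I => if (x : ℝ) < 1 / 2 then r x * B (pmMap a x) else 0) :=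
  integrable_iff_of_branch measurableSet_Ioo Ioo_zero_half_subset
    (fun _ hy => hasDerivAt_leftMap a hy.1) (injOn_leftMap a) (image_leftMap_ae_eq a)
    (fun _ => abs_leftDeriv_mul_leftOp a r B) fun _ => realExt_ite_lt_half_eq_zero _

lemma integral_rightOp_mul :
    ∫ x : I, rightOp r x * B x =
      ∫ x : I, if (x : ℝ) < 1 / 2 then 0 else r x * B (pmMap a x) :=
  integral_eq_of_branch measurableSet_Icc Icc_half_one_subset
    (fun y _ => hasDerivAt_rightMap y) injOn_rightMap image_rightMap_ae_eq
    (fun _ => abs_two_mul_rightOp a r B) fun _ => realExt_ite_half_le_eq_zero _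

lemma integrable_rightOp_mul :
    Integrable (fun x : I => rightOp r x * B x) ↔
      Integrable (fun x : I => if (x : ℝ) < 1 / 2 then 0 else r x * B (pmMap a x)) :=
  integrable_iff_of_branch measurableSet_Icc Icc_half_one_subset
    (fun y _ => hasDerivAt_rightMap y) injOn_rightMap image_rightMap_ae_eq
    (fun _ => abs_two_mul_rightOp a r B) fun _ => realExt_ite_half_le_eq_zero _

variable {r B}

lemma measurableSet_lt_half : MeasurableSet {x : I | (x : ℝ) < 1 / 2} :=
  measurableSet_lt measurable_subtype_coe measurable_const

lemma integrable_ite_lt_half {F : I → ℝ} (hF : Integrable F) :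
    Integrable fun x : I => if (x : ℝ) < 1 / 2 then F x else 0 :=
  (hF.indicator measurableSet_lt_half).congr (ae_of_all _ fun _ => by
    simp only [Set.indicator, Set.mem_ofPred_eq])

lemma integrable_ite_half_le {F : I → ℝ} (hF : Integrable F) :
    Integrable fun x : I => if (x : ℝ) < 1 / 2 then 0 else F x := by
  refine (hF.sub (integrable_ite_lt_half hF)).congr (ae_of_all _ fun x => ?_)
  simp only [Pi.sub_apply]
  split_ifs <;> simp

lemma integrable_leftOp (hr : Integrable fun x : I => r x) :
    Integrable fun x : I => leftOp a r x := by
  simpa using (integrable_leftOp_mul a r fun _ => 1).2 (by simpa using integrable_ite_lt_half hr)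

lemma integrable_rightOp (hr : Integrable fun x : I => r x) :
    Integrable fun x : I => rightOp r x := by
  simpa using (integrable_rightOp_mul 0 r fun _ => 1).2 (by simpa using integrable_ite_half_le hr)

lemma integrable_transferOp (hr : Integrable fun x : I => r x) :
    Integrable fun x : I => transferOp a r x :=
  (integrable_leftOp a hr).add (integrable_rightOp hr)

lemma integral_transferOp_mul (h : Integrable fun x : I => r x * B (pmMap a x)) :
    ∫ x : I, transferOp a r x * B x = ∫ x : I, r x * B (pmMap a x) := by
  have hleft := integrable_ite_lt_half h
  have hright := integrable_ite_half_le h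
  simp only [transferOp_apply, add_mul]
  rw [integral_add ((integrable_leftOp_mul a r B).2 hleft)
    ((integrable_rightOp_mul a r B).2 hright), integral_leftOp_mul, integral_rightOp_mul a,
    ← integral_add hleft hright]
  congr with x
  split_ifs <;> simp

/-- The integral over the unit interval of a function on the real line. -/
noncomputable def mass (r : ℝ → ℝ) : ℝ := ∫ x : I, r x

lemma mass_le_mass {s : ℝ → ℝ} (hr : Integrable fun x : I => r x)
    (hs : Integrable fun x : I => s x) (h : ∀ x ∈ Set.Ioc (0 : ℝ) 1, r x ≤ s x) :
    mass r ≤ mass s :=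
  integral_mono_ae hr hs (ae_mem_Ioc.mono fun x => h x)

lemma mass_nonneg (hr : ∀ x ∈ Set.Ioc (0 : ℝ) 1, 0 ≤ r x) : 0 ≤ mass r :=
  integral_nonneg_of_ae (ae_mem_Ioc.mono fun x => hr x)

lemma mass_const (c : ℝ) : mass (fun _ => c) = c := by simp [mass]

lemma mass_transferOp (hr : Integrable fun x : I => r x) : mass (transferOp a r) = mass r := by
  simpa [mass] using integral_transferOp_mul a (r := r) (B := fun _ => 1) (by simpa using hr)

lemma mass_leftOp_add_rightOp (hr : Integrable fun x : I => r x) :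
    mass (leftOp a r) + mass (rightOp r) = mass r := by
  rw [← mass_transferOp a hr]
  exact (integral_add (integrable_leftOp a hr) (integrable_rightOp hr)).symm

lemma leftOp_nonneg (hr : ∀ x ∈ Set.Ioc (0 : ℝ) 1, 0 ≤ r x) :
    ∀ x ∈ Set.Ioc (0 : ℝ) 1, 0 ≤ leftOp a r x := fun _ hx =>
  div_nonneg (hr _ (leftInv_mem_Ioc a hx)) (leftDeriv_pos a (leftInv_pos a hx).le).le

lemma rightOp_nonneg (hr : ∀ x ∈ Set.Ioc (0 : ℝ) 1, 0 ≤ r x) :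
    ∀ x ∈ Set.Ioc (0 : ℝ) 1, 0 ≤ rightOp r x := fun _ hx =>
  div_nonneg (hr _ (half_add_mem_Ioc hx)) zero_le_two

lemma transferOp_nonneg (hr : ∀ x ∈ Set.Ioc (0 : ℝ) 1, 0 ≤ r x) :
    ∀ x ∈ Set.Ioc (0 : ℝ) 1, 0 ≤ transferOp a r x := fun x hx =>
  add_nonneg (leftOp_nonneg a hr x hx) (rightOp_nonneg hr x hx)

lemma antitoneOn_leftOp (hr0 : ∀ x ∈ Set.Ioc (0 : ℝ) 1, 0 ≤ r x)
    (hr : AntitoneOn r (Set.Ioc 0 1)) : AntitoneOn (leftOp a r) (Set.Ioc 0 1) := by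
  intro x hx y hy hxy
  have hinv := leftInv_le_leftInv a hx hy hxy
  exact div_le_div₀ (hr0 _ (leftInv_mem_Ioc a hx))
    (hr (leftInv_mem_Ioc a hx) (leftInv_mem_Ioc a hy) hinv)
    (leftDeriv_pos a (leftInv_pos a hx).le)
    (leftDeriv_le_leftDeriv a (leftInv_pos a hx).le hinv)

lemma antitoneOn_rightOp (hr : AntitoneOn r (Set.Ioc 0 1)) :
    AntitoneOn (rightOp r) (Set.Ioc 0 1) := fun x hx y hy hxy =>
  div_le_div_of_nonneg_right (hr (half_add_mem_Ioc hx) (half_add_mem_Ioc hy) (by linarith))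
    zero_le_two

end TransferOperator
section RegularDensity

/-- Regular densities: nonnegative integrable functions `r` on `(0,1]` such that `r` is decreasing
and `x ^ b * r x` is increasing. -/
structure RegularDensity (b : ℝ) (r : ℝ → ℝ) : Prop where
  nonneg : ∀ x ∈ Set.Ioc (0 : ℝ) 1, 0 ≤ r x
  antitoneOn : AntitoneOn r (Set.Ioc 0 1)
  monotoneOn : MonotoneOn (fun x => x ^ b * r x) (Set.Ioc 0 1)
  integrable : Integrable fun x : I => r x

lemma one_add_rpow_div_le {b c u v : ℝ} (hb : 1 ≤ b) (hc0 : 0 ≤ c) (hc : c ≤ b) (hu : 0 ≤ u)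
    (huv : u ≤ v) : (1 + u) ^ b / (1 + c * u) ≤ (1 + v) ^ b / (1 + c * v) := by
  have hv : 0 ≤ v := hu.trans huv
  rw [div_le_div_iff₀ (by positivity) (by positivity)]
  set t := (v - u) / (1 + u)
  have ht : 0 ≤ t := div_nonneg (by linarith) (by linarith)
  have hvt : v = u + (1 + u) * t := by
    rw [mul_div_cancel₀ _ (by linarith)]
    ring
  have hbernoulli : 1 + b * t ≤ (1 + t) ^ b := one_add_mul_self_le_rpow_one_add (by linarith) hb
  have hlin : 1 + c * v ≤ (1 + b * t) * (1 + c * u) := by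
    have hcb : 0 ≤ (b - c) * t := mul_nonneg (by linarith) ht
    have hb1 : 0 ≤ (b - 1) * (c * u * t) := mul_nonneg (by linarith) (by positivity)
    rw [hvt]
    nlinarith
  calc (1 + u) ^ b * (1 + c * v) ≤ (1 + u) ^ b * ((1 + t) ^ b * (1 + c * u)) := by
        gcongr
        exact hlin.trans (by gcongr)
    _ = (1 + v) ^ b * (1 + c * u) := by
        rw [← mul_assoc, ← Real.mul_rpow (by positivity) (by positivity), hvt]
        ring_nf

lemma rpow_mul_leftOp (a : ℝ≥0) (b : ℝ) (r : ℝ → ℝ) {x : ℝ} (hx : x ∈ Set.Ioc (0 : ℝ) 1) :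
    x ^ b * leftOp a r x = (leftInv a x ^ b * r (leftInv a x)) *
      ((1 + 2 ^ (a : ℝ) * leftInv a x ^ (a : ℝ)) ^ b /
        (1 + (1 + a) * (2 ^ (a : ℝ) * leftInv a x ^ (a : ℝ)))) := by
  have hy := leftInv_pos a hx
  have hxb : x ^ b = leftInv a x ^ b * (1 + 2 ^ (a : ℝ) * leftInv a x ^ (a : ℝ)) ^ b := by
    rw [← Real.mul_rpow hy.le (by positivity)]
    exact congrArg (· ^ b) (leftMap_leftInv a (Set.Ioc_subset_Icc_self hx)).symm
  rw [hxb, leftOp_apply, leftDeriv]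
  ring

lemma rpow_half_mul_rightOp (b : ℝ) (r : ℝ → ℝ) {x : ℝ} (hx : x ∈ Set.Ioc (0 : ℝ) 1) :
    x ^ (b / 2) * rightOp r x =
      (x / ((x + 1) / 2) ^ 2) ^ (b / 2) * (((x + 1) / 2) ^ b * r ((x + 1) / 2)) / 2 := by
  have hy : 0 < (x + 1) / 2 := (half_add_mem_Ioc hx).1
  have hb : ((2 : ℕ) : ℝ) * (b / 2) = b := by
    push_cast
    ring
  have hyb := (Real.rpow_pos_of_pos hy b).ne'
  rw [Real.div_rpow hx.1.le (by positivity), ← Real.rpow_natCast, ← Real.rpow_mul hy.le, hb,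
    rightOp_apply]
  field_simp

lemma div_sq_half_add_le {x y : ℝ} (hx : 0 ≤ x) (hy : y ≤ 1) (hxy : x ≤ y) :
    x / ((x + 1) / 2) ^ 2 ≤ y / ((y + 1) / 2) ^ 2 := by
  have hy0 : 0 ≤ y := hx.trans hxy
  rw [div_le_div_iff₀ (by positivity) (by positivity)]
  have hprod : 0 ≤ (y - x) * (1 - x * y) :=
    mul_nonneg (by linarith) (by linarith [mul_le_one₀ (hxy.trans hy) hy0 hy])
  nlinarith

lemma sq_mul_sub_le {X Y p q θ : ℝ} (hX : 0 < X) (hXY : X ≤ Y) (hpq : X * p ≤ Y * q)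
    (hθ0 : 0 ≤ θ) (hθ : 2 * θ ≤ q) : X ^ 2 * (p - θ) ≤ Y ^ 2 * (q - θ) := by
  have hscaled : X * (X * p) ≤ X * (Y * q) := mul_le_mul_of_nonneg_left hpq hX.le
  have hgain : 0 ≤ (Y - X) * (Y * q - θ * (X + Y)) := mul_nonneg (by linarith) (by nlinarith)
  nlinarith

lemma one_mem_Ioc : (1 : ℝ) ∈ Set.Ioc (0 : ℝ) 1 := ⟨one_pos, le_rfl⟩

namespace RegularDensity

variable {a : ℝ≥0} {b : ℝ} {r s : ℝ → ℝ}

protected lemma add (hr : RegularDensity b r) (hs : RegularDensity b s) :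
    RegularDensity b (r + s) where
  nonneg x hx := add_nonneg (hr.nonneg x hx) (hs.nonneg x hx)
  antitoneOn := hr.antitoneOn.add hs.antitoneOn
  monotoneOn := by simpa only [Pi.add_apply, mul_add] using hr.monotoneOn.add hs.monotoneOn
  integrable := hr.integrable.add hs.integrable

lemma const_smul (hr : RegularDensity b r) {c : ℝ} (hc : 0 ≤ c) : RegularDensity b (c • r) where
  nonneg x hx := mul_nonneg hc (hr.nonneg x hx)
  antitoneOn _ hx _ hy hxy := mul_le_mul_of_nonneg_left (hr.antitoneOn hx hy hxy) hc
  monotoneOn x hx y hy hxy := by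
    simpa only [Pi.smul_apply, smul_eq_mul, mul_left_comm c] using
      mul_le_mul_of_nonneg_left (hr.monotoneOn hx hy hxy) hc
  integrable := hr.integrable.const_mul c

protected lemma one (hb : 0 ≤ b) : RegularDensity b 1 where
  nonneg _ _ := zero_le_one
  antitoneOn _ _ _ _ _ := le_rfl
  monotoneOn x hx y _ hxy := by simpa using Real.rpow_le_rpow hx.1.le hxy hb
  integrable := integrable_const _

protected lemma leftOp (hr : RegularDensity b r) (ha : 1 + (a : ℝ) ≤ b) :
    RegularDensity b (leftOp a r) where
  nonneg := leftOp_nonneg a hr.nonneg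
  antitoneOn := antitoneOn_leftOp a hr.nonneg hr.antitoneOn
  integrable := integrable_leftOp a hr.integrable
  monotoneOn x hx y hy hxy := by
    have hinv := leftInv_le_leftInv a hx hy hxy
    have hx' := leftInv_mem_Ioc a hx
    have hy' := leftInv_mem_Ioc a hy
    have hx0 := hx'.1
    simp only [rpow_mul_leftOp a b r hx, rpow_mul_leftOp a b r hy]
    refine mul_le_mul (hr.monotoneOn hx' hy' hinv) ?_ (by positivity)
      (mul_nonneg (Real.rpow_nonneg hy'.1.le _) (hr.nonneg _ hy'))
    exact one_add_rpow_div_le (by linarith [a.2]) (by positivity) ha (by positivity)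
      (two_rpow_mul_rpow_le a hx0.le hinv)

-- The right branch halves the exponent, which leaves room for the subtraction of a constant.
lemma monotoneOn_rpow_half_mul_rightOp (hb : 0 ≤ b) (hr : RegularDensity b r) :
    MonotoneOn (fun x => x ^ (b / 2) * rightOp r x) (Set.Ioc 0 1) := by
  intro x hx y hy hxy
  have hx' := half_add_mem_Ioc hx
  have hy' := half_add_mem_Ioc hy
  have hx0 : 0 ≤ x / ((x + 1) / 2) ^ 2 := div_nonneg hx.1.le (by positivity)
  have hpow := Real.rpow_le_rpow hx0 (div_sq_half_add_le hx.1.le hy.2 hxy)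
    (div_nonneg hb zero_le_two)
  have hmono := hr.monotoneOn hx' hy' (by linarith)
  simp only [rpow_half_mul_rightOp b r hx, rpow_half_mul_rightOp b r hy]
  refine div_le_div_of_nonneg_right (mul_le_mul hpow hmono ?_ ?_) zero_le_two
  · exact mul_nonneg (Real.rpow_nonneg hx'.1.le _) (hr.nonneg _ hx')
  · exact Real.rpow_nonneg (div_nonneg hy.1.le (by positivity)) _

lemma rightOp_sub_const (hb : 0 ≤ b) (hr : RegularDensity b r) {θ : ℝ} (hθ0 : 0 ≤ θ)
    (hθ : θ ≤ rightOp r 1 / 2) : RegularDensity b (fun x => rightOp r x - θ) where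
  nonneg x hx := by linarith [antitoneOn_rightOp hr.antitoneOn hx one_mem_Ioc hx.2]
  antitoneOn _ hx _ hy hxy := sub_le_sub_right (antitoneOn_rightOp hr.antitoneOn hx hy hxy) θ
  integrable := (integrable_rightOp hr.integrable).sub (integrable_const _)
  monotoneOn x hx y hy hxy := by
    have hsq : ∀ z ∈ Set.Ioc (0 : ℝ) 1, z ^ b = (z ^ (b / 2)) ^ 2 := fun z hz => by
      rw [← Real.rpow_mul_natCast hz.1.le, Nat.cast_ofNat, div_mul_cancel₀ _ two_ne_zero]
    simp only [hsq x hx, hsq y hy]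
    exact sq_mul_sub_le (Real.rpow_pos_of_pos hx.1 _)
      (Real.rpow_le_rpow hx.1.le hxy (div_nonneg hb zero_le_two))
      (hr.monotoneOn_rpow_half_mul_rightOp hb hx hy hxy) hθ0
      (by linarith [antitoneOn_rightOp hr.antitoneOn hy one_mem_Ioc hy.2])

protected lemma rightOp (hb : 0 ≤ b) (hr : RegularDensity b r) : RegularDensity b (rightOp r) := by
  simpa only [sub_zero] using hr.rightOp_sub_const hb le_rfl
    (div_nonneg (rightOp_nonneg hr.nonneg 1 one_mem_Ioc) zero_le_two)

protected lemma transferOp (hr : RegularDensity b r) (ha : 1 + (a : ℝ) ≤ b) :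
    RegularDensity b (transferOp a r) :=
  (hr.leftOp ha).add (hr.rightOp (by linarith [a.2]))

lemma transferOp_sub_const (hr : RegularDensity b r) (ha : 1 + (a : ℝ) ≤ b) {θ : ℝ}
    (hθ0 : 0 ≤ θ) (hθ : θ ≤ r 1 / 4) : RegularDensity b (fun x => transferOp a r x - θ) := by
  have hθ' : θ ≤ rightOp r 1 / 2 := by
    rw [rightOp_apply, add_self_div_two]
    linarith
  have hsplit : (fun x => transferOp a r x - θ) = leftOp a r + fun x => rightOp r x - θ :=
    funext fun x => add_sub_assoc _ _ _
  rw [hsplit]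
  exact (hr.leftOp ha).add (hr.rightOp_sub_const (by linarith [a.2]) hθ0 hθ')

lemma rpow_mul_le_apply_one (hr : RegularDensity b r) {x : ℝ} (hx : x ∈ Set.Ioc (0 : ℝ) 1) :
    x ^ b * r x ≤ r 1 := by
  simpa only [Real.one_rpow, one_mul] using hr.monotoneOn hx one_mem_Ioc hx.2

lemma mass_rightOp_le (hb : 0 ≤ b) (hr : RegularDensity b r) :
    mass (rightOp r) ≤ 2 ^ b * rightOp r 1 := by
  rw [← mass_const (2 ^ b * rightOp r 1)]
  refine mass_le_mass (integrable_rightOp hr.integrable) (integrable_const _) fun x hx => ?_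
  have hx' := half_add_mem_Ioc hx
  have hpow : (1 / 2 : ℝ) ^ b ≤ ((x + 1) / 2) ^ b :=
    Real.rpow_le_rpow (by norm_num) (by linarith [hx.1]) hb
  have hhalf : (1 / 2 : ℝ) ^ b * r ((x + 1) / 2) ≤ r 1 :=
    (mul_le_mul_of_nonneg_right hpow (hr.nonneg _ hx')).trans (hr.rpow_mul_le_apply_one hx')
  rw [Real.div_rpow zero_le_one zero_le_two, Real.one_rpow, one_div,
    inv_mul_le_iff₀ (by positivity)] at hhalf
  rw [rightOp_apply, rightOp_apply, add_self_div_two, ← mul_div_assoc]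
  exact div_le_div_of_nonneg_right hhalf zero_le_two

end RegularDensity

end RegularDensity

section Composition

/-- The transfer operator of a composition of maps; the head of the list acts first. -/
noncomputable def transferList : List ℝ≥0 → (ℝ → ℝ) →ₗ[ℝ] ℝ → ℝ
  | [] => LinearMap.id
  | a :: l => transferList l ∘ₗ transferOp a

/-- The part of `transferList` that only uses left branches: it transports the mass that has not
left a neighbourhood of the neutral fixed point `0`. -/
noncomputable def leftList : List ℝ≥0 → (ℝ → ℝ) →ₗ[ℝ] ℝ → ℝ
  | [] => LinearMap.id
  | a :: l => leftList l ∘ₗ leftOp a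

/-- Composition of maps along a list; the head of the list acts first. -/
noncomputable def compList : List ℝ≥0 → I → I
  | [], x => x
  | a :: l, x => compList l (pmMap a x)

variable (l l' : List ℝ≥0) {r s : ℝ → ℝ}

lemma transferList_cons (a : ℝ≥0) (r : ℝ → ℝ) :
    transferList (a :: l) r = transferList l (transferOp a r) := rfl

lemma leftList_cons (a : ℝ≥0) (r : ℝ → ℝ) : leftList (a :: l) r = leftList l (leftOp a r) := rfl

lemma transferList_append (r : ℝ → ℝ) :
    transferList (l ++ l') r = transferList l' (transferList l r) := by
  induction l generalizing r with
  | nil => rfl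
  | cons _ _ ih => exact ih _

lemma compList_append (x : I) : compList (l ++ l') x = compList l' (compList l x) := by
  induction l generalizing x with
  | nil => rfl
  | cons _ _ ih => exact ih _

lemma transferList_nonneg (hr : ∀ x ∈ Set.Ioc (0 : ℝ) 1, 0 ≤ r x) :
    ∀ x ∈ Set.Ioc (0 : ℝ) 1, 0 ≤ transferList l r x := by
  induction l generalizing r with
  | nil => exact hr
  | cons _ _ ih => exact ih (transferOp_nonneg _ hr)

lemma transferList_le_transferList (hrs : ∀ x ∈ Set.Ioc (0 : ℝ) 1, r x ≤ s x) :
    ∀ x ∈ Set.Ioc (0 : ℝ) 1, transferList l r x ≤ transferList l s x := fun x hx => by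
  have hsub := transferList_nonneg l (r := s - r) (fun x hx => sub_nonneg.2 (hrs x hx)) x hx
  rwa [map_sub, Pi.sub_apply, sub_nonneg] at hsub

lemma abs_transferList_le (r : ℝ → ℝ) {x : ℝ} (hx : x ∈ Set.Ioc (0 : ℝ) 1) :
    |transferList l r x| ≤ transferList l |r| x := by
  refine abs_le'.2 ⟨transferList_le_transferList l (fun x _ => le_abs_self (r x)) x hx, ?_⟩
  rw [← Pi.neg_apply, ← map_neg]
  exact transferList_le_transferList l (fun x _ => neg_le_abs (r x)) x hx

lemma integrable_transferList (hr : Integrable fun x : I => r x) :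
    Integrable fun x : I => transferList l r x := by
  induction l generalizing r with
  | nil => exact hr
  | cons _ _ ih => exact ih (integrable_transferOp _ hr)

lemma mass_transferList (hr : Integrable fun x : I => r x) :
    mass (transferList l r) = mass r := by
  induction l generalizing r with
  | nil => rfl
  | cons a _ ih => exact (ih (integrable_transferOp a hr)).trans (mass_transferOp _ hr)

lemma mass_abs_transferList_le (hr : Integrable fun x : I => r x) :
    mass |transferList l r| ≤ mass |r| := by
  have habs : Integrable fun x : I => |r| x := hr.abs
  rw [← mass_transferList l habs]
  exact mass_le_mass (integrable_transferList l hr).abs (integrable_transferList l habs)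
    fun x hx => abs_transferList_le l r hx

lemma measurable_pmMap (a : ℝ≥0) : Measurable (pmMap a) := by
  refine Measurable.subtype_mk ?_
  refine Measurable.ite measurableSet_lt_half ?_ ?_ <;> fun_prop

lemma measurable_compList : Measurable (compList l) := by
  induction l with
  | nil => exact measurable_id
  | cons _ _ ih => exact ih.comp (measurable_pmMap _)

variable {l} {b : ℝ}

protected lemma RegularDensity.transferList (hr : RegularDensity b r)
    (hl : ∀ a ∈ l, 1 + (a : ℝ) ≤ b) : RegularDensity b (transferList l r) := by
  induction l generalizing r with
  | nil => exact hr
  | cons a l ih =>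
    exact ih (hr.transferOp (hl _ List.mem_cons_self)) fun c hc => hl c (List.mem_cons_of_mem _ hc)

protected lemma RegularDensity.leftList (hr : RegularDensity b r)
    (hl : ∀ a ∈ l, 1 + (a : ℝ) ≤ b) : RegularDensity b (leftList l r) := by
  induction l generalizing r with
  | nil => exact hr
  | cons a l ih =>
    exact ih (hr.leftOp (hl _ List.mem_cons_self)) fun c hc => hl c (List.mem_cons_of_mem _ hc)

end Composition
section Escape

/-- Decreasing densities of mass at most one dominated by `3 x ^ (-β)`. This class is invariant
under the transfer operators with parameters in `[0, β]`. -/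
structure DominatedDensity (β : ℝ) (r : ℝ → ℝ) : Prop where
  nonneg : ∀ x ∈ Set.Ioc (0 : ℝ) 1, 0 ≤ r x
  antitoneOn : AntitoneOn r (Set.Ioc 0 1)
  integrable : Integrable fun x : I => r x
  mass_le : mass r ≤ 1
  le : ∀ x ∈ Set.Ioc (0 : ℝ) 1, r x ≤ 3 * x ^ (-β)

variable {β : ℝ} {a : ℝ≥0} {r : ℝ → ℝ} {l : List ℝ≥0} {x : ℝ}

-- The left branch of the doubling map compares the average of `r` over `[0, 1/2]` with its values
-- on `[1/2, 1]`.
lemma rightOp_le_mass (h0 : ∀ x ∈ Set.Ioc (0 : ℝ) 1, 0 ≤ r x) (hr : AntitoneOn r (Set.Ioc 0 1))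
    (hi : Integrable fun x : I => r x) (hx : x ∈ Set.Ioc (0 : ℝ) 1) : rightOp r x ≤ mass r := by
  have hle : ∀ y ∈ Set.Ioc (0 : ℝ) 1, rightOp r x ≤ leftOp 0 r y := fun y hy => by
    have hderiv : leftDeriv 0 (leftInv 0 y) = 2 := by norm_num [leftDeriv]
    have hinv : leftInv 0 y ≤ (x + 1) / 2 := by
      linarith [(leftInv_mem_Icc 0 (Set.Ioc_subset_Icc_self hy)).2, hx.1]
    rw [leftOp_apply, rightOp_apply, hderiv]
    exact div_le_div_of_nonneg_right
      (hr (leftInv_mem_Ioc 0 hy) (half_add_mem_Ioc hx) hinv) zero_le_two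
  calc rightOp r x = mass fun _ => rightOp r x := (mass_const _).symm
    _ ≤ mass (leftOp 0 r) := mass_le_mass (integrable_const _) (integrable_leftOp 0 hi) hle
    _ ≤ mass r := by
      rw [← mass_leftOp_add_rightOp 0 hi]
      exact le_add_of_nonneg_right (mass_nonneg (rightOp_nonneg h0))

lemma rpow_le_two_rpow_mul_leftInv_rpow (hβ : 0 ≤ β) (ha : (a : ℝ) ≤ β)
    (hx : x ∈ Set.Ioc (0 : ℝ) 1) : x ^ β ≤ 2 ^ (a : ℝ) * leftInv a x ^ (a : ℝ) := by
  have hy := leftInv_mem_Icc a (Set.Ioc_subset_Icc_self hx)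
  have hy0 := leftInv_pos a hx
  have hx2 : x ≤ 2 * leftInv a x := by
    nth_rw 1 [← leftMap_leftInv a (Set.Ioc_subset_Icc_self hx), leftMap]
    nlinarith [two_rpow_mul_rpow_le_one a hy.1 hy.2]
  rw [← Real.mul_rpow two_pos.le hy.1]
  exact (Real.rpow_le_rpow hx.1.le hx2 hβ).trans
    (Real.rpow_le_rpow_of_exponent_ge (by positivity) (by linarith [hy.2]) ha)

lemma leftInv_rpow_neg_le (hβ : 0 ≤ β) (hβ1 : β ≤ 1) (hx : x ∈ Set.Ioc (0 : ℝ) 1) :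
    leftInv a x ^ (-β) ≤ x ^ (-β) * (1 + β * (2 ^ (a : ℝ) * leftInv a x ^ (a : ℝ))) := by
  have hy := leftInv_pos a hx
  have hu : 0 ≤ 2 ^ (a : ℝ) * leftInv a x ^ (a : ℝ) := by positivity
  have hxy : x ^ (-β) =
      leftInv a x ^ (-β) * (1 + 2 ^ (a : ℝ) * leftInv a x ^ (a : ℝ)) ^ (-β) := by
    rw [← Real.mul_rpow hy.le (by positivity)]
    exact congrArg (· ^ (-β)) (leftMap_leftInv a (Set.Ioc_subset_Icc_self hx)).symm
  rw [hxy, mul_assoc]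
  refine le_mul_of_one_le_right (by positivity) ?_
  rw [Real.rpow_neg (by positivity), ← div_eq_inv_mul, one_le_div (by positivity)]
  exact rpow_one_add_le_one_add_mul_self (by linarith) hβ hβ1

lemma three_mul_div_add_one_le {a β u X : ℝ} (ha : 0 ≤ a) (hβ : β ≤ 1 / 3) (hu0 : 0 ≤ u)
    (hu1 : u ≤ 1) (hXu : 1 ≤ X * u) :
    3 * (X * (1 + β * u)) / (1 + (1 + a) * u) + 1 ≤ 3 * X := by
  have hden : 0 < 1 + (1 + a) * u := by positivity
  rw [div_add_one hden.ne', div_le_iff₀ hden]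
  have hgain : 3 * (1 + a - β) ≤ 3 * (1 + a - β) * (X * u) :=
    le_mul_of_one_le_right (by linarith) hXu
  nlinarith

namespace DominatedDensity

protected lemma transferOp (hβ0 : 0 ≤ β) (hβ : β ≤ 1 / 3) (hr : DominatedDensity β r)
    (ha : (a : ℝ) ≤ β) : DominatedDensity β (transferOp a r) where
  nonneg := transferOp_nonneg a hr.nonneg
  antitoneOn := (antitoneOn_leftOp a hr.nonneg hr.antitoneOn).add (antitoneOn_rightOp hr.antitoneOn)
  integrable := integrable_transferOp a hr.integrable
  mass_le := (mass_transferOp a hr.integrable).trans_le hr.mass_le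
  le x hx := by
    have hright : rightOp r x ≤ 1 :=
      (rightOp_le_mass hr.nonneg hr.antitoneOn hr.integrable hx).trans hr.mass_le
    have hy := leftInv_mem_Icc a (Set.Ioc_subset_Icc_self hx)
    have hle := (hr.le _ (leftInv_mem_Ioc a hx)).trans
      (mul_le_mul_of_nonneg_left (leftInv_rpow_neg_le hβ0 (by linarith) hx) zero_le_three)
    have hu0 : 0 ≤ 2 ^ (a : ℝ) * leftInv a x ^ (a : ℝ) :=
      mul_nonneg (by positivity) (Real.rpow_nonneg hy.1 _)
    have hXu : 1 ≤ x ^ (-β) * (2 ^ (a : ℝ) * leftInv a x ^ (a : ℝ)) := by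
      rw [Real.rpow_neg hx.1.le, ← div_eq_inv_mul, one_le_div (Real.rpow_pos_of_pos hx.1 _)]
      exact rpow_le_two_rpow_mul_leftInv_rpow hβ0 ha hx
    rw [transferOp_apply]
    exact (add_le_add (div_le_div_of_nonneg_right hle (leftDeriv_pos a hy.1).le) hright).trans
      (three_mul_div_add_one_le a.2 hβ hu0 (two_rpow_mul_rpow_le_one a hy.1 hy.2) hXu)

protected lemma transferList (hβ0 : 0 ≤ β) (hβ : β ≤ 1 / 3) (hr : DominatedDensity β r)
    (hl : ∀ a ∈ l, (a : ℝ) ≤ β) : DominatedDensity β (transferList l r) := by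
  induction l generalizing r with
  | nil => exact hr
  | cons a l ih =>
    obtain ⟨ha, hl⟩ := List.forall_mem_cons.1 hl
    exact ih (hr.transferOp hβ0 hβ ha) hl

protected lemma one (hβ0 : 0 ≤ β) : DominatedDensity β 1 where
  nonneg _ _ := zero_le_one
  antitoneOn _ _ _ _ _ := le_rfl
  integrable := integrable_const _
  mass_le := (mass_const 1).le
  le x hx := by
    have hone := Real.one_le_rpow_of_pos_of_le_one_of_nonpos hx.1 hx.2 (neg_nonpos.2 hβ0)
    rw [Pi.one_apply]
    linarith

end DominatedDensity

lemma integrable_rpow_neg {s : ℝ} (hs : s < 1) : Integrable fun x : I => (x : ℝ) ^ (-s) := by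
  have hpow : IntegrableOn (fun x : ℝ => x ^ (-s)) (Set.Ioc 0 1) :=
    (intervalIntegrable_iff_integrableOn_Ioc_of_le zero_le_one).1
      (intervalIntegral.intervalIntegrable_rpow' (by linarith))
  rw [integrable_unitInterval]
  refine hpow.congr_fun (fun x hx => ?_) measurableSet_Ioc
  exact (realExt_of_mem (fun x : I => (x : ℝ) ^ (-s)) (Set.Ioc_subset_Icc_self hx)).symm

lemma mass_rpow_neg {s : ℝ} (hs : s < 1) : mass (fun x => x ^ (-s)) = (1 - s)⁻¹ := by
  have hcongr : ∫ x in Set.Ioc (0 : ℝ) 1, realExt (fun x : I => (x : ℝ) ^ (-s)) x =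
      ∫ x in Set.Ioc (0 : ℝ) 1, x ^ (-s) :=
    setIntegral_congr_fun measurableSet_Ioc
      fun x hx => realExt_of_mem _ (Set.Ioc_subset_Icc_self hx)
  rw [mass, integral_unitInterval, hcongr, ← intervalIntegral.integral_of_le zero_le_one,
    integral_rpow (Or.inl (by linarith)), Real.one_rpow, Real.zero_rpow (by linarith),
    neg_add_eq_sub, sub_zero, one_div]

-- Interpolation between the bounds `r x ≤ 3 x ^ (-β)` and `r x ≤ r 1 * x ^ (-(1 + β))`.
lemma RegularDensity.le_rpow_neg_two_thirds (hβ : β ≤ 1 / 3) (hr : RegularDensity (1 + β) r)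
    (hd : DominatedDensity β r) (hx : x ∈ Set.Ioc (0 : ℝ) 1) :
    r x ≤ 3 * r 1 ^ (1 / 3 : ℝ) * x ^ (-(2 / 3) : ℝ) := by
  have hx0 := hr.nonneg x hx
  have hr1 := hr.nonneg 1 one_mem_Ioc
  have hsplit : r x = r x ^ (2 / 3 : ℝ) * r x ^ (1 / 3 : ℝ) := by
    rw [← Real.rpow_add' hx0 (by norm_num)]
    norm_num
  have hdom : r x ^ (2 / 3 : ℝ) ≤ 3 * x ^ (-β * (2 / 3)) := by
    refine (Real.rpow_le_rpow hx0 (hd.le x hx) (by norm_num)).trans ?_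
    rw [Real.mul_rpow zero_le_three (Real.rpow_nonneg hx.1.le _), ← Real.rpow_mul hx.1.le]
    exact mul_le_mul_of_nonneg_right (Real.rpow_le_self_of_one_le (by norm_num) (by norm_num))
      (Real.rpow_nonneg hx.1.le _)
  have hreg : r x ^ (1 / 3 : ℝ) ≤ r 1 ^ (1 / 3 : ℝ) * x ^ (-(1 + β) * (1 / 3)) := by
    have hle : r x ≤ r 1 * x ^ (-(1 + β)) := by
      rw [Real.rpow_neg hx.1.le, ← div_eq_mul_inv, le_div_iff₀' (Real.rpow_pos_of_pos hx.1 _)]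
      exact hr.rpow_mul_le_apply_one hx
    rw [Real.rpow_mul hx.1.le, ← Real.mul_rpow hr1 (Real.rpow_nonneg hx.1.le _)]
    exact Real.rpow_le_rpow hx0 hle (by norm_num)
  have hexp : x ^ (-β * (2 / 3)) * x ^ (-(1 + β) * (1 / 3)) ≤ x ^ (-(2 / 3) : ℝ) := by
    rw [← Real.rpow_add hx.1]
    exact Real.rpow_le_rpow_of_exponent_ge hx.1 hx.2 (by linarith)
  calc r x = r x ^ (2 / 3 : ℝ) * r x ^ (1 / 3 : ℝ) := hsplit
    _ ≤ 3 * x ^ (-β * (2 / 3)) * (r 1 ^ (1 / 3 : ℝ) * x ^ (-(1 + β) * (1 / 3))) :=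
      mul_le_mul hdom hreg (Real.rpow_nonneg hx0 _)
        (mul_nonneg zero_le_three (Real.rpow_nonneg hx.1.le _))
    _ = 3 * r 1 ^ (1 / 3 : ℝ) * (x ^ (-β * (2 / 3)) * x ^ (-(1 + β) * (1 / 3))) := by ring
    _ ≤ 3 * r 1 ^ (1 / 3 : ℝ) * x ^ (-(2 / 3) : ℝ) :=
      mul_le_mul_of_nonneg_left hexp (mul_nonneg zero_le_three (Real.rpow_nonneg hr1 _))

lemma RegularDensity.le_apply_one_of_mass_eq_one (hβ : β ≤ 1 / 3)
    (hr : RegularDensity (1 + β) r) (hd : DominatedDensity β r) (hm : mass r = 1) :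
    1 / 729 ≤ r 1 := by
  have hr1 := hr.nonneg 1 one_mem_Ioc
  have hmass : mass (fun x => 3 * r 1 ^ (1 / 3 : ℝ) * x ^ (-(2 / 3) : ℝ)) =
      9 * r 1 ^ (1 / 3 : ℝ) := by
    have hrpow := mass_rpow_neg (s := 2 / 3) (by norm_num)
    rw [mass] at hrpow ⊢
    rw [integral_const_mul, hrpow]
    ring
  have hone : 1 ≤ 9 * r 1 ^ (1 / 3 : ℝ) := by
    refine hm.symm.le.trans ((mass_le_mass hr.integrable ?_ fun x hx => ?_).trans hmass.le)
    · exact (integrable_rpow_neg (by norm_num)).const_mul _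
    · exact hr.le_rpow_neg_two_thirds hβ hd hx
  have hcube : (1 / 9 : ℝ) ^ 3 ≤ (r 1 ^ (1 / 3 : ℝ)) ^ 3 :=
    pow_le_pow_left₀ (by norm_num) (by linarith) 3
  rw [← Real.rpow_mul_natCast hr1] at hcube
  norm_num at hcube
  linarith

lemma le_transferList_one (hβ0 : 0 ≤ β) (hβ : β ≤ 1 / 3) (hl : ∀ a ∈ l, (a : ℝ) ≤ β)
    (hx : x ∈ Set.Ioc (0 : ℝ) 1) : 1 / 729 ≤ transferList l 1 x := by
  have hreg : RegularDensity (1 + β) (transferList l 1) :=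
    (RegularDensity.one (by linarith)).transferList fun a ha => by linarith [hl a ha]
  have hmass : mass (transferList l 1) = 1 :=
    (mass_transferList l (integrable_const _)).trans (mass_const 1)
  exact (hreg.le_apply_one_of_mass_eq_one hβ
    ((DominatedDensity.one hβ0).transferList hβ0 hβ hl) hmass).trans
    (hreg.antitoneOn hx one_mem_Ioc hx.2)

-- Mass that has visited `[1/2, 1]` spreads out at least as evenly as a constant density.
lemma RegularDensity.mass_sub_mass_leftList_le (hβ0 : 0 ≤ β) (hβ : β ≤ 1 / 3)
    (hl : ∀ a ∈ l, (a : ℝ) ≤ β) (hr : RegularDensity (1 + β) r) (hx : x ∈ Set.Ioc (0 : ℝ) 1) :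
    1 / 2916 * (mass r - mass (leftList l r)) ≤ transferList l r x := by
  induction l generalizing r with
  | nil => simpa [leftList, transferList] using hr.nonneg x hx
  | cons a l ih =>
    obtain ⟨ha, hl⟩ := List.forall_mem_cons.1 hl
    have hleft := ih hl (hr.leftOp (a := a) (by linarith))
    have hr1 := rightOp_nonneg hr.nonneg 1 one_mem_Ioc
    have hright : rightOp r 1 * (1 / 729) ≤ transferList l (rightOp r) x :=
      calc rightOp r 1 * (1 / 729) ≤ rightOp r 1 * transferList l 1 x :=
            mul_le_mul_of_nonneg_left (le_transferList_one hβ0 hβ hl hx) hr1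
        _ = transferList l (rightOp r 1 • 1) x := by rw [map_smul]; rfl
        _ ≤ transferList l (rightOp r) x := by
          refine transferList_le_transferList l (fun y hy => ?_) x hx
          simpa using antitoneOn_rightOp hr.antitoneOn hy one_mem_Ioc hy.2
    have hpow : (2 : ℝ) ^ (1 + β) ≤ 4 :=
      calc (2 : ℝ) ^ (1 + β) ≤ 2 ^ (2 : ℝ) :=
            Real.rpow_le_rpow_of_exponent_le one_le_two (by linarith)
        _ = 4 := by norm_num
    have hmass_right : mass (rightOp r) ≤ 4 * rightOp r 1 :=
      (hr.mass_rightOp_le (by linarith)).trans (mul_le_mul_of_nonneg_right hpow hr1)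
    have hmass := mass_leftOp_add_rightOp a hr.integrable
    rw [transferList_cons, leftList_cons, transferOp, LinearMap.add_apply, map_add, Pi.add_apply]
    linarith

/-- The points whose first iterates along the list all use the left branch. -/
def Trapped : List ℝ≥0 → I → Prop
  | [], _ => True
  | a :: l, x => (x : ℝ) < 1 / 2 ∧ Trapped l (pmMap a x)

open Classical in
lemma mass_leftList (l : List ℝ≥0) (r : ℝ → ℝ) :
    mass (leftList l r) = ∫ x : I, if Trapped l x then r x else 0 := by
  induction l generalizing r with
  | nil => simp [leftList, Trapped, mass]
  | cons a l ih =>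
    have hstep := integral_leftOp_mul a r fun x => if Trapped l x then 1 else 0
    simp only [mul_ite, mul_one, mul_zero] at hstep
    rw [leftList_cons, ih, hstep]
    refine integral_congr_ae (ae_of_all _ fun x => ?_)
    by_cases hT : Trapped l (pmMap a x) <;> simp [Trapped, hT]

lemma one_add_rpow_neg_le {w : ℝ} (hβ0 : 0 ≤ β) (hβ : β ≤ 1) (hw0 : 0 ≤ w) (hw1 : w ≤ 1) :
    (1 + w) ^ (-β) ≤ 1 - β * w / 2 := by
  have heq : (1 + w) ^ (-β) = (1 + -(w / (1 + w))) ^ β := by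
    rw [Real.rpow_neg (by linarith), ← Real.inv_rpow (by linarith)]
    congr 1
    field_simp
    ring
  have hle1 : w / (1 + w) ≤ 1 := (div_le_one (by linarith)).2 (by linarith)
  have hle2 : w / 2 ≤ w / (1 + w) := div_le_div_of_nonneg_left hw0 (by linarith) (by linarith)
  rw [heq]
  refine (rpow_one_add_le_one_add_mul_self (by linarith) hβ0 hβ).trans ?_
  nlinarith

lemma rpow_neg_add_le {δ : ℝ} (hβ0 : 0 ≤ β) (hβ : β ≤ 1) (hx0 : 0 < x) (hx : x ≤ 1 / 2)
    (hδ : x * (1 + (2 * x) ^ β) ≤ δ) : δ ^ (-β) + β / 2 ≤ x ^ (-β) := by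
  have hw0 : 0 ≤ (2 * x) ^ β := Real.rpow_nonneg (by linarith) _
  have hw1 : (2 * x) ^ β ≤ 1 := Real.rpow_le_one (by linarith) (by linarith) hβ0
  have hX : 0 < x ^ (-β) := Real.rpow_pos_of_pos hx0 _
  have hδX : δ ^ (-β) ≤ x ^ (-β) * (1 + (2 * x) ^ β) ^ (-β) := by
    rw [← Real.mul_rpow hx0.le (by linarith)]
    exact Real.rpow_le_rpow_of_nonpos (by positivity) hδ (by linarith)
  have hone : 1 ≤ x ^ (-β) * (2 * x) ^ β := by
    rw [Real.mul_rpow zero_le_two hx0.le, mul_left_comm, ← Real.rpow_add hx0, neg_add_cancel,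
      Real.rpow_zero, mul_one]
    exact Real.one_le_rpow one_le_two hβ0
  have hbernoulli := mul_le_mul_of_nonneg_left (one_add_rpow_neg_le hβ0 hβ hw0 hw1) hX.le
  nlinarith

lemma le_leftMap (ha : (a : ℝ) ≤ β) (hx0 : 0 < x) (hx : x ≤ 1 / 2) :
    x * (1 + (2 * x) ^ β) ≤ leftMap a x := by
  have hpow : (2 * x) ^ β ≤ (2 * x) ^ (a : ℝ) :=
    Real.rpow_le_rpow_of_exponent_ge (by linarith) (by linarith) ha
  rw [leftMap, ← Real.mul_rpow two_pos.le hx0.le]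
  gcongr

lemma Trapped.one_add_le_rpow_neg (hβ0 : 0 ≤ β) (hβ : β ≤ 1) (hl : ∀ a ∈ l, (a : ℝ) ≤ β) {x : I}
    (hx : (0 : ℝ) < x) (h : Trapped l x) : 1 + β / 2 * l.length ≤ (x : ℝ) ^ (-β) := by
  induction l generalizing x with
  | nil =>
    simpa using Real.one_le_rpow_of_pos_of_le_one_of_nonpos hx x.2.2 (neg_nonpos.2 hβ0)
  | cons a l ih =>
    obtain ⟨ha, hl⟩ := List.forall_mem_cons.1 hl
    have hmap := le_leftMap ha hx h.1.le
    have hgain := rpow_neg_add_le hβ0 hβ hx h.1.le hmap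
    rw [← coe_pmMap_of_lt_half a h.1] at hmap hgain
    have hpos : (0 : ℝ) < pmMap a x := lt_of_lt_of_le (by positivity) hmap
    have hrest := ih hl hpos h.2
    rw [List.length_cons]
    push_cast
    linarith

lemma Trapped.le_rpow_neg {γ : ℝ} (hβ0 : 0 < β) (hβ : β ≤ 1) (hγ0 : 0 ≤ γ)
    (hl : ∀ a ∈ l, (a : ℝ) ≤ β) {x : I} (hx : (0 : ℝ) < x) (h : Trapped l x) :
    (x : ℝ) ^ (-β) ≤
      (β / 2 * (l.length + 1)) ^ (-γ) * (x : ℝ) ^ (-(β * (γ + 1))) := by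
  have hX : 0 < (x : ℝ) ^ (-β) := Real.rpow_pos_of_pos hx _
  have hlength : β / 2 * (l.length + 1) ≤ (x : ℝ) ^ (-β) := by
    linarith [h.one_add_le_rpow_neg hβ0.le hβ hl hx]
  have hsplit : (x : ℝ) ^ (-(β * (γ + 1))) = (x : ℝ) ^ (-β) * ((x : ℝ) ^ (-β)) ^ γ := by
    rw [← Real.rpow_mul hx.le, ← Real.rpow_add hx]
    congr 1
    ring
  rw [hsplit, mul_left_comm, Real.rpow_neg (x := β / 2 * (l.length + 1)) (by positivity),
    ← div_eq_inv_mul]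
  exact le_mul_of_one_le_right hX.le
    ((one_le_div (by positivity)).2 (Real.rpow_le_rpow (by positivity) hlength hγ0))

lemma mass_leftList_le {γ : ℝ} (hβ0 : 0 < β) (hβ : β ≤ 1) (hγ0 : 0 ≤ γ) (hγ : β * (γ + 1) < 1)
    (hl : ∀ a ∈ l, (a : ℝ) ≤ β) (h0 : ∀ x ∈ Set.Ioc (0 : ℝ) 1, 0 ≤ r x)
    (hr : ∀ x ∈ Set.Ioc (0 : ℝ) 1, r x ≤ 3 * x ^ (-β)) :
    mass (leftList l r) ≤
      3 * (1 - β * (γ + 1))⁻¹ * (β / 2) ^ (-γ) * ((l.length : ℝ) + 1) ^ (-γ) := by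
  classical
  set D : ℝ := (β / 2 * (l.length + 1)) ^ (-γ) with hD
  calc mass (leftList l r) = ∫ x : I, if Trapped l x then r x else 0 := mass_leftList l r
    _ ≤ ∫ x : I, 3 * D * (x : ℝ) ^ (-(β * (γ + 1))) := by
      refine integral_mono_of_nonneg ?_ ((integrable_rpow_neg hγ).const_mul _) ?_
      · filter_upwards [ae_mem_Ioc] with x hx
        exact ite_nonneg (h0 x hx) le_rfl
      · filter_upwards [ae_mem_Ioc] with x hx
        split_ifs with ht
        · rw [mul_assoc]
          exact (hr x hx).trans
            (mul_le_mul_of_nonneg_left (ht.le_rpow_neg hβ0 hβ hγ0 hl hx.1) zero_le_three)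
        · exact mul_nonneg (by positivity) (Real.rpow_nonneg hx.1.le _)
    _ = 3 * D * (1 - β * (γ + 1))⁻¹ := by
      rw [integral_const_mul]
      exact congrArg _ (mass_rpow_neg hγ)
    _ = _ := by
      rw [hD, Real.mul_rpow (by positivity) (by positivity)]
      ring

end Escape
section BlockLengths

variable {c s : ℝ}

lemma sum_ceil_mul_pow_le (hc : 0 ≤ c) (hs : 1 < s) (J : ℕ) :
    ((∑ j ∈ Finset.range J, ⌈c * s ^ j⌉₊ : ℕ) : ℝ) ≤ (c + 1) / (s - 1) * (s ^ J - 1) := by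
  have hterm : ∀ j ∈ Finset.range J, (⌈c * s ^ j⌉₊ : ℝ) ≤ (c + 1) * s ^ j := fun j _ => by
    have hceil := (Nat.ceil_lt_add_one (show 0 ≤ c * s ^ j by positivity)).le
    linarith [one_le_pow₀ hs.le (n := j)]
  calc ((∑ j ∈ Finset.range J, ⌈c * s ^ j⌉₊ : ℕ) : ℝ)
      ≤ ∑ j ∈ Finset.range J, (c + 1) * s ^ j := by
        push_cast
        exact Finset.sum_le_sum hterm
    _ = (c + 1) / (s - 1) * (s ^ J - 1) := by
        rw [← Finset.mul_sum, geom_sum_eq hs.ne']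
        ring

lemma exists_pow_near (hc : 0 < c) (hs : 1 < s) (N : ℕ) :
    ∃ J : ℕ, c * (s ^ J - 1) ≤ N ∧ ((N : ℝ) + 1) / ((c + 1) * s) ≤ s ^ J := by
  obtain ⟨J, hlo, hhi⟩ := exists_nat_pow_near (x := N / c + 1) (y := s)
    (le_add_of_nonneg_left (by positivity)) hs
  refine ⟨J, ?_, ?_⟩
  · rwa [← sub_le_iff_le_add, le_div_iff₀' hc] at hlo
  · rw [← lt_sub_iff_add_lt, div_lt_iff₀' hc, pow_succ] at hhi
    rw [div_le_iff₀' (by positivity)]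
    nlinarith [one_le_pow₀ hs.le (n := J)]

lemma exists_blockLengths {K q γ : ℝ} (hK : 0 < K) (hq0 : 0 < q) (hq1 : q < 1) (hγ : 0 < γ) :
    ∃ n : ℕ → ℕ, (∀ J, 0 < n J ∧ K * (n J : ℝ) ^ (-γ) ≤ q ^ J / 4) ∧
      ∃ C : ℝ, 0 < C ∧ ∀ N : ℕ, ∃ J,
        ∑ j ∈ Finset.range J, n j ≤ N ∧ q ^ J ≤ C * ((N : ℝ) + 1) ^ (-γ) := by
  set s : ℝ := q ^ (-γ⁻¹) with hs_def
  have hs : 1 < s := Real.one_lt_rpow_of_pos_of_lt_one_of_neg hq0 hq1 (by simpa using hγ)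
  have hsq : ∀ J : ℕ, (s ^ J) ^ (-γ) = q ^ J := fun J => by
    rw [hs_def, ← Real.rpow_mul_natCast hq0.le, ← Real.rpow_mul hq0.le, ← Real.rpow_natCast]
    congr 1
    field_simp
  set c : ℝ := (4 * K) ^ γ⁻¹ with hc_def
  have hc : 0 < c := by positivity
  have hc₂ : 0 < (c + 1) / (s - 1) := div_pos (by positivity) (by linarith)
  refine ⟨fun J => ⌈c * s ^ J⌉₊, fun J => ⟨Nat.ceil_pos.2 (by positivity), ?_⟩,
    (((c + 1) / (s - 1) + 1) * s) ^ γ, by positivity, fun N => ?_⟩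
  · calc K * (⌈c * s ^ J⌉₊ : ℝ) ^ (-γ) ≤ K * (c * s ^ J) ^ (-γ) :=
          mul_le_mul_of_nonneg_left (Real.rpow_le_rpow_of_nonpos (by positivity)
            (Nat.le_ceil _) (by linarith)) hK.le
      _ = K * ((4 * K)⁻¹ * q ^ J) := by
          rw [Real.mul_rpow hc.le (by positivity), hsq, hc_def, ← Real.rpow_mul (by positivity),
            mul_neg, inv_mul_cancel₀ hγ.ne', Real.rpow_neg_one]
      _ = q ^ J / 4 := by field_simp
  · obtain ⟨J, hlo, hhi⟩ := exists_pow_near hc₂ hs N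
    refine ⟨J, Nat.cast_le.1 ((sum_ceil_mul_pow_le hc.le hs J).trans hlo), ?_⟩
    rw [← hsq]
    refine (Real.rpow_le_rpow_of_nonpos (by positivity) hhi (by linarith)).trans_eq ?_
    rw [Real.div_rpow (by positivity) (by positivity),
      Real.rpow_neg (x := ((c + 1) / (s - 1) + 1) * s) (by positivity), div_inv_eq_mul, mul_comm]

end BlockLengths

section Coupling

variable {ι : Type*} [Fintype ι] {β γ : ℝ} {r s : ι → ℝ → ℝ} {l : List ℝ≥0} {m : ℝ}

/-- Finite families of regular densities whose sum lies below a dominated density. -/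
structure DominatedFamily (β : ℝ) (r : ι → ℝ → ℝ) : Prop where
  regular : ∀ i, RegularDensity (1 + β) (r i)
  exists_le : ∃ G, DominatedDensity β G ∧ ∀ x ∈ Set.Ioc (0 : ℝ) 1, ∑ i, r i x ≤ G x

/-- A pair of dominated families with equal individual masses and total mass at most `m`: the
densities that remain to be matched in a coupling. -/
structure Coupled (β : ℝ) (r s : ι → ℝ → ℝ) (m : ℝ) : Prop where
  left : DominatedFamily β r
  right : DominatedFamily β s
  mass_eq : ∀ i, mass (r i) = mass (s i)
  sum_mass_le : ∑ i, mass (r i) ≤ m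

/-- The mass that two densities of equal mass have in common after the maps of the list have acted:
a fixed proportion of the mass that has left the neutral fixed point under both densities. -/
noncomputable def overlap (l : List ℝ≥0) (r s : ℝ → ℝ) : ℝ :=
  max 0 (mass r - mass (leftList l r) - mass (leftList l s)) / 11664

/-- The constant in the bound on the trapped mass. -/
noncomputable def trapConst (β γ : ℝ) : ℝ := 3 * (1 - β * (γ + 1))⁻¹ * (β / 2) ^ (-γ)

lemma trapConst_pos (hβ0 : 0 < β) (hγ : β * (γ + 1) < 1) : 0 < trapConst β γ :=
  mul_pos (mul_pos three_pos (inv_pos.2 (by linarith))) (Real.rpow_pos_of_pos (by positivity) _)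

lemma mass_sub_const {r : ℝ → ℝ} (hr : Integrable fun x : I => r x) (θ : ℝ) :
    mass (fun x => r x - θ) = mass r - θ :=
  (integral_sub hr (integrable_const θ)).trans (congrArg (mass r - ·) (mass_const θ))

lemma overlap_nonneg (l : List ℝ≥0) (r s : ℝ → ℝ) : 0 ≤ overlap l r s :=
  div_nonneg (le_max_left _ _) (by norm_num)

lemma overlap_comm (l : List ℝ≥0) {r s : ℝ → ℝ} (h : mass r = mass s) :
    overlap l r s = overlap l s r := by
  rw [overlap, overlap, h, sub_right_comm]

lemma RegularDensity.overlap_le (hβ0 : 0 ≤ β) (hβ : β ≤ 1 / 3) (hl : ∀ a ∈ l, (a : ℝ) ≤ β)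
    {r s : ℝ → ℝ} (hr : RegularDensity (1 + β) r) (hs : 0 ≤ mass (leftList l s)) :
    overlap l r s ≤ transferList l r 1 / 4 := by
  have hmass := hr.mass_sub_mass_leftList_le hβ0 hβ hl one_mem_Ioc
  have hnonneg := transferList_nonneg l hr.nonneg 1 one_mem_Ioc
  have hmax : max 0 (mass r - mass (leftList l r) - mass (leftList l s)) ≤
      2916 * transferList l r 1 := max_le (by positivity) (by linarith)
  rw [overlap]
  linarith

namespace DominatedFamily

lemma mass_leftList_nonneg (hr : DominatedFamily β r) (hl : ∀ a ∈ l, (a : ℝ) ≤ β) (i : ι) :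
    0 ≤ mass (leftList l (r i)) :=
  mass_nonneg ((hr.regular i).leftList fun a ha => by linarith [hl a ha]).nonneg

lemma sum_mass_leftList_le (hβ0 : 0 < β) (hβ : β ≤ 1) (hγ0 : 0 ≤ γ) (hγ : β * (γ + 1) < 1)
    (hl : ∀ a ∈ l, (a : ℝ) ≤ β) (hr : DominatedFamily β r) :
    ∑ i, mass (leftList l (r i)) ≤ trapConst β γ * ((l.length : ℝ) + 1) ^ (-γ) := by
  obtain ⟨G, hG, hle⟩ := hr.exists_le
  have hint : ∀ i ∈ Finset.univ, Integrable fun x : I => leftList l (r i) x := fun i _ =>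
    ((hr.regular i).leftList fun a ha => by linarith [hl a ha]).integrable
  have hsum : mass (leftList l (∑ i, r i)) = ∑ i, mass (leftList l (r i)) := by
    simp only [mass, map_sum, Finset.sum_apply]
    exact integral_finsetSum _ hint
  rw [← hsum]
  refine mass_leftList_le hβ0 hβ hγ0 hγ hl (fun x hx => ?_) fun x hx => ?_ <;>
    rw [Finset.sum_apply]
  · exact Finset.sum_nonneg fun i _ => (hr.regular i).nonneg x hx
  · exact (hle x hx).trans (hG.le x hx)

protected lemma transferList (hβ0 : 0 ≤ β) (hβ : β ≤ 1 / 3) (hl : ∀ a ∈ l, (a : ℝ) ≤ β)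
    (hr : DominatedFamily β r) : DominatedFamily β fun i => transferList l (r i) where
  regular i := (hr.regular i).transferList fun a ha => by linarith [hl a ha]
  exists_le := by
    obtain ⟨G, hG, hle⟩ := hr.exists_le
    refine ⟨transferList l G, hG.transferList hβ0 hβ hl, fun x hx => ?_⟩
    rw [← Finset.sum_apply, ← map_sum]
    exact transferList_le_transferList l (by simpa only [Finset.sum_apply] using hle) x hx

lemma transferOp_sub_const (hβ0 : 0 ≤ β) (hβ : β ≤ 1 / 3) {a : ℝ≥0} (ha : (a : ℝ) ≤ β)
    (hr : DominatedFamily β r) {θ : ι → ℝ} (hθ0 : ∀ i, 0 ≤ θ i) (hθ : ∀ i, θ i ≤ r i 1 / 4) :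
    DominatedFamily β fun i x => transferOp a (r i) x - θ i where
  regular i := (hr.regular i).transferOp_sub_const (by linarith) (hθ0 i) (hθ i)
  exists_le := by
    obtain ⟨G, hG, hle⟩ := (hr.transferList hβ0 hβ (l := [a]) (by simpa using ha)).exists_le
    exact ⟨G, hG, fun x hx =>
      (Finset.sum_le_sum fun i _ => sub_le_self _ (hθ0 i)).trans (hle x hx)⟩

end DominatedFamily

namespace Coupled

lemma div_le_sum_overlap (hβ0 : 0 < β) (hβ : β ≤ 1) (hγ0 : 0 ≤ γ) (hγ : β * (γ + 1) < 1)
    (hc : Coupled β r s m) (hl : ∀ a ∈ l, (a : ℝ) ≤ β)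
    (hm : trapConst β γ * ((l.length : ℝ) + 1) ^ (-γ) ≤ m / 4) :
    (∑ i, mass (r i) - m / 2) / 11664 ≤ ∑ i, overlap l (r i) (s i) := by
  have htrap_left := hc.left.sum_mass_leftList_le hβ0 hβ hγ0 hγ hl
  have htrap_right := hc.right.sum_mass_leftList_le hβ0 hβ hγ0 hγ hl
  calc (∑ i, mass (r i) - m / 2) / 11664
      ≤ (∑ i, (mass (r i) - mass (leftList l (r i)) - mass (leftList l (s i)))) / 11664 := by
        rw [Finset.sum_sub_distrib, Finset.sum_sub_distrib]
        linarith
    _ ≤ ∑ i, overlap l (r i) (s i) := by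
        rw [Finset.sum_div]
        exact Finset.sum_le_sum fun i _ =>
          div_le_div_of_nonneg_right (le_max_right _ _) (by norm_num)

-- The overlap is subtracted, as a constant, from both densities.
lemma exists_step_append (hβ0 : 0 < β) (hβ : β ≤ 1 / 3) (hγ0 : 0 ≤ γ) (hγ : β * (γ + 1) < 1)
    (hc : Coupled β r s m) (hl : ∀ a ∈ l, (a : ℝ) ≤ β) {a : ℝ≥0} (ha : (a : ℝ) ≤ β)
    (hm : trapConst β γ * ((l.length : ℝ) + 1) ^ (-γ) ≤ m / 4) :
    ∃ r' s', Coupled β r' s' ((1 - 1 / 23328) * m) ∧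
      ∀ i, transferList (l ++ [a]) (r i - s i) = r' i - s' i := by
  set θ : ι → ℝ := fun i => overlap l (r i) (s i)
  have hθ0 : ∀ i, 0 ≤ θ i := fun i => overlap_nonneg l (r i) (s i)
  have hθr : ∀ i, θ i ≤ transferList l (r i) 1 / 4 := fun i =>
    (hc.left.regular i).overlap_le hβ0.le hβ hl (hc.right.mass_leftList_nonneg hl i)
  have hθs : ∀ i, θ i ≤ transferList l (s i) 1 / 4 := fun i =>
    (overlap_comm l (hc.mass_eq i)).trans_le <|
      (hc.right.regular i).overlap_le hβ0.le hβ hl (hc.left.mass_leftList_nonneg hl i)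
  have hmass : ∀ u : ℝ → ℝ, (Integrable fun x : I => u x) → ∀ t,
      mass (fun x => transferOp a (transferList l u) x - t) = mass u - t := fun u hu t => by
    have hint := integrable_transferList l hu
    rw [mass_sub_const (integrable_transferOp a hint), mass_transferOp a hint,
      mass_transferList l hu]
  have hsum : ∑ i, mass (fun x => transferOp a (transferList l (r i)) x - θ i) =
      ∑ i, mass (r i) - ∑ i, θ i := by
    rw [← Finset.sum_sub_distrib]
    exact Finset.sum_congr rfl fun i _ => hmass _ (hc.left.regular i).integrable _
  refine ⟨fun i x => transferOp a (transferList l (r i)) x - θ i,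
    fun i x => transferOp a (transferList l (s i)) x - θ i,
    ⟨(hc.left.transferList hβ0.le hβ hl).transferOp_sub_const hβ0.le hβ ha hθ0 hθr,
      (hc.right.transferList hβ0.le hβ hl).transferOp_sub_const hβ0.le hβ ha hθ0 hθs,
      fun i => ?_, ?_⟩, fun i => ?_⟩
  · rw [hmass _ (hc.left.regular i).integrable, hmass _ (hc.right.regular i).integrable,
      hc.mass_eq]
  · rw [hsum]
    linarith [hc.div_le_sum_overlap hβ0 (by linarith) hγ0 hγ hl hm, hc.sum_mass_le]
  · rw [transferList_append, map_sub, transferList_cons, map_sub, map_sub]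
    exact funext fun x => (sub_sub_sub_cancel_right _ _ (θ i)).symm

lemma exists_step (hβ0 : 0 < β) (hβ : β ≤ 1 / 3) (hγ0 : 0 ≤ γ) (hγ : β * (γ + 1) < 1)
    (hc : Coupled β r s m) (hl : ∀ a ∈ l, (a : ℝ) ≤ β) (hne : l ≠ [])
    (hm : trapConst β γ * (l.length : ℝ) ^ (-γ) ≤ m / 4) :
    ∃ r' s', Coupled β r' s' ((1 - 1 / 23328) * m) ∧
      ∀ i, transferList l (r i - s i) = r' i - s' i := by
  obtain ⟨l', a, rfl⟩ : ∃ l' a, l = l' ++ [a] := ⟨_, _, (List.dropLast_append_getLast hne).symm⟩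
  refine hc.exists_step_append hβ0 hβ hγ0 hγ (fun c h => hl c (List.mem_append_left _ h))
    (hl a (by simp)) ?_
  simpa using hm

lemma sum_mass_abs_le (hc : Coupled β r s m) : ∑ i, mass |r i - s i| ≤ 2 * m := by
  have hterm : ∀ i, mass |r i - s i| ≤ 2 * mass (r i) := fun i => by
    have hri := (hc.left.regular i).integrable
    have hsi := (hc.right.regular i).integrable
    calc mass |r i - s i| ≤ mass (r i + s i) :=
          mass_le_mass (hri.sub hsi).abs (hri.add hsi) fun x hx => by
            simpa [abs_of_nonneg ((hc.left.regular i).nonneg x hx),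
              abs_of_nonneg ((hc.right.regular i).nonneg x hx)] using abs_sub (r i x) (s i x)
      _ = mass (r i) + mass (s i) := integral_add hri hsi
      _ = 2 * mass (r i) := by rw [← hc.mass_eq i, two_mul]
  calc ∑ i, mass |r i - s i| ≤ ∑ i, 2 * mass (r i) := Finset.sum_le_sum fun i _ => hterm i
    _ ≤ 2 * m := by
      rw [← Finset.mul_sum]
      linarith [hc.sum_mass_le]

lemma exists_iterate (hβ0 : 0 < β) (hβ : β ≤ 1 / 3) (hγ0 : 0 ≤ γ) (hγ : β * (γ + 1) < 1)
    {n : ℕ → ℕ}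
    (hn : ∀ J, 0 < n J ∧ trapConst β γ * (n J : ℝ) ^ (-γ) ≤ (1 - 1 / 23328) ^ J / 4)
    (hc : Coupled β r s 1) (J : ℕ) (hl : ∀ a ∈ l, (a : ℝ) ≤ β)
    (hlen : l.length = ∑ j ∈ Finset.range J, n j) :
    ∃ r' s', Coupled β r' s' ((1 - 1 / 23328) ^ J) ∧
      ∀ i, transferList l (r i - s i) = r' i - s' i := by
  induction J generalizing l with
  | zero =>
    obtain rfl : l = [] := by simpa using hlen
    exact ⟨r, s, by simpa using hc, fun i => rfl⟩
  | succ J ih =>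
    rw [Finset.sum_range_succ] at hlen
    set k := ∑ j ∈ Finset.range J, n j
    obtain ⟨u, v, huv, heq⟩ := ih (l := l.take k) (fun a ha => hl a (List.mem_of_mem_take ha))
      (by simp [hlen])
    have hdrop : (l.drop k).length = n J := by simp [hlen]
    obtain ⟨u', v', huv', heq'⟩ := huv.exists_step hβ0 hβ hγ0 hγ (l := l.drop k)
      (fun a ha => hl a (List.mem_of_mem_drop ha))
      (List.ne_nil_of_length_pos (hdrop ▸ (hn J).1)) (hdrop ▸ (hn J).2)
    refine ⟨u', v', by rwa [pow_succ'], fun i => ?_⟩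
    rw [← List.take_append_drop k l, transferList_append, heq, heq']

end Coupled

theorem exists_coupling_bound (hβ0 : 0 < β) (hβ : β ≤ 1 / 3) (hγ0 : 0 < γ)
    (hγ : β * (γ + 1) < 1) :
    ∃ C : ℝ, 0 < C ∧ ∀ {ι : Type*} [Fintype ι] {r s : ι → ℝ → ℝ}, Coupled β r s 1 →
      ∀ l : List ℝ≥0, (∀ a ∈ l, (a : ℝ) ≤ β) →
      ∑ i, mass |transferList l (r i - s i)| ≤ C * ((l.length : ℝ) + 1) ^ (-γ) := by
  obtain ⟨n, hn, C, hC, hJ⟩ := exists_blockLengths (q := 1 - 1 / 23328)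
    (trapConst_pos hβ0 hγ) (by norm_num) (by norm_num) hγ0
  refine ⟨2 * C, by positivity, fun {ι} _ {r s} hc l hl => ?_⟩
  obtain ⟨J, hk, hq⟩ := hJ l.length
  set k := ∑ j ∈ Finset.range J, n j
  obtain ⟨u, v, huv, heq⟩ := hc.exists_iterate hβ0 hβ hγ0.le hγ hn J (l := l.take k)
    (fun a ha => hl a (List.mem_of_mem_take ha)) (by rw [List.length_take, min_eq_left hk])
  have hterm : ∀ i, mass |transferList l (r i - s i)| ≤ mass |u i - v i| := fun i => by
    rw [← List.take_append_drop k l, transferList_append, heq]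
    exact mass_abs_transferList_le _
      ((huv.left.regular i).integrable.sub (huv.right.regular i).integrable)
  calc ∑ i, mass |transferList l (r i - s i)| ≤ ∑ i, mass |u i - v i| :=
        Finset.sum_le_sum fun i _ => hterm i
    _ ≤ 2 * (1 - 1 / 23328) ^ J := huv.sum_mass_abs_le
    _ ≤ 2 * C * ((l.length : ℝ) + 1) ^ (-γ) := by
      rw [mul_assoc]
      exact mul_le_mul_of_nonneg_left hq zero_le_two

end Coupling
section Itinerary

/-- The itinerary of a point along a list of maps: whether the left branch is used, at each time. -/
noncomputable def itinerary (l : List ℝ≥0) (x : I) (i : Fin l.length) : Bool :=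
  decide ((compList (l.take i) x : ℝ) < 1 / 2)

variable {a : ℝ≥0} {l : List ℝ≥0} {x x' : I} {β γ : ℝ}

lemma itinerary_cons (a : ℝ≥0) (l : List ℝ≥0) (x : I) :
    itinerary (a :: l) x = Fin.cons (decide ((x : ℝ) < 1 / 2)) (itinerary l (pmMap a x)) :=
  funext fun i => Fin.cases rfl (fun _ => rfl) i

lemma itinerary_cons_eq_iff :
    itinerary (a :: l) x = itinerary (a :: l) x' ↔
      ((x : ℝ) < 1 / 2 ↔ (x' : ℝ) < 1 / 2) ∧
        itinerary l (pmMap a x) = itinerary l (pmMap a x') := by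
  rw [itinerary_cons, itinerary_cons, Fin.cons_inj, decide_eq_decide]

lemma itinerary_drop_eq (h : itinerary l x = itinerary l x') (i : ℕ) :
    itinerary (l.drop i) (compList (l.take i) x) =
      itinerary (l.drop i) (compList (l.take i) x') := by
  induction l generalizing x x' i with
  | nil => cases i <;> exact h
  | cons _ _ ih =>
    cases i with
    | zero => exact h
    | succ i => exact ih (itinerary_cons_eq_iff.1 h).2 i

lemma measurable_itinerary (l : List ℝ≥0) : Measurable (itinerary l) :=
  measurable_pi_lambda _ fun i => measurable_to_bool (by
    have hset : (itinerary l · i) ⁻¹' {true} =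
        compList (l.take i) ⁻¹' {x : I | (x : ℝ) < 1 / 2} :=
      Set.ext fun _ => decide_eq_true_iff
    rw [hset]
    exact measurable_compList _ measurableSet_lt_half)

lemma leftMap_sub_le {y z : ℝ} (hy : 0 ≤ y) (hyz : y ≤ z) :
    leftMap a (z - y) ≤ leftMap a z - leftMap a y := by
  have hy' : y * y ^ (a : ℝ) ≤ y * z ^ (a : ℝ) := by gcongr
  have hsub : (z - y) * (z - y) ^ (a : ℝ) ≤ (z - y) * z ^ (a : ℝ) :=
    mul_le_mul_of_nonneg_left (Real.rpow_le_rpow (sub_nonneg.2 hyz) (sub_le_self z hy) a.2)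
      (sub_nonneg.2 hyz)
  have hsum : 2 ^ (a : ℝ) * ((z - y) * (z - y) ^ (a : ℝ)) ≤
      2 ^ (a : ℝ) * (z * z ^ (a : ℝ) - y * y ^ (a : ℝ)) :=
    mul_le_mul_of_nonneg_left (by linarith) (by positivity)
  unfold leftMap
  linarith

lemma sub_le_half_of_lt_half_iff (h : (x : ℝ) < 1 / 2 ↔ (x' : ℝ) < 1 / 2) :
    (x : ℝ) - x' ≤ 1 / 2 := by
  have hx := x.2.2
  have hx' := x'.2.1
  by_cases hlt : (x : ℝ) < 1 / 2
  · linarith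
  · linarith [not_lt.1 fun hlt' => hlt (h.2 hlt')]

lemma mul_le_pmMap_sub (hβ0 : 0 ≤ β) (ha : (a : ℝ) ≤ β) (hxx : (x' : ℝ) < x)
    (h : (x : ℝ) < 1 / 2 ↔ (x' : ℝ) < 1 / 2) :
    ((x : ℝ) - x') * (1 + (2 * ((x : ℝ) - x')) ^ β) ≤ (pmMap a x : ℝ) - pmMap a x' := by
  have hhalf := sub_le_half_of_lt_half_iff h
  have hpos := sub_pos.2 hxx
  by_cases hx : (x : ℝ) < 1 / 2
  · rw [coe_pmMap_of_lt_half a hx, coe_pmMap_of_lt_half a (h.1 hx)]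
    exact (le_leftMap ha hpos hhalf).trans (leftMap_sub_le x'.2.1 hxx.le)
  · rw [coe_pmMap_of_half_le a (not_lt.1 hx),
      coe_pmMap_of_half_le a (not_lt.1 fun hx' => hx (h.2 hx'))]
    have hone : (2 * ((x : ℝ) - x')) ^ β ≤ 1 :=
      Real.rpow_le_one (by linarith) (by linarith) hβ0
    linarith [mul_le_mul_of_nonneg_left hone hpos.le]

lemma one_add_mul_length_le_rpow (hβ0 : 0 ≤ β) (hβ : β ≤ 1) (hl : ∀ a ∈ l, (a : ℝ) ≤ β)
    (hxx : (x' : ℝ) < x) (h : itinerary l x = itinerary l x') :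
    1 + β / 2 * l.length ≤ ((x : ℝ) - x') ^ (-β) := by
  induction l generalizing x x' with
  | nil =>
    have hle : (x : ℝ) - x' ≤ 1 := by linarith [x.2.2, x'.2.1]
    simpa using Real.one_le_rpow_of_pos_of_le_one_of_nonpos (sub_pos.2 hxx) hle (neg_nonpos.2 hβ0)
  | cons a l ih =>
    obtain ⟨ha, hl⟩ := List.forall_mem_cons.1 hl
    obtain ⟨hside, htail⟩ := itinerary_cons_eq_iff.1 h
    have hpos := sub_pos.2 hxx
    have hexp := mul_le_pmMap_sub hβ0 ha hxx hside
    have hstep := rpow_neg_add_le hβ0 hβ hpos (sub_le_half_of_lt_half_iff hside) hexp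
    have hxx' : (pmMap a x' : ℝ) < pmMap a x := sub_pos.1 (lt_of_lt_of_le (by positivity) hexp)
    have hrec := ih hl hxx' htail
    simp only [List.length_cons]
    push_cast
    linarith

lemma dist_le_of_itinerary_eq (hβ0 : 0 < β) (hβ : β ≤ 1) (hl : ∀ a ∈ l, (a : ℝ) ≤ β)
    (h : itinerary l x = itinerary l x') :
    dist x x' ≤ (β / 2) ^ (-β⁻¹) * ((l.length : ℝ) + 1) ^ (-β⁻¹) := by
  rw [Subtype.dist_eq, Real.dist_eq]
  wlog hxx : (x' : ℝ) < x generalizing x x'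
  · rcases (not_lt.1 hxx).lt_or_eq with hlt | heq
    · rw [abs_sub_comm]
      exact this h.symm hlt
    · rw [heq, sub_self, abs_zero]
      positivity
  have hpos := sub_pos.2 hxx
  have hexp := one_add_mul_length_le_rpow hβ0.le hβ hl hxx h
  have hle : β / 2 * ((l.length : ℝ) + 1) ≤ ((x : ℝ) - x') ^ (-β) := by linarith
  have hinv := Real.rpow_le_rpow_of_nonpos (by positivity) hle (neg_nonpos.2 (inv_nonneg.2 hβ0.le))
  rwa [← Real.rpow_mul hpos.le, neg_mul_neg, mul_inv_cancel₀ hβ0.ne', Real.rpow_one,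
    Real.mul_rpow (by positivity) (by positivity), ← abs_of_pos hpos] at hinv

lemma one_lt_inv_sub (hβ0 : 0 < β) (hγ : β * (γ + 1) < 1) : 1 < β⁻¹ - γ := by
  rw [lt_sub_iff_add_lt', ← one_div, lt_div_iff₀ hβ0, mul_comm]
  exact hγ

/-- A bound for the total distance of two orbit segments with the same itinerary, up to a decay
factor depending on how much longer the orbits stay together. -/
noncomputable def closenessConst (β γ : ℝ) : ℝ :=
  (β / 2) ^ (-β⁻¹) * ∑' j : ℕ, ((j : ℝ) + 1) ^ (-(β⁻¹ - γ))

lemma closenessConst_nonneg (hβ0 : 0 ≤ β) : 0 ≤ closenessConst β γ :=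
  mul_nonneg (Real.rpow_nonneg (div_nonneg hβ0 zero_le_two) _) (tsum_nonneg fun _ => by positivity)

lemma add_rpow_neg_le_mul {p u v : ℝ} (hγ0 : 0 ≤ γ) (hγp : γ ≤ p) (hu : 0 < u) (hv : 0 < v) :
    (u + v) ^ (-p) ≤ u ^ (-γ) * v ^ (-(p - γ)) := by
  rw [show -p = -γ + -(p - γ) by ring, Real.rpow_add (add_pos hu hv)]
  exact mul_le_mul (Real.rpow_le_rpow_of_nonpos hu (by linarith) (neg_nonpos.2 hγ0))
    (Real.rpow_le_rpow_of_nonpos hv (by linarith) (neg_nonpos.2 (sub_nonneg.2 hγp)))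
    (by positivity) (by positivity)

lemma dist_compList_take_le (hβ0 : 0 < β) (hβ : β ≤ 1) (hγ0 : 0 ≤ γ) (hγ : β * (γ + 1) < 1)
    (hl : ∀ a ∈ l, (a : ℝ) ≤ β) (h : itinerary l x = itinerary l x') {q k i : ℕ}
    (hq : l.length = q + k) (hi : i < q) :
    dist (compList (l.take i) x) (compList (l.take i) x') ≤
      (β / 2) ^ (-β⁻¹) * (((k : ℝ) + 1) ^ (-γ) * (((q - 1 - i : ℕ) : ℝ) + 1) ^ (-(β⁻¹ - γ))) := by
  refine (dist_le_of_itinerary_eq hβ0 hβ (fun a ha => hl a (List.mem_of_mem_drop ha))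
    (itinerary_drop_eq h i)).trans (mul_le_mul_of_nonneg_left ?_ (by positivity))
  have hlen : (l.drop i).length = k + (q - 1 - i) + 1 := by
    rw [List.length_drop]
    omega
  have hlen' : ((l.drop i).length : ℝ) + 1 = ((k : ℝ) + 1) + (((q - 1 - i : ℕ) : ℝ) + 1) := by
    rw [hlen]
    push_cast
    ring
  rw [hlen']
  have hγβ := one_lt_inv_sub hβ0 hγ
  exact add_rpow_neg_le_mul hγ0 (by linarith) (by positivity) (by positivity)

lemma sum_dist_le_of_itinerary_eq (hβ0 : 0 < β) (hβ : β ≤ 1) (hγ0 : 0 ≤ γ) (hγ : β * (γ + 1) < 1)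
    (hl : ∀ a ∈ l, (a : ℝ) ≤ β) (h : itinerary l x = itinerary l x') {q k : ℕ}
    (hq : l.length = q + k) :
    ∑ i ∈ Finset.range q, dist (compList (l.take i) x) (compList (l.take i) x') ≤
      closenessConst β γ * ((k : ℝ) + 1) ^ (-γ) := by
  have hsummable : Summable fun j : ℕ => ((j : ℝ) + 1) ^ (-(β⁻¹ - γ)) := by
    have := (summable_nat_add_iff 1).2
      (Real.summable_nat_rpow.2 (neg_lt_neg (one_lt_inv_sub hβ0 hγ)))
    simpa using this
  calc ∑ i ∈ Finset.range q, dist (compList (l.take i) x) (compList (l.take i) x')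
      ≤ ∑ i ∈ Finset.range q, (β / 2) ^ (-β⁻¹) *
          (((k : ℝ) + 1) ^ (-γ) * (((q - 1 - i : ℕ) : ℝ) + 1) ^ (-(β⁻¹ - γ))) :=
        Finset.sum_le_sum fun i hi =>
          dist_compList_take_le hβ0 hβ hγ0 hγ hl h hq (Finset.mem_range.1 hi)
    _ = (β / 2) ^ (-β⁻¹) *
          (((k : ℝ) + 1) ^ (-γ) * ∑ j ∈ Finset.range q, ((j : ℝ) + 1) ^ (-(β⁻¹ - γ))) := by
        rw [← Finset.mul_sum, ← Finset.mul_sum,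
          Finset.sum_range_reflect (fun j : ℕ => ((j : ℝ) + 1) ^ (-(β⁻¹ - γ))) q]
    _ ≤ (β / 2) ^ (-β⁻¹) *
          (((k : ℝ) + 1) ^ (-γ) * ∑' j : ℕ, ((j : ℝ) + 1) ^ (-(β⁻¹ - γ))) := by
        gcongr
        exact hsummable.sum_le_tsum _ fun j _ => by positivity
    _ = closenessConst β γ * ((k : ℝ) + 1) ^ (-γ) := by
        rw [closenessConst]
        ring

end Itinerary

section Branches

/-- The contribution of one branch to the transfer operator: the left one for `true`, the right one
for `false`. -/
noncomputable def branchOp (a : ℝ≥0) : Bool → (ℝ → ℝ) →ₗ[ℝ] ℝ → ℝ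
  | true => leftOp a
  | false => rightOp

/-- The contribution of the points with a given itinerary to the transfer operator of a
composition. -/
noncomputable def branchList : (l : List ℝ≥0) → (Fin l.length → Bool) → (ℝ → ℝ) →ₗ[ℝ] ℝ → ℝ
  | [], _ => LinearMap.id
  | a :: l, c => branchList l (Fin.tail c) ∘ₗ branchOp a (c 0)

variable {l : List ℝ≥0} {r : ℝ → ℝ} {b : ℝ}

lemma branchList_cons (a : ℝ≥0) (l : List ℝ≥0) (c₀ : Bool) (c : Fin l.length → Bool) (r : ℝ → ℝ) :
    branchList (a :: l) (Fin.cons c₀ c) r = branchList l c (branchOp a c₀ r) := rfl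

protected lemma RegularDensity.branchList (hr : RegularDensity b r)
    (hl : ∀ a ∈ l, 1 + (a : ℝ) ≤ b) (c : Fin l.length → Bool) :
    RegularDensity b (branchList l c r) := by
  induction l generalizing r with
  | nil => exact hr
  | cons a l ih =>
    obtain ⟨ha, hl⟩ := List.forall_mem_cons.1 hl
    refine ih ?_ hl _
    cases c 0 with
    | true => exact hr.leftOp ha
    | false =>
      have hb : 0 ≤ b := by linarith [a.2]
      exact RegularDensity.rightOp hb hr

lemma sum_branchList (l : List ℝ≥0) (r : ℝ → ℝ) : ∑ c, branchList l c r = transferList l r := by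
  induction l generalizing r with
  | nil => exact Fintype.sum_unique fun _ : Fin 0 → Bool => r
  | cons a l ih =>
    calc ∑ c, branchList (a :: l) c r
        = ∑ p : Bool × (Fin l.length → Bool), branchList l p.2 (branchOp a p.1 r) :=
          ((Fin.consEquiv fun _ : Fin (l.length + 1) => Bool).sum_comp
            fun c => branchList (a :: l) c r).symm
      _ = transferList l (leftOp a r) + transferList l (rightOp r) := by
          rw [Fintype.sum_prod_type, Fintype.sum_bool, ← ih, ← ih]
          rfl
      _ = transferList (a :: l) r := by
          rw [← map_add]
          rfl

lemma integral_branchOp_mul (a : ℝ≥0) (c : Bool) (r : ℝ → ℝ) (B : I → ℝ) :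
    ∫ x : I, branchOp a c r x * B x =
      ∫ x : I, r x * if decide ((x : ℝ) < 1 / 2) = c then B (pmMap a x) else 0 := by
  cases c with
  | true =>
    refine (integral_leftOp_mul a r B).trans ?_
    simp only [decide_eq_true_eq, mul_ite, mul_zero]
  | false =>
    refine (integral_rightOp_mul a r B).trans ?_
    simp only [decide_eq_false_iff_not, ite_not, mul_ite, mul_zero]

lemma integral_branchList_mul (l : List ℝ≥0) (c : Fin l.length → Bool) (r : ℝ → ℝ) (B : I → ℝ) :
    ∫ x : I, branchList l c r x * B x =
      ∫ x : I, r x * if itinerary l x = c then B (compList l x) else 0 := by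
  induction l generalizing r with
  | nil =>
    have hc (x : I) : itinerary [] x = c := Subsingleton.elim (α := Fin 0 → Bool) _ _
    simp only [hc, if_true]
    rfl
  | cons a l ih =>
    cases c using Fin.consCases with
    | _ c₀ c =>
    rw [branchList_cons, ih, integral_branchOp_mul]
    congr with x
    rw [itinerary_cons]
    simp only [Fin.cons_inj, ite_and]
    rfl

lemma integrable_mul_of_abs_le (hr : Integrable fun x : I => r x) {B : I → ℝ} (hB : Measurable B)
    (hb : ∀ x, |B x| ≤ b) : Integrable fun x : I => r x * B x :=
  hr.mul_bdd hB.aestronglyMeasurable (ae_of_all _ hb)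

lemma integral_mul_itinerary (l : List ℝ≥0) (hr : Integrable fun x : I => r x)
    {Φ : (Fin l.length → Bool) → I → ℝ} (hΦ : ∀ c, Measurable (Φ c)) (hb : ∀ c x, |Φ c x| ≤ b) :
    ∫ x : I, r x * Φ (itinerary l x) (compList l x) =
      ∑ c, ∫ x : I, branchList l c r x * Φ c x := by
  simp only [integral_branchList_mul]
  rw [← integral_finsetSum]
  · congr with x
    rw [← Finset.mul_sum, Finset.sum_ite_eq, if_pos (Finset.mem_univ _)]
  · refine fun c _ => integrable_mul_of_abs_le hr (b := b) (Measurable.ite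
      (measurable_itinerary l (measurableSet_singleton c))
      ((hΦ c).comp (measurable_compList l)) measurable_const) fun x => ?_
    split_ifs
    · exact hb _ _
    · exact abs_zero.trans_le ((abs_nonneg _).trans (hb c x))

lemma integral_transferList_mul (l : List ℝ≥0) (hr : Integrable fun x : I => r x)
    {B : I → ℝ} (hB : Measurable B) (hb : ∀ x, |B x| ≤ b) :
    ∫ x : I, transferList l r x * B x = ∫ x : I, r x * B (compList l x) := by
  induction l generalizing r with
  | nil => rfl
  | cons a l ih =>
    rw [transferList_cons, ih (integrable_transferOp a hr)]
    exact integral_transferOp_mul a (B := fun x => B (compList l x))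
      (integrable_mul_of_abs_le hr (hB.comp ((measurable_compList l).comp (measurable_pmMap a)))
        fun x => hb _)

end Branches

section InitialMeasure

variable {β : ℝ} {μ : Measure I} [IsProbabilityMeasure μ]

lemma HasConeDensity.exists_regularDensity (hβ0 : 0 ≤ β) (hβ : β ≤ 1 / 3)
    (h : HasConeDensity β μ) :
    ∃ g : ℝ → ℝ, RegularDensity (1 + β) g ∧ DominatedDensity β g ∧ mass g = 1 ∧
      ∀ F : I → ℝ, ∫ x, F x ∂μ = ∫ x : I, g x * F x := by
  obtain ⟨g, ⟨-, hgi, hg0, hga, hgm, hgb⟩, hμ⟩ := h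
  have hext : ∀ x ∈ Set.Ioc (0 : ℝ) 1, realExt (fun x : I => g x) x = g x := fun x hx =>
    realExt_of_mem (fun x : I => g x) (Set.Ioc_subset_Icc_self hx)
  have hint : Integrable fun x : I => g x := (integrable_unitInterval _).2
    (hgi.congr_fun (fun x hx => (hext x hx).symm) measurableSet_Ioc)
  have hgF : ∀ F : I → ℝ, ∫ x, F x ∂μ = ∫ x : I, g x * F x := fun F => by
    rw [hμ, integral_withDensity_eq_integral_toReal_smul₀ hint.aemeasurable.ennreal_ofReal
      (ae_of_all _ fun x => ENNReal.ofReal_lt_top)]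
    refine integral_congr_ae (ae_mem_Ioc.mono fun x hx => ?_)
    simp only [ENNReal.toReal_ofReal (hg0 x hx), smul_eq_mul]
  have hmass : mass g = 1 := by simpa [mass] using (hgF fun _ => 1).symm
  have hmass' : ∫ y in Set.Ioc (0 : ℝ) 1, g y = 1 := by
    rw [mass, integral_unitInterval, setIntegral_congr_fun measurableSet_Ioc hext] at hmass
    exact hmass
  refine ⟨g, ⟨hg0, hga, by rwa [add_comm], hint⟩, ⟨hg0, hga, hint, hmass.le, fun x hx => ?_⟩,
    hmass, hgF⟩
  have hconst : (2 : ℝ) ^ β ≤ 9 / 7 := by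
    calc (2 : ℝ) ^ β ≤ 2 ^ (1 / 3 : ℝ) := Real.rpow_le_rpow_of_exponent_le one_le_two hβ
      _ ≤ ((9 / 7 : ℝ) ^ (3 : ℝ)) ^ (1 / 3 : ℝ) :=
          Real.rpow_le_rpow zero_le_two (by norm_num) (by norm_num)
      _ = 9 / 7 := by rw [← Real.rpow_mul (by norm_num)]; norm_num
  have hle := hgb x hx
  rw [hmass', mul_one] at hle
  refine hle.trans (mul_le_mul_of_nonneg_right ?_ (Real.rpow_nonneg hx.1.le _))
  nlinarith

end InitialMeasure

section Orbits

/-- The parameters `α (j + 1), …, α (j + n)`. -/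
def paramList (α : ℕ → ℝ≥0) (j n : ℕ) : List ℝ≥0 := (List.range n).map fun i => α (j + i + 1)

variable (α : ℕ → ℝ≥0) (j n : ℕ)

lemma length_paramList : (paramList α j n).length = n := by
  rw [paramList, List.length_map, List.length_range]

lemma paramList_succ : paramList α j (n + 1) = paramList α j n ++ [α (j + n + 1)] := by
  rw [paramList, List.range_succ, List.map_append, List.map_singleton, paramList]

lemma paramList_le {α : ℕ → ℝ≥0} {β : ℝ} (hα : ∀ n, 1 ≤ n → (α n : ℝ) ≤ β) :
    ∀ a ∈ paramList α j n, (a : ℝ) ≤ β := fun a ha => by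
  obtain ⟨i, -, rfl⟩ := List.mem_map.1 ha
  exact hα _ (Nat.le_add_left _ _)

lemma take_paramList {i n : ℕ} (h : i ≤ n) : (paramList α j n).take i = paramList α j i := by
  rw [paramList, ← List.map_take, List.take_range, min_eq_left h, paramList]

lemma comp_add (x : I) : comp α (j + n) x = compList (paramList α j n) (comp α j x) := by
  induction n with
  | zero => rfl
  | succ n ih =>
    rw [paramList_succ, compList_append, ← ih]
    rfl

lemma comp_eq_compList (x : I) : comp α n x = compList (paramList α 0 n) x := by
  rw [← zero_add n, comp_add, zero_add]
  rfl

lemma measurable_comp : Measurable (comp α n) := by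
  rw [funext (comp_eq_compList α n)]
  exact measurable_compList _

end Orbits
section Correlation

variable {Ω Y : Type*} [MeasurableSpace Ω] {μ : Measure Ω} [IsProbabilityMeasure μ]
  {T : Ω → Y} {Γ Γ' : Ω → Y → ℝ} {b b' ε : ℝ}

/-- The correlation of a point `x` with its image `T x`, tested against `Γ`: how much the integral
of `Γ` changes when `T x` is replaced by an independent copy. -/
noncomputable def correlation (μ : Measure Ω) (T : Ω → Y) (Γ : Ω → Y → ℝ) : ℝ :=
  ∫ x, Γ x (T x) ∂μ - ∫ x, ∫ x', Γ x (T x') ∂μ ∂μ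

lemma abs_correlation_le (hΓ : ∀ x y, |Γ x y| ≤ ε) : |correlation μ T Γ| ≤ 2 * ε := by
  refine (abs_sub _ _).trans ?_
  rw [two_mul]
  exact add_le_add (abs_integral_le_of_forall fun x => hΓ x _)
    (abs_integral_le_of_forall fun x => abs_integral_le_of_forall fun x' => hΓ x _)

lemma integrable_of_abs_le {F : Ω → ℝ} (hF : Measurable F) (hb : ∀ x, |F x| ≤ b) :
    Integrable F μ :=
  Integrable.of_bound hF.aestronglyMeasurable b (ae_of_all _ hb)

variable [MeasurableSpace Y]

lemma integrable_uncurry_prod (hT : Measurable T) (hm : Measurable (Function.uncurry Γ))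
    (hb : ∀ x y, |Γ x y| ≤ b) : Integrable (fun p : Ω × Ω => Γ p.1 (T p.2)) (μ.prod μ) :=
  integrable_of_abs_le (hm.comp (measurable_fst.prodMk (hT.comp measurable_snd))) fun _ => hb _ _

lemma correlation_sub (hT : Measurable T) (hm : Measurable (Function.uncurry Γ))
    (hm' : Measurable (Function.uncurry Γ')) (hb : ∀ x y, |Γ x y| ≤ b)
    (hb' : ∀ x y, |Γ' x y| ≤ b') :
    correlation μ T (Γ - Γ') = correlation μ T Γ - correlation μ T Γ' := by
  have hdiag : ∫ x, (Γ - Γ') x (T x) ∂μ = ∫ x, Γ x (T x) ∂μ - ∫ x, Γ' x (T x) ∂μ :=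
    integral_sub (integrable_of_abs_le (hm.comp (measurable_id.prodMk hT)) fun _ => hb _ _)
      (integrable_of_abs_le (hm'.comp (measurable_id.prodMk hT)) fun _ => hb' _ _)
  have hprod := integral_integral_sub (integrable_uncurry_prod (μ := μ) hT hm hb)
    (integrable_uncurry_prod (μ := μ) hT hm' hb')
  rw [correlation, hdiag]
  exact (congrArg _ hprod).trans (sub_sub_sub_comm _ _ _ _)

lemma abs_correlation_le_add (hT : Measurable T) (hm : Measurable (Function.uncurry Γ))
    (hm' : Measurable (Function.uncurry Γ')) (hb : ∀ x y, |Γ x y| ≤ b)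
    (hb' : ∀ x y, |Γ' x y| ≤ b') (hε : ∀ x y, |Γ x y - Γ' x y| ≤ ε) :
    |correlation μ T Γ| ≤ |correlation μ T Γ'| + 2 * ε := by
  have hsub : |correlation μ T (Γ - Γ')| ≤ 2 * ε := abs_correlation_le hε
  rw [correlation_sub hT hm hm' hb hb'] at hsub
  linarith [abs_sub_abs_le_abs_sub (correlation μ T Γ) (correlation μ T Γ')]

end Correlation

section Decorrelation

variable {β γ b : ℝ} {l l' : List ℝ≥0} {g : ℝ → ℝ} {μ : Measure I}

lemma sum_mass_branchList (l : List ℝ≥0) (hg : Integrable fun x : I => g x) :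
    ∑ c, mass (branchList l c g) = mass g := by
  simpa [mass] using (integral_mul_itinerary l hg (Φ := fun _ _ => 1) (b := 1)
    (fun _ => measurable_const) fun _ _ => abs_one.le).symm

lemma mass_smul (c : ℝ) (r : ℝ → ℝ) : mass (c • r) = c * mass r := integral_const_mul _ _

lemma coupled_branchList (hβ0 : 0 ≤ β) (hβ : β ≤ 1 / 3) (hg : RegularDensity (1 + β) g)
    (hgd : DominatedDensity β g) (hmass : mass g = 1) (hl : ∀ a ∈ l, (a : ℝ) ≤ β) :
    Coupled β (fun c => branchList l c g)
      (fun c => mass (branchList l c g) • transferList l g) 1 := by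
  have hl' : ∀ a ∈ l, 1 + (a : ℝ) ≤ 1 + β := fun a ha => add_le_add_right (hl a ha) 1
  have hsum : ∑ c, mass (branchList l c g) = 1 := (sum_mass_branchList l hg.integrable).trans hmass
  have hdom := hgd.transferList hβ0 hβ hl
  refine ⟨⟨hg.branchList hl', _, hdom, fun x _ => ?_⟩, ⟨fun c => ?_, _, hdom, fun x _ => ?_⟩,
    fun c => ?_, hsum.le⟩
  · rw [← sum_branchList, Finset.sum_apply]
  · exact (hg.transferList hl').const_smul (mass_nonneg (hg.branchList hl' c).nonneg)
  · simp only [Pi.smul_apply, smul_eq_mul]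
    rw [← Finset.sum_mul, hsum, one_mul]
  · rw [mass_smul, mass_transferList l hg.integrable, hmass, mul_one]

lemma integrable_branchList (l : List ℝ≥0) (hg : Integrable fun x : I => g x)
    (c : Fin l.length → Bool) : Integrable fun x : I => branchList l c g x := by
  induction l generalizing g with
  | nil => exact hg
  | cons a l ih =>
    refine ih ?_ _
    cases c 0 with
    | true => exact integrable_leftOp a hg
    | false => exact integrable_rightOp hg

lemma integral_diagonal_itinerary (hg : Integrable fun x : I => g x)
    (hμ : ∀ F : I → ℝ, ∫ x, F x ∂μ = ∫ x : I, g x * F x) {H : (Fin l.length → Bool) → I → ℝ}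
    (hH : ∀ c, Measurable (H c)) (hb : ∀ c y, |H c y| ≤ b) :
    ∫ x, H (itinerary l x) (compList (l ++ l') x) ∂μ =
      ∑ c, ∫ x : I, transferList l' (branchList l c g) x * H c x := by
  simp only [hμ, compList_append]
  rw [integral_mul_itinerary l hg (Φ := fun c x => H c (compList l' x))
    (fun c => (hH c).comp (measurable_compList l')) fun c x => hb c _]
  exact Finset.sum_congr rfl fun c _ =>
    (integral_transferList_mul l' (integrable_branchList l hg c) (hH c) (hb c)).symm

variable [IsProbabilityMeasure μ]

lemma integral_prod_itinerary (hg : Integrable fun x : I => g x)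
    (hμ : ∀ F : I → ℝ, ∫ x, F x ∂μ = ∫ x : I, g x * F x) {H : (Fin l.length → Bool) → I → ℝ}
    (hH : ∀ c, Measurable (H c)) (hb : ∀ c y, |H c y| ≤ b) :
    ∫ x, ∫ x', H (itinerary l x) (compList (l ++ l') x') ∂μ ∂μ =
      ∑ c, ∫ x : I, transferList l' (mass (branchList l c g) • transferList l g) x * H c x := by
  have himage (c : Fin l.length → Bool) : ∫ x', H c (compList (l ++ l') x') ∂μ =
      ∫ x : I, transferList l' (transferList l g) x * H c x := by
    rw [hμ, ← transferList_append, integral_transferList_mul _ hg (hH c) (hb c)]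
  rw [hμ, integral_mul_itinerary l hg (Φ := fun c _ => ∫ x', H c (compList (l ++ l') x') ∂μ)
    (fun _ => measurable_const) fun c _ => abs_integral_le_of_forall fun _ => hb c _]
  refine Finset.sum_congr rfl fun c _ => ?_
  rw [integral_mul_const, himage, map_smul, ← mass]
  simp only [Pi.smul_apply, smul_eq_mul, mul_assoc]
  exact (integral_const_mul (mass (branchList l c g)) _).symm

lemma abs_integral_sub_integral_le_mass {r s : ℝ → ℝ} {B : I → ℝ}
    (hr : Integrable fun x : I => r x) (hs : Integrable fun x : I => s x) (hB : Measurable B)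
    (hb : ∀ x, |B x| ≤ b) :
    |(∫ x : I, r x * B x) - ∫ x : I, s x * B x| ≤ b * mass |r - s| := by
  rw [← integral_sub (integrable_mul_of_abs_le hr hB hb) (integrable_mul_of_abs_le hs hB hb), mass,
    ← integral_const_mul, ← Real.norm_eq_abs]
  refine norm_integral_le_of_norm_le ((hr.sub hs).abs.const_mul b) (ae_of_all _ fun x => ?_)
  rw [← sub_mul, norm_mul, mul_comm]
  exact mul_le_mul_of_nonneg_right (hb x) (norm_nonneg _)

/-- Points with the same itinerary may be replaced by one representative, which turns a test
function into a step function; its correlation is then the distance between two coupled families. -/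
lemma abs_correlation_itinerary_le (hg : Integrable fun x : I => g x)
    (hμ : ∀ F : I → ℝ, ∫ x, F x ∂μ = ∫ x : I, g x * F x) {H : (Fin l.length → Bool) → I → ℝ}
    (hH : ∀ c, Measurable (H c)) (hb : ∀ c y, |H c y| ≤ b) :
    |correlation μ (compList (l ++ l')) fun x => H (itinerary l x)| ≤
      b * ∑ c, mass |transferList l'
        (branchList l c g - mass (branchList l c g) • transferList l g)| := by
  rw [correlation, integral_diagonal_itinerary hg hμ hH hb, integral_prod_itinerary hg hμ hH hb,
    ← Finset.sum_sub_distrib, Finset.mul_sum]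
  refine (Finset.abs_sum_le_sum_abs _ _).trans (Finset.sum_le_sum fun c _ => ?_)
  rw [map_sub]
  exact abs_integral_sub_integral_le_mass
    (integrable_transferList l' (integrable_branchList l hg c))
    (integrable_transferList l' ((integrable_transferList l hg).const_mul _)) (hH c) (hb c)

lemma sum_dist_comp_le_of_itinerary_eq (hβ0 : 0 < β) (hβ : β ≤ 1) (hγ0 : 0 ≤ γ)
    (hγ : β * (γ + 1) < 1) {α : ℕ → ℝ≥0} (hα : ∀ n, 1 ≤ n → (α n : ℝ) ≤ β) {q k : ℕ} {x x' : I}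
    (h : itinerary (paramList α 0 (q + k)) x = itinerary (paramList α 0 (q + k)) x') :
    ∑ i ∈ Finset.range q, dist (comp α i x) (comp α i x') ≤
      closenessConst β γ * ((k : ℝ) + 1) ^ (-γ) := by
  refine le_of_eq_of_le (Finset.sum_congr rfl fun i hi => ?_)
    (sum_dist_le_of_itinerary_eq hβ0 hβ hγ0 hγ (paramList_le _ _ hα) h (length_paramList _ _ _))
  rw [take_paramList _ _ (Nat.le_add_right_of_le (Finset.mem_range.1 hi).le), ← comp_eq_compList,
    ← comp_eq_compList]

lemma comp_add_eq_compList_append (α : ℕ → ℝ≥0) (m n : ℕ) :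
    comp α (m + n) = compList (paramList α 0 m ++ paramList α m n) := by
  funext x
  rw [compList_append, ← comp_eq_compList, comp_add]

lemma add_one_rpow_neg_le (hγ0 : 0 ≤ γ) {k j : ℕ} (hj : k ≤ 2 * j + 1) :
    ((j : ℝ) + 1) ^ (-γ) ≤ 2 ^ γ * ((k : ℝ) + 1) ^ (-γ) := by
  have hhalf : ((k : ℝ) + 1) / 2 ≤ (j : ℝ) + 1 := by
    have : (k : ℝ) ≤ 2 * j + 1 := by exact_mod_cast hj
    linarith
  refine (Real.rpow_le_rpow_of_nonpos (by positivity) hhalf (neg_nonpos.2 hγ0)).trans_eq ?_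
  rw [Real.div_rpow (by positivity) two_pos.le, Real.rpow_neg two_pos.le, div_inv_eq_mul, mul_comm]

/-- Decorrelation at a polynomial rate along the orbit of a `μ`-distributed point: test functions
that are Lipschitz in the first `q` points of the orbit are nearly uncorrelated with the orbit from
time `q + k` on. -/
def Decorrelation (μ : Measure I) (α : ℕ → ℝ≥0) (γ C : ℝ) : Prop :=
  ∀ ⦃q : ℕ⦄ (k : ℕ) ⦃Γ : I → I → ℝ⦄ ⦃b : ℝ⦄, Measurable (Function.uncurry Γ) →
    (∀ x y, |Γ x y| ≤ b) →
    (∀ x x' y, |Γ x y - Γ x' y| ≤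
      b * ∑ i ∈ Finset.range q, dist (comp α i x) (comp α i x')) →
    |correlation μ (comp α (q + k)) Γ| ≤ C * b * ((k : ℝ) + 1) ^ (-γ)

lemma exists_abs_correlation_comp_add_le (hβ0 : 0 < β) (hβ : β ≤ 1 / 3) (hγ0 : 0 < γ)
    (hγ : β * (γ + 1) < 1) :
    ∃ C : ℝ, 0 < C ∧ ∀ {α : ℕ → ℝ≥0}, (∀ n, 1 ≤ n → (α n : ℝ) ≤ β) →
      ∀ {μ : Measure I} [IsProbabilityMeasure μ], HasConeDensity β μ →
      ∀ {q : ℕ} (j j' : ℕ) {Γ : I → I → ℝ} {b : ℝ}, Measurable (Function.uncurry Γ) →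
      (∀ x y, |Γ x y| ≤ b) →
      (∀ x x' y, |Γ x y - Γ x' y| ≤
        b * ∑ i ∈ Finset.range q, dist (comp α i x) (comp α i x')) →
      |correlation μ (comp α (q + j + j')) Γ| ≤
        b * (C * ((j' : ℝ) + 1) ^ (-γ)) +
          2 * (b * (closenessConst β γ * ((j : ℝ) + 1) ^ (-γ))) := by
  obtain ⟨C, hC, hcoup⟩ := exists_coupling_bound hβ0 hβ hγ0 hγ
  refine ⟨C, hC, fun {α} hα {μ} _ hμ {q} j j' {Γ b} hΓm hΓb hΓl => ?_⟩
  obtain ⟨g, hg, hgd, hmass, hgF⟩ := hμ.exists_regularDensity hβ0.le hβ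
  have hb0 : 0 ≤ b := (abs_nonneg _).trans (hΓb 0 0)
  have hΓx (x : I) : Measurable (Γ x) := hΓm.of_uncurry_left
  let l := paramList α 0 (q + j)
  let l' := paramList α (q + j) j'
  let H (c : Fin l.length → Bool) : I → ℝ := Γ (Function.invFun (itinerary l) c)
  have happrox (x y : I) : |Γ x y - H (itinerary l x) y| ≤
      b * (closenessConst β γ * ((j : ℝ) + 1) ^ (-γ)) := by
    refine (hΓl _ _ _).trans (mul_le_mul_of_nonneg_left ?_ hb0)
    exact sum_dist_comp_le_of_itinerary_eq hβ0 (by linarith) hγ0.le hγ hα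
      (Function.invFun_eq ⟨x, rfl⟩).symm
  have hHm : Measurable (Function.uncurry fun x => H (itinerary l x)) :=
    (measurable_from_prod_countable_right (f := Function.uncurry H) fun c =>
      hΓx (Function.invFun (itinerary l) c)).comp ((measurable_itinerary l).prodMap measurable_id)
  have hstep : |correlation μ (compList (l ++ l')) fun x => H (itinerary l x)| ≤
      b * (C * ((j' : ℝ) + 1) ^ (-γ)) := by
    refine (abs_correlation_itinerary_le hg.integrable hgF (fun c => hΓx _)
      fun c => hΓb _).trans (mul_le_mul_of_nonneg_left ?_ hb0)
    have hbound := hcoup (coupled_branchList (l := l) hβ0.le hβ hg hgd hmass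
      (paramList_le _ _ hα)) l' (paramList_le _ _ hα)
    rwa [length_paramList α _ j'] at hbound
  rw [← comp_add_eq_compList_append] at hstep
  exact (abs_correlation_le_add (measurable_comp α _) hΓm hHm hΓb (fun x => hΓb _)
    happrox).trans (add_le_add_left hstep _)

theorem exists_decorrelation (hβ0 : 0 < β) (hβ : β ≤ 1 / 3) (hγ0 : 0 < γ)
    (hγ : β * (γ + 1) < 1) :
    ∃ C : ℝ, 0 < C ∧ ∀ {α : ℕ → ℝ≥0}, (∀ n, 1 ≤ n → (α n : ℝ) ≤ β) →
      ∀ {μ : Measure I} [IsProbabilityMeasure μ], HasConeDensity β μ → Decorrelation μ α γ C := by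
  obtain ⟨C, hC, hcorr⟩ := exists_abs_correlation_comp_add_le hβ0 hβ hγ0 hγ
  have hD := closenessConst_nonneg (γ := γ) hβ0.le
  refine ⟨(C + 2 * closenessConst β γ) * 2 ^ γ, by positivity, ?_⟩
  intro α hα μ _ hμ q k Γ b hΓm hΓb hΓl
  have hb0 : 0 ≤ b := (abs_nonneg _).trans (hΓb 0 0)
  have hsplit := hcorr hα hμ (k / 2) (k - k / 2) hΓm hΓb hΓl
  rw [show q + k / 2 + (k - k / 2) = q + k by omega] at hsplit
  have hhalf := add_one_rpow_neg_le hγ0.le (k := k) (j := k / 2) (by omega)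
  have hhalf' := add_one_rpow_neg_le hγ0.le (k := k) (j := k - k / 2) (by omega)
  refine hsplit.trans ((add_le_add
    (mul_le_mul_of_nonneg_left (mul_le_mul_of_nonneg_left hhalf' hC.le) hb0)
    (mul_le_mul_of_nonneg_left (mul_le_mul_of_nonneg_left
      (mul_le_mul_of_nonneg_left hhalf hD) hb0) zero_le_two)).trans_eq ?_)
  ring

end Decorrelation

section Orbit

variable {α : ℕ → ℝ≥0} {γ C b b₁ b₂ : ℝ} {S S₁ S₂ : Finset ℕ} {χ Q : (ℕ → I) → ℝ}
  {s e k p J : ℕ}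

/-- The orbit of `x` as a random sequence of points. -/
noncomputable def orbit (α : ℕ → ℝ≥0) (x : I) : ℕ → I := fun i => comp α i x

/-- The sequence that follows the orbit of `x` up to time `J` and starts from `y` at time `J`. -/
noncomputable def splice (α : ℕ → ℝ≥0) (J : ℕ) (x y : I) : ℕ → I :=
  fun i => if i < J then comp α i x else compList (paramList α J (i - J)) y

lemma splice_of_lt {i : ℕ} (h : i < J) (x y : I) : splice α J x y i = comp α i x := if_pos h

lemma splice_of_le {i : ℕ} (h : J ≤ i) (x y : I) :
    splice α J x y i = compList (paramList α J (i - J)) y := if_neg h.not_gt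

lemma splice_comp_self (α : ℕ → ℝ≥0) (J : ℕ) (x : I) :
    splice α J x (comp α J x) = orbit α x := by
  funext i
  rcases lt_or_ge i J with h | h
  · exact splice_of_lt h _ _
  · rw [splice_of_le h, ← comp_add, Nat.add_sub_cancel' h, orbit]

lemma measurable_orbit (α : ℕ → ℝ≥0) : Measurable (orbit α) :=
  measurable_pi_iff.2 fun i => measurable_comp α i

lemma measurable_splice (α : ℕ → ℝ≥0) (J : ℕ) :
    Measurable fun z : I × I => splice α J z.1 z.2 := by
  refine measurable_pi_iff.2 fun i => ?_
  rcases lt_or_ge i J with h | h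
  · simp only [splice_of_lt h]
    exact (measurable_comp α i).comp measurable_fst
  · simp only [splice_of_le h]
    exact (measurable_compList _).comp measurable_snd

lemma BoundedLip.abs_sub_splice_le (hQ : BoundedLip b S Q) (hp : p ≤ J)
    (hS : ∀ i ∈ S, i < J → i < p) (x x' y : I) :
    |Q (splice α J x y) - Q (splice α J x' y)| ≤
      b * ∑ i ∈ Finset.range p, dist (comp α i x) (comp α i x') := by
  refine hQ.abs_sub_le_of_eqOn_off (fun i => dist_nonneg) (fun i _ hi => ?_) fun i hiS hi => ?_
  · have hiJ := (Finset.mem_range.1 hi).trans_le hp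
    rw [splice_of_lt hiJ, splice_of_lt hiJ]
  · have hiJ : J ≤ i := not_lt.1 fun h => hi (Finset.mem_range.2 (hS i hiS h))
    rw [splice_of_le hiJ, splice_of_le hiJ]

lemma BoundedLip.splice_eq_orbit (hχ : BoundedLip b S χ) (hS : ∀ i ∈ S, i < J) (x y : I) :
    χ (splice α J x y) = χ (orbit α x) :=
  hχ.eq_of_eqOn fun i hi => splice_of_lt (hS i hi) x y

lemma abs_mul_le_mul {x y a c : ℝ} (hx : |x| ≤ a) (hy : |y| ≤ c) : |x * y| ≤ a * c :=
  (abs_mul x y).trans_le (mul_le_mul hx hy (abs_nonneg _) ((abs_nonneg _).trans hx))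

namespace Decorrelation

variable {μ : Measure I}

lemma nonneg (hμ : Decorrelation μ α γ C) : 0 ≤ C := by
  have h := hμ (q := 0) 0 (Γ := 0) (b := 1) measurable_const (fun _ _ => by simp)
    fun _ _ _ => by simp
  simpa using (abs_nonneg _).trans h

lemma abs_integral_mul_of_past_le (hμ : Decorrelation μ α γ C) (hχ : BoundedLip b₁ S₁ χ)
    (hS₁ : ∀ i ∈ S₁, s ≤ i) (hχ0 : ∫ x, χ (orbit α x) ∂μ = 0) {R : I → ℝ} (hR : Measurable R)
    (hb : ∀ x, |R x| ≤ b₂)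
    (hl : ∀ x x', |R x - R x'| ≤
      b₂ * ∑ i ∈ Finset.range (s - k), dist (comp α i x) (comp α i x')) :
    |∫ x, χ (orbit α x) * R x ∂μ| ≤ C * (b₁ * b₂) * ((k : ℝ) + 1) ^ (-γ) := by
  have hb₁ := hχ.nonneg
  have hb₂ : 0 ≤ b₂ := (abs_nonneg _).trans (hb 0)
  rcases le_or_gt k s with hks | hks
  · let tail (z : I) (i : ℕ) : I := compList (paramList α s (i - s)) z
    have htail : Measurable tail := measurable_pi_iff.2 fun i => measurable_compList _
    have hχtail (x : I) : χ (tail (comp α s x)) = χ (orbit α x) := hχ.eq_of_eqOn fun i hi => by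
      rw [orbit, ← Nat.add_sub_cancel' (hS₁ i hi), comp_add]
      simp only [tail, Nat.add_sub_cancel_left]
    have hcorr := hμ (q := s - k) k (Γ := fun x z => χ (tail z) * R x) (b := b₁ * b₂)
      (((hχ.continuous.measurable.comp htail).comp measurable_snd).mul (hR.comp measurable_fst))
      (fun x z => abs_mul_le_mul (hχ.abs_le _) (hb x))
      (fun x x' z => by
        rw [← mul_sub, mul_assoc]
        exact abs_mul_le_mul (hχ.abs_le _) (hl x x'))
    rw [Nat.sub_add_cancel hks] at hcorr
    simpa only [correlation, hχtail, integral_mul_const, hχ0, zero_mul, integral_zero,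
      sub_zero] using hcorr
  · have hconst (x : I) : R x = R 0 := by
      have hx := hl x 0
      rw [Nat.sub_eq_zero_of_le hks.le, Finset.sum_range_zero, mul_zero] at hx
      exact sub_eq_zero.1 (abs_nonpos_iff.1 hx)
    simp only [hconst, integral_mul_const, hχ0, zero_mul, abs_zero]
    exact mul_nonneg (mul_nonneg hμ.nonneg (mul_nonneg hb₁ hb₂)) (by positivity)

variable [IsProbabilityMeasure μ]

lemma abs_integral_integral_mul_splice_le (hμ : Decorrelation μ α γ C) (hχ : BoundedLip b₁ S₁ χ)
    (hQ : BoundedLip b₂ S₂ Q) (hS₁ : ∀ i ∈ S₁, s ≤ i) (hsJ : s - k ≤ J)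
    (hS₂ : ∀ i ∈ S₂, i < J → i < s - k) (hχ0 : ∫ x, χ (orbit α x) ∂μ = 0) {T : I → I}
    (hT : Measurable T) :
    |∫ x, ∫ x', χ (orbit α x) * Q (splice α J x (T x')) ∂μ ∂μ| ≤
      C * (b₁ * b₂) * ((k : ℝ) + 1) ^ (-γ) := by
  have hint : Integrable (Function.uncurry fun x x' => χ (orbit α x) * Q (splice α J x (T x')))
      (μ.prod μ) :=
    integrable_of_abs_le
      (((hχ.continuous.measurable.comp (measurable_orbit α)).comp measurable_fst).mul
        (hQ.continuous.measurable.comp ((measurable_splice α J).comp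
          (measurable_fst.prodMk (hT.comp measurable_snd)))))
      fun z => abs_mul_le_mul (hχ.abs_le (orbit α z.1)) (hQ.abs_le (splice α J z.1 (T z.2)))
  rw [integral_integral_swap hint]
  exact abs_integral_le_of_forall fun x' => hμ.abs_integral_mul_of_past_le hχ hS₁ hχ0
    (hQ.continuous.measurable.comp
      ((measurable_splice α J).comp (measurable_id.prodMk measurable_const)))
    (fun x => hQ.abs_le _) fun x y => hQ.abs_sub_splice_le hsJ hS₂ x y (T x')

/-- First the coordinates after the window are made independent of the others; then, with those
frozen, the window is separated from the coordinates before it. -/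
lemma abs_integral_mul_le (hμ : Decorrelation μ α γ C) (hχ : BoundedLip b₁ S₁ χ)
    (hQ : BoundedLip b₂ S₂ Q) (hS₁ : ∀ i ∈ S₁, s ≤ i ∧ i ≤ e) (hse : s ≤ e)
    (hS₂ : ∀ i ∈ S₂, i + k < s ∨ e + k < i) (hχ0 : ∫ x, χ (orbit α x) ∂μ = 0) :
    |∫ x, χ (orbit α x) * Q (orbit α x) ∂μ| ≤ 3 * (C * (b₁ * b₂)) * ((k : ℝ) + 1) ^ (-γ) := by
  set J := e + 1 + k with hJ
  have hprod : BoundedLip (2 * (b₁ * b₂)) (S₁ ∪ S₂) fun ω => χ ω * Q ω :=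
    (hχ.mono le_rfl Finset.subset_union_left).mul (hQ.mono le_rfl Finset.subset_union_right)
  have hS₂J (i : ℕ) (hi : i ∈ S₂) (hiJ : i < J) : i < s - k := by
    have := hS₂ i hi
    omega
  have hS₁J (i : ℕ) (hi : i ∈ S₁) : i < J := by
    have := hS₁ i hi
    omega
  have hunion (i : ℕ) (hi : i ∈ S₁ ∪ S₂) (hiJ : i < J) : i < e + 1 := by
    rcases Finset.mem_union.1 hi with hi | hi
    · exact Nat.lt_succ_of_le (hS₁ i hi).2
    · have := hS₂J i hi hiJ
      omega
  have hfuture := hμ (q := e + 1) k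
    (Γ := fun x y => χ (splice α J x y) * Q (splice α J x y))
    (hprod.continuous.measurable.comp (measurable_splice α J)) (fun x y => hprod.abs_le _)
    (hprod.abs_sub_splice_le (Nat.le_add_right _ _) hunion)
  have hpast := hμ.abs_integral_integral_mul_splice_le hχ hQ (fun i hi => (hS₁ i hi).1)
    (by omega) hS₂J hχ0 (measurable_comp α J)
  simp only [correlation, ← hJ, splice_comp_self, hχ.splice_eq_orbit hS₁J] at hfuture
  linarith [abs_sub_abs_le_abs_sub (∫ x, χ (orbit α x) * Q (orbit α x) ∂μ)
    (∫ x, ∫ x', χ (orbit α x) * Q (splice α J x (comp α J x')) ∂μ ∂μ)]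

theorem mixing_map_orbit (hμ : Decorrelation μ α γ C) (hγ : 0 ≤ γ) :
    Mixing (μ.map (orbit α)) γ (3 * C * 2 ^ γ + 1) := by
  intro s e k b₁ b₂ S₁ S₂ χ Q hχ hQ hS₁ hse hS₂ hχ0
  have hC := hμ.nonneg
  have hb := mul_nonneg hχ.nonneg hQ.nonneg
  rw [integral_map (measurable_orbit α).aemeasurable
    hχ.continuous.measurable.aestronglyMeasurable] at hχ0
  rw [integral_map (f := fun ω => χ ω * Q ω) (measurable_orbit α).aemeasurable
    (hχ.continuous.mul hQ.continuous).measurable.aestronglyMeasurable]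
  rcases k with _ | k
  · have htriv : |∫ x, χ (orbit α x) * Q (orbit α x) ∂μ| ≤ b₁ * b₂ :=
      abs_integral_le_of_forall fun x => abs_mul_le_mul (hχ.abs_le _) (hQ.abs_le _)
    have hpos : 0 ≤ 3 * C * 2 ^ γ * (b₁ * b₂) := by positivity
    simp only [Nat.cast_zero, zero_add, Real.one_rpow, mul_one]
    linarith
  · have hgap := hμ.abs_integral_mul_le hχ hQ hS₁ hse
      (fun i hi => (hS₂ i hi).imp (by omega) (by omega)) hχ0 (k := k)
    have hrate := mul_le_mul_of_nonneg_left
      (add_one_rpow_neg_le hγ (k := k + 1) (j := k) (by omega))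
      (mul_nonneg zero_le_three (mul_nonneg hC hb))
    have hpos := mul_nonneg hb (Real.rpow_nonneg (by positivity : (0 : ℝ) ≤ (k + 1 : ℕ) + 1) (-γ))
    linarith

end Decorrelation

end Orbit

section TestFunctions

variable {d k : ℕ} {M : ℝ≥0} {h : (Fin d → ℝ) → ℝ}

lemma enorm_le_coe_iff {x : ℝ} {L : ℝ≥0} : ‖x‖ₑ ≤ (L : ℝ≥0∞) ↔ |x| ≤ L := by
  rw [enorm_le_coe, ← NNReal.coe_le_coe, coe_nnnorm, Real.norm_eq_abs]

/-- The iterated partial derivative of `h` in the coordinate directions listed by `i`. -/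
noncomputable def iterPartial (h : (Fin d → ℝ) → ℝ) (i : Fin k → Fin d) (x : Fin d → ℝ) : ℝ :=
  iteratedFDeriv ℝ k h x fun j => Pi.single (i j) 1

lemma iterPartial_zero (i : Fin 0 → Fin d) : iterPartial h i = h :=
  funext fun _ => iteratedFDeriv_zero_apply _

lemma abs_iterPartial_le (hM : derivNorm k h ≤ M) (i : Fin k → Fin d) (x : Fin d → ℝ) :
    |iterPartial h i x| ≤ M :=
  enorm_le_coe_iff.1 ((le_iSup₂ (f := fun (i : Fin k → Fin d) (x : Fin d → ℝ) =>
    ‖iteratedFDeriv ℝ k h x (fun j => Pi.single (i j) 1)‖ₑ) i x).trans hM)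

namespace ThriceDifferentiable

lemma hasFDerivAt_iterPartial (hh : ThriceDifferentiable h) (hk : k < 3) (i : Fin k → Fin d)
    (x : Fin d → ℝ) :
    HasFDerivAt (iterPartial h i)
      ((ContinuousMultilinearMap.apply ℝ (fun _ : Fin k => Fin d → ℝ) ℝ
        (fun j => Pi.single (i j) 1)).comp (fderiv ℝ (iteratedFDeriv ℝ k h) x)) x :=
  (ContinuousMultilinearMap.apply ℝ (fun _ : Fin k => Fin d → ℝ) ℝ
    (fun j => Pi.single (i j) 1)).hasFDerivAt.comp x (hh k hk x).hasFDerivAt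

lemma differentiable_iterPartial (hh : ThriceDifferentiable h) (hk : k < 3) (i : Fin k → Fin d) :
    Differentiable ℝ (iterPartial h i) :=
  fun x => (hh.hasFDerivAt_iterPartial hk i x).differentiableAt

lemma differentiable (hh : ThriceDifferentiable h) : Differentiable ℝ h :=
  iterPartial_zero (h := h) Fin.elim0 ▸ hh.differentiable_iterPartial three_pos _

lemma partialDeriv_iterPartial (hh : ThriceDifferentiable h) (hk : k < 3) (i : Fin k → Fin d)
    (b : Fin d) :
    partialDeriv (iterPartial h i) b = iterPartial h (Fin.cons b i : Fin (k + 1) → Fin d) := by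
  ext x
  rw [partialDeriv, (hh.hasFDerivAt_iterPartial hk i x).fderiv, iterPartial,
    iteratedFDeriv_succ_apply_left]
  rfl

lemma partialDeriv_eq_iterPartial (hh : ThriceDifferentiable h) (a : Fin d) :
    partialDeriv h a = iterPartial h (fun _ : Fin 1 => a) := by
  have hstep := hh.partialDeriv_iterPartial three_pos Fin.elim0 a
  rw [iterPartial_zero] at hstep
  exact hstep.trans (congrArg _ (funext fun j => by rw [Fin.fin_one_eq_zero j, Fin.cons_zero]))

lemma norm_fderiv_iterPartial_le (hh : ThriceDifferentiable h) (hk : k < 3)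
    (hM : derivNorm (k + 1) h ≤ M) (i : Fin k → Fin d) (x : Fin d → ℝ) :
    ‖fderiv ℝ (iterPartial h i) x‖ ≤ d * M :=
  norm_le_of_apply_single_le M.2 fun b =>
    (congrArg abs (congrFun (hh.partialDeriv_iterPartial hk i b) x)).trans_le
      (abs_iterPartial_le hM _ x)

lemma abs_iterPartial_sub_le (hh : ThriceDifferentiable h) (hk : k < 3)
    (hM : derivNorm (k + 1) h ≤ M) (i : Fin k → Fin d) (x y : Fin d → ℝ) :
    |iterPartial h i x - iterPartial h i y| ≤ d * M * ‖x - y‖ :=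
  convex_univ.norm_image_sub_le_of_norm_fderiv_le (𝕜 := ℝ)
    (fun z _ => hh.differentiable_iterPartial hk i z)
    (fun z _ => hh.norm_fderiv_iterPartial_le hk hM i z) (Set.mem_univ y) (Set.mem_univ x)

lemma norm_fderiv_iterPartial_sub_le (hh : ThriceDifferentiable h) (hk : k + 1 < 3)
    (hM : derivNorm (k + 2) h ≤ M) (i : Fin k → Fin d) (x y : Fin d → ℝ) :
    ‖fderiv ℝ (iterPartial h i) x - fderiv ℝ (iterPartial h i) y‖ ≤ d ^ 2 * M * ‖x - y‖ := by
  refine (norm_le_of_apply_single_le (c := d * M * ‖x - y‖) (by positivity)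
    fun b => ?_).trans_eq (by ring)
  have hcons := hh.partialDeriv_iterPartial (k.lt_succ_self.trans hk) i b
  calc |(fderiv ℝ (iterPartial h i) x - fderiv ℝ (iterPartial h i) y) (Pi.single b 1)|
      = |iterPartial h (Fin.cons b i : Fin (k + 1) → Fin d) x -
          iterPartial h (Fin.cons b i : Fin (k + 1) → Fin d) y| := by rw [← hcons]; rfl
    _ ≤ d * M * ‖x - y‖ := hh.abs_iterPartial_sub_le hk hM _ x y

lemma smoothTest (hh : ThriceDifferentiable h) (hM : ∀ k ∈ Finset.Icc 1 3, derivNorm k h ≤ M) :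
    SmoothTest ((d : ℝ) ^ 2 * M) h where
  differentiable := hh.differentiable
  smoothBounded_partialDeriv a := by
    have hd : (1 : ℝ) ≤ d := Nat.one_le_cast.2 a.pos
    have hM0 : (0 : ℝ) ≤ M := M.2
    rw [hh.partialDeriv_eq_iterPartial]
    exact
      { differentiable := hh.differentiable_iterPartial (by norm_num) _
        abs_le := fun w => (abs_iterPartial_le (hM 1 (by simp)) _ w).trans
          (le_mul_of_one_le_left hM0 (one_le_pow₀ hd))
        norm_fderiv_le := fun w =>
          (hh.norm_fderiv_iterPartial_le (by norm_num) (hM 2 (by simp)) _ w).trans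
            (mul_le_mul_of_nonneg_right (le_self_pow₀ hd two_ne_zero) hM0)
        norm_fderiv_sub_le := fun w w' =>
          hh.norm_fderiv_iterPartial_sub_le (by norm_num) (hM 3 (by simp)) _ w w' }

end ThriceDifferentiable

end TestFunctions

section Observables

variable {d : ℕ} {f : I → Fin d → ℝ} {L : ℝ≥0}

lemma abs_le_of_lipNorm_le (hf : lipNorm f ≤ L) (x : I) (a : Fin d) : |f x a| ≤ L :=
  enorm_le_coe_iff.1 ((le_iSup₂ (f := fun (a : Fin d) (x : I) => ‖f x a‖ₑ) a x).trans
    (le_self_add.trans hf))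

lemma abs_sub_le_of_lipNorm_le (hf : lipNorm f ≤ L) (x y : I) (a : Fin d) :
    |f x a - f y a| ≤ L * dist x y := by
  rcases eq_or_ne x y with rfl | hxy
  · simp
  have hquot : ‖f x a - f y a‖ₑ / edist x y ≤ L := by
    refine le_trans ?_ (le_add_self.trans hf)
    refine le_trans ?_ (le_iSup₂ (f := fun (a : Fin d) (x : I) =>
      ⨆ (y : I) (_ : x ≠ y), ‖f x a - f y a‖ₑ / edist x y) a x)
    exact le_iSup₂ (f := fun (y : I) (_ : x ≠ y) => ‖f x a - f y a‖ₑ / edist x y) y hxy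
  rw [ENNReal.div_le_iff (edist_pos.2 hxy).ne' (edist_ne_top x y), edist_nndist,
    ← ENNReal.coe_mul, enorm_le_coe_iff] at hquot
  simpa using hquot

lemma norm_le_of_lipNorm_le (hf : lipNorm f ≤ L) (x : I) : ‖f x‖ ≤ L :=
  (pi_norm_le_iff_of_nonneg L.2).2 fun a => abs_le_of_lipNorm_le hf x a

lemma norm_sub_le_of_lipNorm_le (hf : lipNorm f ≤ L) (x y : I) : ‖f x - f y‖ ≤ L * dist x y :=
  (pi_norm_le_iff_of_nonneg (by positivity)).2 fun a => abs_sub_le_of_lipNorm_le hf x y a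

lemma continuous_of_lipNorm_le (hf : lipNorm f ≤ L) : Continuous f := by
  have hlip : LipschitzWith L f := LipschitzWith.of_dist_le_mul fun x y => by
    rw [dist_eq_norm]
    exact norm_sub_le_of_lipNorm_le hf x y
  exact hlip.continuous

variable {α : ℕ → ℝ≥0} {μ : Measure I} {N : ℕ}

/-- The centred and normalized observables `N^{-1/2} (f - ∫ f ∘ T̃_i dμ)`, whose sum along an orbit
is `W(N)`. -/
noncomputable def centered (α : ℕ → ℝ≥0) (μ : Measure I) (f : I → Fin d → ℝ) (N i : ℕ) (y : I) :
    Fin d → ℝ :=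
  (1 / √(N : ℝ)) • (f y - ∫ x, f (comp α i x) ∂μ)

lemma partialSum_centered_orbit (α : ℕ → ℝ≥0) (μ : Measure I) (f : I → Fin d → ℝ) (N : ℕ) (x : I) :
    partialSum (centered α μ f N) (Finset.range N) (orbit α x) = W α μ f N x :=
  Finset.smul_sum.symm

variable [IsProbabilityMeasure μ]

lemma uniformLip_centered (hf : lipNorm f ≤ L) :
    UniformLip (1 / √(N : ℝ) * (2 * L)) (centered α μ f N) where
  norm_le i y := by
    have hmean : ‖∫ x, f (comp α i x) ∂μ‖ ≤ L := by
      simpa using norm_integral_le_of_norm_le_const (μ := μ)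
        (ae_of_all _ fun x => norm_le_of_lipNorm_le hf (comp α i x))
    rw [centered, norm_smul, Real.norm_of_nonneg (by positivity), two_mul]
    gcongr
    exact (norm_sub_le _ _).trans (add_le_add (norm_le_of_lipNorm_le hf y) hmean)
  norm_sub_le i y y' := by
    rw [centered, centered, ← smul_sub, sub_sub_sub_cancel_right, norm_smul,
      Real.norm_of_nonneg (by positivity), mul_assoc]
    gcongr
    refine (norm_sub_le_of_lipNorm_le hf y y').trans ?_
    gcongr
    exact le_mul_of_one_le_left L.2 one_le_two

lemma integrable_comp_of_lipNorm_le (hf : lipNorm f ≤ L) (i : ℕ) :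
    Integrable (fun x => f (comp α i x)) μ :=
  Integrable.of_bound
    ((continuous_of_lipNorm_le hf).measurable.comp (measurable_comp α i)).aestronglyMeasurable
    L (ae_of_all _ fun _ => norm_le_of_lipNorm_le hf _)

lemma integral_centered_map_orbit (hf : lipNorm f ≤ L) (i : ℕ) (a : Fin d) :
    ∫ ω, centered α μ f N i (ω i) a ∂(μ.map (orbit α)) = 0 := by
  have hcont : Continuous fun ω : ℕ → I => centered α μ f N i (ω i) a :=
    ((uniformLip_centered hf).boundedLip_apply i a).continuous
  have hint : Integrable (fun x => f (comp α i x)) μ := integrable_comp_of_lipNorm_le hf i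
  have heval : (∫ x, f (comp α i x) ∂μ) a = ∫ x, f (comp α i x) a ∂μ := eval_integral hint.eval a
  rw [integral_map (measurable_orbit α).aemeasurable hcont.aestronglyMeasurable]
  change ∫ x, 1 / √(N : ℝ) * (f (comp α i x) a - (∫ x, f (comp α i x) ∂μ) a) ∂μ = 0
  rw [integral_const_mul, integral_sub (hint.eval a) (integrable_const _), heval]
  simp

lemma map_partialSum_centered (hf : lipNorm f ≤ L) :
    (μ.map (orbit α)).map (partialSum (centered α μ f N) (Finset.range N)) =
      μ.map (W α μ f N) := by
  rw [Measure.map_map ((uniformLip_centered hf).continuous_partialSum _).measurable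
    (measurable_orbit α)]
  exact congrArg (fun F => μ.map F) (funext (partialSum_centered_orbit α μ f N))

lemma covMat_eq_integral_map_orbit (hf : lipNorm f ≤ L) :
    covMat α μ f N = Matrix.of fun a b =>
      ∫ ω, partialSum (centered α μ f N) (Finset.range N) ω a *
        partialSum (centered α μ f N) (Finset.range N) ω b ∂(μ.map (orbit α)) := by
  have hsum := (uniformLip_centered (α := α) (μ := μ) (N := N) hf).continuous_partialSum
    (Finset.range N)
  ext a b
  have hprod : Continuous fun ω => partialSum (centered α μ f N) (Finset.range N) ω a *
    partialSum (centered α μ f N) (Finset.range N) ω b := by fun_prop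
  rw [Matrix.of_apply, integral_map (measurable_orbit α).aemeasurable hprod.aestronglyMeasurable]
  simp only [partialSum_centered_orbit]
  rfl

lemma measurable_W (hf : lipNorm f ≤ L) : Measurable (W α μ f N) := by
  have hsum := (uniformLip_centered (α := α) (μ := μ) (N := N) hf).continuous_partialSum
    (Finset.range N)
  exact (funext (partialSum_centered_orbit α μ f N)) ▸ hsum.measurable.comp (measurable_orbit α)

lemma exists_norm_W_le (hf : lipNorm f ≤ L) : ∃ B, ∀ x, ‖W α μ f N x‖ ≤ B :=
  ⟨∑ _i ∈ Finset.range N, 1 / √(N : ℝ) * (2 * L), fun x => by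
    rw [← partialSum_centered_orbit]
    exact norm_sum_le_of_le _ fun i _ => (uniformLip_centered hf).norm_le i _⟩

lemma posSemidef_integral_mul {Ω : Type*} [MeasurableSpace Ω] {P : Measure Ω} {X : Ω → Fin d → ℝ}
    (hX : ∀ a b, Integrable (fun ω => X ω a * X ω b) P) :
    (Matrix.of fun a b => ∫ ω, X ω a * X ω b ∂P).PosSemidef := by
  refine Matrix.PosSemidef.of_dotProduct_mulVec_nonneg ?_ fun y => ?_
  · ext a b
    simp [mul_comm]
  · have hquad : star y ⬝ᵥ (Matrix.of fun a b => ∫ ω, X ω a * X ω b ∂P).mulVec y =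
        ∫ ω, (∑ a, y a * X ω a) ^ 2 ∂P := by
      have hint : ∀ a b, Integrable (fun ω => y a * X ω a * (y b * X ω b)) P := fun a b =>
        ((hX a b).const_mul (y a * y b)).congr (ae_of_all _ fun ω => by ring)
      simp only [sq, Finset.sum_mul_sum]
      rw [integral_finsetSum _ fun a _ => integrable_finsetSum _ fun b _ => hint a b]
      refine Finset.sum_congr rfl fun a _ => ?_
      rw [integral_finsetSum _ fun b _ => hint a b, star_trivial, Matrix.mulVec, dotProduct,
        Finset.mul_sum]
      refine Finset.sum_congr rfl fun b _ => ?_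
      rw [Matrix.of_apply, ← integral_mul_const, ← integral_const_mul]
      exact integral_congr_ae (ae_of_all _ fun ω => by ring)
    rw [hquad]
    exact integral_nonneg fun _ => sq_nonneg _

lemma posSemidef_covMat (hf : lipNorm f ≤ L) : (covMat α μ f N).PosSemidef := by
  obtain ⟨B, hB⟩ := exists_norm_W_le (α := α) (μ := μ) (N := N) hf
  have hW : Measurable (W α μ f N) := measurable_W hf
  refine posSemidef_integral_mul fun a b =>
    integrable_of_abs_le (b := B * B) (by fun_prop) fun x => ?_
  exact abs_mul_le_mul ((norm_le_pi_norm _ a).trans (hB x)) ((norm_le_pi_norm _ b).trans (hB x))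

end Observables

section NormalApproximation

variable {d N : ℕ} {f : I → Fin d → ℝ} {h : (Fin d → ℝ) → ℝ} {L : ℝ≥0} {β β' γ C M : ℝ}
  {α : ℕ → ℝ≥0} {μ : Measure I}

lemma cone_subset_cone (hβ0 : 0 ≤ β) (hβ : β ≤ β') : cone β ⊆ cone β' := by
  rintro g ⟨hcont, hint, hnonneg, hanti, hmono, hbound⟩
  refine ⟨hcont, hint, hnonneg, hanti, fun x hx y hy hxy => ?_, fun x hx => ?_⟩
  · have hsplit : ∀ z ∈ Set.Ioc (0 : ℝ) 1,
        z ^ (β' + 1) * g z = z ^ (β' - β) * (z ^ (β + 1) * g z) := fun z hz => by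
      rw [← mul_assoc, ← Real.rpow_add hz.1]
      ring_nf
    simp only [hsplit x hx, hsplit y hy]
    exact mul_le_mul (Real.rpow_le_rpow hx.1.le hxy (sub_nonneg.2 hβ)) (hmono hx hy hxy)
      (mul_nonneg (Real.rpow_nonneg hx.1.le _) (hnonneg x hx)) (Real.rpow_nonneg hy.1.le _)
  · refine (hbound x hx).trans ?_
    have hmass : 0 ≤ ∫ y in Set.Ioc (0 : ℝ) 1, g y := setIntegral_nonneg measurableSet_Ioc hnonneg
    have hpow : x ^ (-β) ≤ x ^ (-β') :=
      Real.rpow_le_rpow_of_exponent_ge hx.1 hx.2 (neg_le_neg hβ)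
    have hcoeff : 2 ^ β * (2 + β) ≤ 2 ^ β' * (2 + β') :=
      mul_le_mul (Real.rpow_le_rpow_of_exponent_le one_le_two hβ) (by linarith) (by linarith)
        (by positivity)
    refine mul_le_mul_of_nonneg_right (mul_le_mul hcoeff hpow (Real.rpow_nonneg hx.1.le _) ?_) hmass
    exact mul_nonneg (by positivity) (by linarith)

lemma HasConeDensity.mono (hμ : HasConeDensity β μ) (hβ0 : 0 ≤ β) (hβ : β ≤ β') :
    HasConeDensity β' μ :=
  hμ.imp fun _ => And.imp_left fun hg => cone_subset_cone hβ0 hβ hg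

variable [IsProbabilityMeasure μ]

lemma Decorrelation.steinApprox_map_W (hμ : Decorrelation μ α γ C) (hγ : 2 < γ)
    (hf : lipNorm f ≤ L) :
    SteinApprox M (N * ((3 * C * 2 ^ γ + 1) * M * (1 / √(N : ℝ) * (2 * L)) ^ 3 *
      (4 + d * (16 + 16 * decaySum γ)) * decaySum γ)) (covMat α μ f N) (μ.map (W α μ f N)) := by
  have : IsProbabilityMeasure (μ.map (orbit α)) :=
    Measure.isProbabilityMeasure_map (measurable_orbit α).aemeasurable
  rw [covMat_eq_integral_map_orbit hf, ← map_partialSum_centered hf]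
  exact (hμ.mixing_map_orbit (by linarith)).steinApprox_map_partialSum hγ (uniformLip_centered hf)
    (integral_centered_map_orbit hf) N

/-- The constant in the normal approximation of `W(N)` under `Decorrelation μ α γ C`, for
observables with `‖f‖_Lip ≤ L` and test functions of class `SmoothTest M`. -/
noncomputable def approxConst (d : ℕ) (γ C L M : ℝ) : ℝ :=
  d * ((3 * C * 2 ^ γ + 1) * M * (2 * L) ^ 3 * (4 + d * (16 + 16 * decaySum γ)) * decaySum γ) *
    (Real.pi / 2)

lemma approxConst_nonneg {L : ℝ} (d : ℕ) (γ : ℝ) (hC : 0 ≤ C) (hL : 0 ≤ L) (hM : 0 ≤ M) :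
    0 ≤ approxConst d γ C L M := by
  have hdecay := decaySum_nonneg γ
  unfold approxConst
  positivity

theorem Decorrelation.abs_integral_sub_gaussianExp_le (hμ : Decorrelation μ α γ C) (hγ : 2 < γ)
    (hf : lipNorm f ≤ L) (hh : SmoothTest M h) (hN : 1 ≤ N) :
    |(∫ x, h (W α μ f N x) ∂μ) - gaussianExp (covMat α μ f N) h| ≤
      approxConst d γ C L M * (N : ℝ) ^ (-(1 / 2) : ℝ) := by
  have hW : Measurable (W α μ f N) := measurable_W hf
  have hcont := hh.differentiable.continuous
  have : IsProbabilityMeasure (μ.map (W α μ f N)) :=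
    Measure.isProbabilityMeasure_map hW.aemeasurable
  obtain ⟨B, hB⟩ := exists_norm_W_le (α := α) (μ := μ) (N := N) hf
  have hintW : Integrable (fun w => ‖w‖) (μ.map (W α μ f N)) :=
    (integrable_map_measure (by fun_prop) hW.aemeasurable).2
      (integrable_of_abs_le (by fun_prop) fun x => (abs_norm _).trans_le (hB x))
  have hbound := hh.abs_integral_sub_integral_le (hμ.steinApprox_map_W hγ hf)
    (steinApprox_normalLaw (posSemidef_covMat hf)) hintW integrable_norm_normalLaw
  rw [integral_map hW.aemeasurable hcont.aestronglyMeasurable,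
    ← gaussianExp_eq_integral_normalLaw hcont] at hbound
  refine hbound.trans_eq ?_
  have hN0 : (0 : ℝ) < N := Nat.cast_pos.2 hN
  have hrate : (N : ℝ) * (1 / √(N : ℝ)) ^ 3 = (N : ℝ) ^ (-(1 / 2) : ℝ) := by
    rw [Real.rpow_neg hN0.le, ← Real.sqrt_eq_rpow]
    field_simp
    rw [Real.sq_sqrt hN0.le]
  rw [approxConst, ← hrate]
  ring

end NormalApproximation

section Rates

variable {β : ℝ}

lemma exists_decorrelation_two_lt (hβ : β < 1 / 3) :
    ∃ γ > 2, ∃ C : ℝ, 0 < C ∧ ∀ {α : ℕ → ℝ≥0}, (∀ n, 1 ≤ n → (α n : ℝ) ≤ β) →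
      ∀ {μ : Measure I} [IsProbabilityMeasure μ], HasConeDensity β μ → Decorrelation μ α γ C := by
  -- Any exponent `γ < 1 / β' - 1` is available, and `1 / β' - 1 > 2` because `β' < 1 / 3`.
  set β' := max β (1 / 4)
  have hββ' : β ≤ β' := le_max_left _ _
  have hβ'0 : 0 < β' := lt_max_of_lt_right (by norm_num)
  have hβ' : β' < 1 / 3 := max_lt hβ (by norm_num)
  have hinv : 3 < 1 / β' := by
    rw [lt_div_iff₀ hβ'0]
    linarith
  have hγ : β' * ((1 / β' + 1) / 2 + 1) < 1 := by
    field_simp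
    linarith
  obtain ⟨C, hC, hdec⟩ := exists_decorrelation hβ'0 hβ'.le (by linarith) hγ
  refine ⟨_, by linarith, C, hC, fun hα _ _ hμ => hdec (fun n hn => (hα n hn).trans hββ') ?_⟩
  exact hμ.mono ((NNReal.coe_nonneg _).trans (hα 1 le_rfl)) hββ'

lemma rpow_neg_half_le {N : ℕ} (hβ0 : 0 < β) (hN : 2 ≤ N) :
    (N : ℝ) ^ (-(1 / 2) : ℝ) ≤
      (Real.log 2 ^ (1 / β))⁻¹ * (N : ℝ) ^ (β - 1 / 2) * Real.log N ^ (1 / β) := by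
  have hN2 : (2 : ℝ) ≤ N := Nat.ofNat_le_cast.2 hN
  have hpow : (N : ℝ) ^ (-(1 / 2) : ℝ) ≤ (N : ℝ) ^ (β - 1 / 2) :=
    Real.rpow_le_rpow_of_exponent_le (by linarith) (by linarith)
  have hlog : 1 ≤ (Real.log 2 ^ (1 / β))⁻¹ * Real.log N ^ (1 / β) := by
    rw [inv_mul_eq_div, one_le_div (by positivity)]
    gcongr
  calc (N : ℝ) ^ (-(1 / 2) : ℝ) ≤ (N : ℝ) ^ (β - 1 / 2) * 1 := by rwa [mul_one]
    _ ≤ (N : ℝ) ^ (β - 1 / 2) * ((Real.log 2 ^ (1 / β))⁻¹ * Real.log N ^ (1 / β)) := by gcongr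
    _ = (Real.log 2 ^ (1 / β))⁻¹ * (N : ℝ) ^ (β - 1 / 2) * Real.log N ^ (1 / β) := by ring

end Rates

end Intermittent

theorem theorem1_general (β : ℝ) (hβ : β < 1 / 3) (d : ℕ) (L M : ℝ≥0) :
    ∃ C : ℝ, 0 < C ∧
      ∀ (α : ℕ → ℝ≥0), (∀ n, 1 ≤ n → (α n : ℝ) ≤ β) →
      ∀ (μ : Measure I), IsProbabilityMeasure μ → Intermittent.HasConeDensity β μ →
      ∀ (N : ℕ), 1 ≤ N →
      ∀ (f : I → Fin d → ℝ), Intermittent.lipNorm f ≤ L →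
      ∀ (h : (Fin d → ℝ) → ℝ), Intermittent.ThriceDifferentiable h →
        (∀ k ∈ Finset.Icc 1 3, Intermittent.derivNorm k h ≤ M) →
        |(∫ x, h (Intermittent.W α μ f N x) ∂μ) -
            Intermittent.gaussianExp (Intermittent.covMat α μ f N) h|
          ≤ C * (N : ℝ) ^ (-(1 / 2) : ℝ) := by
  obtain ⟨γ, hγ, C, hC, hdec⟩ := Intermittent.exists_decorrelation_two_lt hβ
  have hK := Intermittent.approxConst_nonneg d γ hC.le L.2
    (by positivity : (0 : ℝ) ≤ (d : ℝ) ^ 2 * M)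
  refine ⟨Intermittent.approxConst d γ C L ((d : ℝ) ^ 2 * M) + 1, by positivity, ?_⟩
  intro α hα μ _ hμ N hN f hf h hh hM
  refine ((hdec hα hμ).abs_integral_sub_gaussianExp_le hγ hf (hh.smoothTest hM) hN).trans ?_
  gcongr
  exact le_add_of_nonneg_right zero_le_one

theorem theorem1 (β : ℝ) (hβ0 : 0 < β) (hβ : β < 1 / 3) (d : ℕ) (hd : 1 ≤ d) (L M : ℝ≥0) :
    ∃ C : ℝ, 0 < C ∧
      ∀ (α : ℕ → ℝ≥0), (∀ n, 1 ≤ n → (α n : ℝ) ≤ β) →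
      ∀ (μ : Measure I), IsProbabilityMeasure μ → Intermittent.HasConeDensity β μ →
      ∀ (N : ℕ), 2 ≤ N →
      ∀ (f : I → Fin d → ℝ), Intermittent.lipNorm f ≤ L →
        (Intermittent.covMat α μ f N).PosDef →
      ∀ (h : (Fin d → ℝ) → ℝ), Intermittent.ThriceDifferentiable h →
        (∀ k ∈ Finset.Icc 1 3, Intermittent.derivNorm k h ≤ M) →
        |(∫ x, h (Intermittent.W α μ f N x) ∂μ) -
            Intermittent.gaussianExp (Intermittent.covMat α μ f N) h|
          ≤ C * (N : ℝ) ^ (β - 1 / 2) * Real.log N ^ (1 / β) := by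
  obtain ⟨C, hC, hgeneral⟩ := theorem1_general β hβ d L M
  refine ⟨C * (Real.log 2 ^ (1 / β))⁻¹,
    mul_pos hC (inv_pos.2 (Real.rpow_pos_of_pos (Real.log_pos one_lt_two) _)), ?_⟩
  intro α hα μ hprob hμ N hN f hf _ h hh hM
  refine (hgeneral α hα μ hprob hμ N (one_le_two.trans hN) f hf h hh hM).trans ?_
  exact (mul_le_mul_of_nonneg_left (Intermittent.rpow_neg_half_le hβ0 hN) hC.le).trans_eq (by ring)
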